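/- **Definitions.** For $x_1,x_2>0$ with $x_1+x_2<\pi/2$ let $T_{(x_1,x_2)}$ be the (obtuse) triangle with sides labelled $1,2,3$ whose angles opposite to sides $1$ and $2$ are $x_1$ and $x_2$ radians. For a finite word $W$ in the digits $1,2,3$ the orbit tile $O(W)$ is the set of all such points $(x_1,x_2)$ for which $T_{(x_1,x_2)}$ has a periodic billiard path that, over one period, hits the sides in the order given by $W$ (so that its successive sides are given by the periodic repetition of $W$). Write $w^-$ for the word $w$ with its last digit removed. For integers $n\ge 3$ and $k\ge 0$ put $u=(23)^{n-1}(13)^{n-1}$, $v=(13)^{n-1}(23)^{n-1}$ and let $W_{nk}$ be the concatenation $$W_{nk}=\bigl[u^{k+2}\bigr]^-\,\bigl[(23)^n v^{k+1}\bigr]^-\,\bigl[(13)^n u^k (23)^n\bigr]^-\,\bigl[v^{k+1}(13)^n\bigr]^- .$$ Let $V_n=(\pi/2n,\pi/2n)$. **Theorem 1.6.** Let $n\ge 3$ be an integer, and for $k\ge 1$ let $S_{nk}(X)=\zeta_n k^2\,(X-V_n)$ be the dilation of $\mathbb R^2$ that maps $V_n$ to $0$ and expands distances by the factor $\zeta_n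 k^2$, where $\zeta_n=2(n-1)\cot(\pi/2n)$. Put $$a_n=\frac12-\frac1{2n},\qquad \mu_n=\frac12-\frac{\tan^2(\pi/2n)}2 .$$ The four points $$\Bigl(-\frac1n,\,1-\frac1n\Bigr),\quad \Bigl(1-\frac1n,\,-\frac1n\Bigr),\quad (a_n,a_n),\quad (\mu_n a_n,\mu_n a_n)$$ are in convex position, i.e. they are the vertices of a convex quadrilateral $Q_n$ (their convex hull). With $n$ fixed and $k\to\infty$, the closure of $S_{nk}(O(W_{nk}))$ converges to $Q_n$ in the Hausdorff metric. Moreover, for every compact subset $K$ of the interior of $Q_n$ we have $K\subset S_{nk}(O(W_{nk}))$ for all sufficiently large $k$. -/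

import Mathlib

namespace TriangularBilliards

/-- The Euclidean plane, used both as the plane of the billiard table and as the parameter plane. -/
abbrev Plane : Type := EuclideanSpace ℝ (Fin 2)

/-- The labels `1`, `2`, `3` of the sides of a triangle (the digits of a word). -/
inductive Side : Type
  | one : Side
  | two : Side
  | three : Side

/-- A finite word in the digits `1`, `2`, `3`. It stands for its infinite periodic repetition. -/
abbrev Word : Type := List Side

/-- The `i`-th digit of the infinite periodic repetition of a nonempty word `W`. -/
def letter (W : Word) (i : ℕ) : Side := W.getD (i % W.length) Side.three

/-! ### The triangle of a parameter point -/

/-- The vertex of the triangle `T_X` opposite to a given side. The triangle has angle `x₁ = X 0` at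
the vertex opposite side `1`, angle `x₂ = X 1` at the vertex opposite side `2`, and it is
normalized so that side `3` is the segment from `(0,0)` to `(1,0)`. By the law of sines side `2`
has length `sin x₂ / sin (x₁ + x₂)`. -/
noncomputable def vertex (X : Plane) : Side → Plane
  | Side.one => !₂[0, 0]
  | Side.two => !₂[1, 0]
  | Side.three => (Real.sin (X 1) / Real.sin (X 0 + X 1)) • !₂[Real.cos (X 0), Real.sin (X 0)]

/-- One endpoint of a side of `T_X`. -/
noncomputable def sideStart (X : Plane) : Side → Plane
  | Side.one => vertex X Side.two
  | Side.two => vertex X Side.one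
  | Side.three => vertex X Side.one

/-- The other endpoint of a side of `T_X`. -/
noncomputable def sideEnd (X : Plane) : Side → Plane
  | Side.one => vertex X Side.three
  | Side.two => vertex X Side.three
  | Side.three => vertex X Side.two

/-- A side of `T_X` without its endpoints. -/
def openSide (X : Plane) (s : Side) : Set Plane := openSegment ℝ (sideStart X s) (sideEnd X s)

/-- The line through the origin parallel to a side of `T_X`. -/
def sideLine (X : Plane) (s : Side) : Submodule ℝ Plane :=
  Submodule.span ℝ {sideEnd X s - sideStart X s}

/-! ### Periodic billiard paths and orbit tiles -/

/-- The unit direction from `a` to `b`. -/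
noncomputable def direction (a b : Plane) : Plane := ‖b - a‖⁻¹ • (b - a)

/-- `p 0, p 1, p 2, …` are the successive bounce points of a periodic billiard path in `T_X` whose
sequence of sides is the periodic repetition of `W`: the bounce points lie on the (relatively open)
sides prescribed by the word, consecutive bounces are on different sides, the path closes up after
one period of the word, and at each bounce the outgoing direction is the mirror image of the
incoming direction in the side that is hit. -/
structure IsPeriodicBilliardPath (X : Plane) (W : Word) (p : ℕ → Plane) : Prop where
  side_ne : ∀ i, letter W i ≠ letter W (i + 1)
  mem_side : ∀ i, p i ∈ openSide X (letter W i)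
  periodic : ∀ i, p (i + W.length) = p i
  bounce : ∀ i, (sideLine X (letter W (i + 1))).reflection (direction (p i) (p (i + 1))) =
    direction (p (i + 1)) (p (i + 2))

/-- The parameter space `Δ` of obtuse triangles: the pairs of small angles, in radians. -/
def obtuseParameters : Set Plane := {X | 0 < X 0 ∧ 0 < X 1 ∧ X 0 + X 1 < Real.pi / 2}

/-- The orbit tile `O(W)`: the obtuse triangles that have a periodic billiard path with
combinatorial type `W`. -/
def orbitTile (W : Word) : Set Plane :=
  {X | X ∈ obtuseParameters ∧ ∃ p : ℕ → Plane, IsPeriodicBilliardPath X W p}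

/-! ### The words `W_{nk}` -/

/-- The word `w` repeated `m` times. -/
def wordPow (w : Word) : ℕ → Word
  | 0 => []
  | m + 1 => w ++ wordPow w m

/-- The word `(23)^m`. -/
def w23 (m : ℕ) : Word := wordPow [Side.two, Side.three] m

/-- The word `(13)^m`. -/
def w13 (m : ℕ) : Word := wordPow [Side.one, Side.three] m

/-- The word `W_{nk}`, for `n ≥ 3`. With `u = (23)^{n-1}(13)^{n-1}` and `v = (13)^{n-1}(23)^{n-1}` it
is the concatenation of
`u^{k+2}`, `(23)^n v^{k+1}`, `(13)^n u^k (23)^n`, `v^{k+1} (13)^n`,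
each with its last digit (a `3`) removed.

This is the word of the closed squarepath which starts at `(0,1)` and whose four parts are, with
`M = 2n-2`:
a staircase of `2k+4` edges, alternately right and down, all of length `M`;
a staircase of `2k+3` edges, alternately left and up, of lengths `M+2, M, …, M`;
a staircase of `2k+2` edges, alternately down and right, of lengths `M+2, M, …, M, M+2`;
a staircase of `2k+3` edges, alternately up and left, of lengths `M, …, M, M+2`.
A horizontal (vertical) edge of length `2m` is a maximal `m`-dart `(23)^{m-1}2` (`(13)^{m-1}1`), and
between consecutive darts a digit `3` is inserted except at the four junctions of the staircases,
where the squarepath does not make a northwest or southeast turn. -/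
def tileWord (n k : ℕ) : Word :=
  (wordPow (w23 (n - 1) ++ w13 (n - 1)) (k + 2)).dropLast ++
  (w23 n ++ wordPow (w13 (n - 1) ++ w23 (n - 1)) (k + 1)).dropLast ++
  (w13 n ++ wordPow (w23 (n - 1) ++ w13 (n - 1)) k ++ w23 n).dropLast ++
  (wordPow (w13 (n - 1) ++ w23 (n - 1)) (k + 1) ++ w13 n).dropLast

/-! ### The rescaling and the limit quadrilateral -/

/-- The Veech point `V_n = (π/2n, π/2n)`. -/
noncomputable def veechPoint (n : ℕ) : Plane := !₂[Real.pi / (2 * n), Real.pi / (2 * n)]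

/-- `ζ_n = 2 (n-1) cot (π/2n)`. -/
noncomputable def zeta (n : ℕ) : ℝ := 2 * ((n : ℝ) - 1) * Real.cot (Real.pi / (2 * n))

/-- The dilation `S_{nk}`, which maps `V_n` to `0` and expands distances by `ζ_n k²`. -/
noncomputable def rescale (n k : ℕ) (X : Plane) : Plane :=
  (zeta n * (k : ℝ) ^ 2) • (X - veechPoint n)

/-- `a_n = 1/2 - 1/(2n)`. -/
noncomputable def aCoeff (n : ℕ) : ℝ := 1 / 2 - 1 / (2 * (n : ℝ))

/-- `μ_n = 1/2 - tan² (π/2n) / 2`. -/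
noncomputable def muCoeff (n : ℕ) : ℝ := 1 / 2 - Real.tan (Real.pi / (2 * n)) ^ 2 / 2

/-- The four vertices of `Q_n`. -/
noncomputable def quadVertex (n : ℕ) : Fin 4 → Plane :=
  ![!₂[-(1 / (n : ℝ)), 1 - 1 / (n : ℝ)],
    !₂[1 - 1 / (n : ℝ), -(1 / (n : ℝ))],
    !₂[aCoeff n, aCoeff n],
    !₂[muCoeff n * aCoeff n, muCoeff n * aCoeff n]]

/-- The (closed) quadrilateral `Q_n`. -/
def quad (n : ℕ) : Set Plane := convexHull ℝ (Set.range (quadVertex n))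

end TriangularBilliards

/-!
A billiard path is unfolded: instead of reflecting the path, the triangle is reflected in the side
that is hit, so that the path becomes a straight line which runs through a chain of triangles. The
chain is described by the `Placement`s of its triangles relative to the line, and a triangle is
crossed as prescribed by the word if its three vertices are on the proper sides of the line
(`Passes`). A point of the parameter space is in the orbit tile if and only if there is a chain which
follows the word and closes up (`exists_path_of_follows`, `exists_follows_of_path`).

The word `W_{nk}` is a sequence of blocks `(23)^{j-1} 2` and `(13)^{j-1} 1` with `j = n - 1` or
`j = n`. In such a block the line passes a fan of `2 j` triangles around one end of the long side.
Consecutive fans are joined by a long side, and all these long sides form a closed path, the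
`Corridor`, of four zigzags joined at four corners, the fans with `j = n`. At a fan with angle `α` at
its centre the path turns by `π - 2 j α`. The orbit tile consists of the parameters for which some
corridor is `Open`: the centres of the fans are on their prescribed sides of the line, the inner
vertices of each fan are on the side opposite to its centre, and the path closes up
(`mem_orbitTile_iff`). The turns cancel, so that closing up is a condition on the heights only.

At the Veech point the zigzags turn by `π / n` to the left and to the right, and the corners do not
turn at all. If the triangle deviates from the Veech point by an amount of order `1 / k²` in each
angle, all long sides deviate by an amount of order `1 / k` from the angle `π / 2n`, and the heights
of the corners are linear in these deviations up to `O(1 / k²)` (`abs_heights_sub_le`). Closing up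
determines the first angle; then four gaps of order `1 / k` remain (`Gaps`), between the two corners
of the path above the line and below it, and between their neighbours. In the rescaled parameters
`(u, v)` the gaps are the affine functions `cornerSlack` and `sideSlack` at `(u, v)` and `(v, u)`, up
to an error `O(1 / k)`. The quadrilateral is where all four are nonnegative (`mem_quad_iff`).

The converse directions need two arguments beyond linearization. An open corridor is near the Veech
point to begin with, because its heights stay bounded along zigzags of length `k`: the sines of the
mean directions of the double steps, which form an arithmetic progression, have bounded sums
(`abs_progression_le`, `Corridor.Open.exists_near`). This gives the upper bound `exists_slacks_ge`
for the orbit tile. If the four slacks are at least `δ > 0`, a closed corridor exists by the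
intermediate value theorem, and all its long sides have angles smaller than `π / 2n` by an amount of
order `1 / k`. Therefore its heights decrease along each zigzag, and by the concavity of the sine the
line passes all fans if it passes the vertices at the corners, which it does by the choice of the
slacks (`Corridor.open_of_tilted`, `eventually_exists_open`). The convergence and the inclusion of
compact sets follow from these two bounds (`tendsto_hausdorffEDist`, `eventually_mem_of_slacksGe`).

Throughout, `n = m + 2`.
-/

namespace TriangularBilliards

/-! ### The trajectory as seen from the unfolded triangles -/

/-- The position of an unfolded copy of the triangle `T_X` relative to a directed line: `o = ±1` is
the orientation of the copy, `φ` the angle from the line to its side from vertex `1` to vertex `2`,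
and `h` the signed distance of its vertex `1` from the line, positive on the left. -/
@[ext]
structure Placement where
  o : ℝ
  φ : ℝ
  h : ℝ

/-- The length of the side of `T_X` labelled `2`, when side `3` has length `1`. With the arguments
interchanged it is the length of the side labelled `1`. -/
noncomputable def sideTwo (α β : ℝ) : ℝ := Real.sin β / Real.sin (α + β)

/-- The signed distance from the line to a vertex of the placed triangle. -/
noncomputable def vertexHeight (α β : ℝ) (t : Placement) : Side → ℝ
  | Side.one => t.h
  | Side.two => t.h + Real.sin t.φ
  | Side.three => t.h + sideTwo α β * Real.sin (t.φ + t.o * α)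

/-- The placement of the next copy, obtained by reflecting the triangle in one of its sides. -/
noncomputable def cross (α β : ℝ) : Side → Placement → Placement
  | Side.one, t => ⟨-t.o, t.φ - 2 * t.o * β, t.h + Real.sin t.φ - Real.sin (t.φ - 2 * t.o * β)⟩
  | Side.two, t => ⟨-t.o, t.φ + 2 * t.o * α, t.h⟩
  | Side.three, t => ⟨-t.o, t.φ, t.h⟩

/-- The label different from two given distinct labels. The value `a` at equal labels makes
`Passes α β a a` contradictory. -/
def third : Side → Side → Side
  | Side.one, Side.two => Side.three
  | Side.two, Side.one => Side.three
  | Side.one, Side.three => Side.two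
  | Side.three, Side.one => Side.two
  | Side.two, Side.three => Side.one
  | Side.three, Side.two => Side.one
  | a, _ => a

/-- The sign of the turn from the vertex `b` to the vertex `a`, as seen from the third vertex of
`T_X`. -/
def turnSign : Side → Side → ℝ
  | Side.three, Side.two => 1
  | Side.two, Side.one => 1
  | Side.one, Side.three => 1
  | _, _ => -1

/-- The line enters the placed triangle through side `a` and leaves it through side `b`: it
separates the common vertex of these sides from the other two vertices, and it does so on the side
which is dictated by the direction of travel. -/
def Passes (α β : ℝ) (a b : Side) (t : Placement) : Prop :=
  0 < t.o * turnSign a b * vertexHeight α β t (third a b) ∧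
  t.o * turnSign a b * vertexHeight α β t a < 0 ∧
  t.o * turnSign a b * vertexHeight α β t b < 0

/-- The placement after crossing the sides of a list. -/
noncomputable def run (α β : ℝ) : Placement → Word → Placement
  | t, [] => t
  | t, b :: l => run α β (cross α β b t) l

/-- The line runs through the successive copies of the triangle obtained by crossing the sides of
a list, the first of which was entered through the side `a`. -/
def Follows (α β : ℝ) : Side → Placement → Word → Prop
  | _, _, [] => True
  | a, t, b :: l => Passes α β a b t ∧ Follows α β b (cross α β b t) l

/-- The signed distance from the line to a point of the folded triangle `T_X`. -/
noncomputable def lineHeight (t : Placement) (z : Plane) : ℝ :=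
  t.h + z 0 * Real.sin t.φ + t.o * (z 1 * Real.cos t.φ)

/-- The direction of the line, folded back to `T_X`. -/
noncomputable def lineDir (t : Placement) : Plane := !₂[Real.cos t.φ, -(t.o * Real.sin t.φ)]

theorem cross_o (α β : ℝ) (s : Side) (t : Placement) : (cross α β s t).o = -t.o := by
  cases s <;> rfl

theorem lineHeight_vertex (X : Plane) (t : Placement) (s : Side) (ho : t.o ^ 2 = 1) :
    lineHeight t (vertex X s) = vertexHeight (X 0) (X 1) t s := by
  have ho' : t.o = 1 ∨ t.o = -1 := by simpa using ho
  cases s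
  · simp [lineHeight, vertex, vertexHeight]
  · simp [lineHeight, vertex, vertexHeight]
  · rcases ho' with h | h <;>
      simp [lineHeight, vertex, vertexHeight, sideTwo, h, Real.sin_add] <;> ring

open Real in
/-- The two sides at the obtuse vertex span the long side: the distances of the obtuse vertex from
a line, computed from either end of the long side, agree. -/
theorem side_identity {α β : ℝ} (h : sin (α + β) ≠ 0) (y : ℝ) :
    sideTwo α β * sin (y + α) + sideTwo β α * sin (y - β) = sin y := by
  have h' : sin (β + α) = sin (α + β) := by rw [add_comm]
  unfold sideTwo
  rw [h']
  field_simp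
  simp only [sin_add, sin_sub]
  ring_nf

/-- The height of the obtuse vertex, computed from the other end of the long side. -/
theorem vertexHeight_three {α β : ℝ} (h : Real.sin (α + β) ≠ 0) {t : Placement}
    (ho : t.o = 1 ∨ t.o = -1) : vertexHeight α β t Side.three =
      t.h + Real.sin t.φ - sideTwo β α * Real.sin (t.φ - t.o * β) := by
  have key := side_identity h
  rcases ho with ho | ho
  · have := key t.φ
    simp only [vertexHeight, ho, one_mul]
    linarith
  · have := key (-t.φ)
    simp only [vertexHeight, ho, neg_one_mul, sub_neg_eq_add]
    rw [show -t.φ + α = -(t.φ + -α) by ring, show -t.φ - β = -(t.φ + β) by ring] at this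
    simp only [Real.sin_neg] at this
    linarith

/-- Reflecting the triangle in a side does not move the two vertices on this side. -/
theorem vertexHeight_cross {α β : ℝ} (h : Real.sin (α + β) ≠ 0) {t : Placement}
    (ho : t.o = 1 ∨ t.o = -1) {s v : Side} (hv : v ≠ s) :
    vertexHeight α β (cross α β s t) v = vertexHeight α β t v := by
  have h3 := vertexHeight_three h ho
  have ho' : (cross α β s t).o = 1 ∨ (cross α β s t).o = -1 := by
    rw [cross_o]; rcases ho with ho | ho <;> simp [ho]
  have h3' := vertexHeight_three h ho'
  cases s <;> cases v <;> first | exact absurd rfl hv | skip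
  · simp [vertexHeight, cross]
  · rw [h3, h3']
    have e : t.φ - 2 * t.o * β - -t.o * β = t.φ - t.o * β := by ring
    simp only [cross, e]
    ring
  · simp [vertexHeight, cross]
  · simp [vertexHeight, cross]
    ring_nf
    simp
  · simp [vertexHeight, cross]
  · simp [vertexHeight, cross]

theorem openSide_eq (X : Plane) {a b : Side} (h : a ≠ b) :
    openSide X a = openSegment ℝ (vertex X (third a b)) (vertex X b) := by
  cases a <;> cases b <;>
    first | exact absurd rfl h | rfl | exact openSegment_symm ℝ _ _

theorem lineHeight_combo (t : Placement) (u v : Plane) {a b : ℝ} (hab : a + b = 1) :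
    lineHeight t (a • u + b • v) = a * lineHeight t u + b * lineHeight t v := by
  obtain rfl : b = 1 - a := by linarith
  simp [lineHeight]
  ring

theorem third_ne_left {a b : Side} (h : a ≠ b) : third a b ≠ a := by
  cases a <;> cases b <;> simp_all [third]

theorem third_comm (a b : Side) : third a b = third b a := by
  cases a <;> cases b <;> rfl

theorem exists_ne_side (a : Side) : ∃ b, a ≠ b := by
  cases a
  · exact ⟨Side.two, by simp⟩
  · exact ⟨Side.one, by simp⟩
  · exact ⟨Side.one, by simp⟩

/-- Reflecting the triangle in a side does not move the points of this side. -/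
theorem lineHeight_cross {X : Plane} (h : Real.sin (X 0 + X 1) ≠ 0) {t : Placement}
    (ho : t.o = 1 ∨ t.o = -1) {s : Side} {z : Plane} (hz : z ∈ openSide X s) :
    lineHeight (cross (X 0) (X 1) s t) z = lineHeight t z := by
  obtain ⟨b, hb⟩ := exists_ne_side s
  rw [openSide_eq X hb] at hz
  obtain ⟨u, v, -, -, huv, rfl⟩ := hz
  have ho' : (cross (X 0) (X 1) s t).o = 1 ∨ (cross (X 0) (X 1) s t).o = -1 := by
    rw [cross_o]; rcases ho with ho | ho <;> simp [ho]
  rw [lineHeight_combo _ _ _ huv, lineHeight_combo _ _ _ huv,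
    lineHeight_vertex _ _ _ (by simpa using ho'), lineHeight_vertex _ _ _ (by simpa using ho'),
    lineHeight_vertex _ _ _ (by simpa using ho), lineHeight_vertex _ _ _ (by simpa using ho),
    vertexHeight_cross h ho (third_ne_left hb), vertexHeight_cross h ho hb.symm]

theorem reflection_span_polar {L : ℝ} (hL : L ≠ 0) (a b : ℝ) :
    (Submodule.span ℝ {(L • !₂[Real.cos a, Real.sin a] : Plane)}).reflection
      !₂[Real.cos b, Real.sin b] = !₂[Real.cos (2 * a - b), Real.sin (2 * a - b)] := by
  have hn : ‖(!₂[Real.cos a, Real.sin a] : Plane)‖ = 1 := by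
    simp [EuclideanSpace.norm_eq]
  rw [Submodule.reflection_singleton_apply, norm_smul, hn]
  have hL2 : ‖L‖ ^ 2 = L ^ 2 := by simp
  have hs : Real.sin a ^ 2 = 1 - Real.cos a ^ 2 := Real.sin_sq a
  ext i
  fin_cases i
  · simp [PiLp.inner_apply, Real.cos_sub, Real.cos_two_mul, Real.sin_two_mul]
    field_simp
    ring
  · simp [PiLp.inner_apply, Real.sin_sub, Real.cos_two_mul, Real.sin_two_mul]
    field_simp
    linear_combination (2 * Real.sin b) * hs

theorem lineDir_eq {t : Placement} (ho : t.o = 1 ∨ t.o = -1) :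
    lineDir t = !₂[Real.cos (-(t.o * t.φ)), Real.sin (-(t.o * t.φ))] := by
  rcases ho with h | h <;> simp [lineDir, h]

/-- The law of reflection: folding the line back after a reflection of the triangle turns its
direction into the mirror image. -/
theorem reflection_lineDir {X : Plane} (hX : X ∈ obtuseParameters) {t : Placement}
    (ho : t.o = 1 ∨ t.o = -1) (s : Side) :
    (sideLine X s).reflection (lineDir t) = lineDir (cross (X 0) (X 1) s t) := by
  obtain ⟨h0, h1, h2⟩ := hX
  have hpi := Real.pi_pos
  have hs : 0 < Real.sin (X 0 + X 1) := Real.sin_pos_of_pos_of_lt_pi (by linarith) (by linarith)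
  have hs0 : 0 < Real.sin (X 0) := Real.sin_pos_of_pos_of_lt_pi (by linarith) (by linarith)
  have hs1 : 0 < Real.sin (X 1) := Real.sin_pos_of_pos_of_lt_pi (by linarith) (by linarith)
  have ho' : (cross (X 0) (X 1) s t).o = 1 ∨ (cross (X 0) (X 1) s t).o = -1 := by
    rw [cross_o]; rcases ho with ho | ho <;> simp [ho]
  have ho2 : t.o * t.o = 1 := by rcases ho with h | h <;> simp [h]
  rw [lineDir_eq ho, lineDir_eq ho']
  have key : ∀ (L a : ℝ), L ≠ 0 → sideEnd X s - sideStart X s = L • !₂[Real.cos a, Real.sin a] →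
      2 * a - -(t.o * t.φ) = -((cross (X 0) (X 1) s t).o * (cross (X 0) (X 1) s t).φ) →
      (sideLine X s).reflection !₂[Real.cos (-(t.o * t.φ)), Real.sin (-(t.o * t.φ))] =
      !₂[Real.cos (-((cross (X 0) (X 1) s t).o * (cross (X 0) (X 1) s t).φ)),
        Real.sin (-((cross (X 0) (X 1) s t).o * (cross (X 0) (X 1) s t).φ))] := by
    intro L a hL h h'
    rw [sideLine, h, reflection_span_polar hL, h']
  cases s
  · refine key (-(sideTwo (X 1) (X 0))) (-(X 1)) ?_ ?_ ?_
    · unfold sideTwo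
      rw [add_comm]
      exact neg_ne_zero.mpr (by positivity)
    · ext i
      fin_cases i
      · simp [sideEnd, sideStart, vertex, sideTwo]
        rw [add_comm (X 1)]
        field_simp
        rw [Real.sin_add]; ring
      · simp [sideEnd, sideStart, vertex, sideTwo]
        rw [add_comm (X 1)]
        field_simp
    · simp [cross]
      linear_combination (2 * X 1) * ho2
  · refine key (sideTwo (X 0) (X 1)) (X 0) ?_ ?_ ?_
    · unfold sideTwo
      positivity
    · ext i
      fin_cases i <;> simp [sideEnd, sideStart, vertex, sideTwo]
    · simp [cross]
      linear_combination (-2 * X 0) * ho2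
  · refine key 1 0 one_ne_zero ?_ ?_
    · ext i
      fin_cases i <;> simp [sideEnd, sideStart, vertex]
    · simp [cross]

/-- Twice the signed area of `T_X`, from any two of its sides. -/
theorem cross_product_sides (X : Plane) {a b : Side} (hab : a ≠ b) :
    (vertex X b 0 - vertex X (third a b) 0) * (vertex X a 1 - vertex X (third a b) 1) -
      (vertex X b 1 - vertex X (third a b) 1) * (vertex X a 0 - vertex X (third a b) 0) =
      turnSign a b * (sideTwo (X 0) (X 1) * Real.sin (X 0)) := by
  cases a <;> cases b <;> first | exact absurd rfl hab | skip
  all_goals simp [third, vertex, turnSign, sideTwo]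
  all_goals ring

/-- The turning formula. If a line of the given height and direction enters the triangle at a point
of side `a` and leaves it at a point of side `b`, the height of their common vertex times the
(signed) distance travelled is, up to the sign dictated by orientation, a positive multiple of the
area of the triangle. -/
theorem turning_formula (X : Plane) {t : Placement}
    (ho : t.o = 1 ∨ t.o = -1) {a b : Side} (hab : a ≠ b) {u v l : ℝ} {p q : Plane}
    (hp : p = (1 - u) • vertex X (third a b) + u • vertex X b)
    (hq : q = (1 - v) • vertex X (third a b) + v • vertex X a)
    (hp0 : lineHeight t p = 0) (hq0 : lineHeight t q = 0)
    (hl : l = (q 0 - p 0) * lineDir t 0 + (q 1 - p 1) * lineDir t 1) :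
    l * (t.o * turnSign a b * vertexHeight (X 0) (X 1) t (third a b)) =
      u * v * (sideTwo (X 0) (X 1) * Real.sin (X 0)) := by
  set S := vertex X (third a b) with hS
  set Y := vertex X b with hY
  set Z := vertex X a with hZ
  have area := cross_product_sides X hab
  rw [← hS, ← hY, ← hZ] at area
  have ht2 : turnSign a b * turnSign a b = 1 := by
    cases a <;> cases b <;> simp [turnSign]
  have ho2 : t.o * t.o = 1 := by rcases ho with h | h <;> simp [h]
  rw [← lineHeight_vertex X t _ (by simpa using ho), ← hS]
  have e1 : lineHeight t p = (1 - u) * lineHeight t S + u * lineHeight t Y := by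
    rw [hp, lineHeight_combo _ _ _ (by ring)]
  have e2 : lineHeight t q = (1 - v) * lineHeight t S + v * lineHeight t Z := by
    rw [hq, lineHeight_combo _ _ _ (by ring)]
  have p0 : p 0 = (1 - u) * S 0 + u * Y 0 := by simp [hp]
  have p1 : p 1 = (1 - u) * S 1 + u * Y 1 := by simp [hp]
  have q0 : q 0 = (1 - v) * S 0 + v * Z 0 := by simp [hq]
  have q1 : q 1 = (1 - v) * S 1 + v * Z 1 := by simp [hq]
  have d0 : lineDir t 0 = Real.cos t.φ := by simp [lineDir]
  have d1 : lineDir t 1 = -(t.o * Real.sin t.φ) := by simp [lineDir]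
  have hN1 : u * (lineHeight t Y - lineHeight t S) = - lineHeight t S := by linarith
  have hN2 : v * (lineHeight t Z - lineHeight t S) = - lineHeight t S := by linarith
  have f1 : lineHeight t Y - lineHeight t S =
    (Y 0 - S 0) * Real.sin t.φ + t.o * ((Y 1 - S 1) * Real.cos t.φ) := by
    simp only [lineHeight]; ring
  have f2 : lineHeight t Z - lineHeight t S =
    (Z 0 - S 0) * Real.sin t.φ + t.o * ((Z 1 - S 1) * Real.cos t.φ) := by
    simp only [lineHeight]; ring
  rw [f1] at hN1
  rw [f2] at hN2
  have hsc := Real.sin_sq_add_cos_sq t.φ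
  rw [hl, d0, d1, p0, p1, q0, q1]
  generalize Real.sin t.φ = sn at *
  generalize Real.cos t.φ = cs at *
  generalize lineHeight t S = H at *
  generalize turnSign a b = τ at *
  generalize sideTwo (X 0) (X 1) * Real.sin (X 0) = ar at *
  -- the basis formed by the direction and the normal of the line has determinant `t.o`
  have hcross : t.o * ((((1 - v) * S 0 + v * Z 0 - ((1 - u) * S 0 + u * Y 0)) * cs +
      ((1 - v) * S 1 + v * Z 1 - ((1 - u) * S 1 + u * Y 1)) * -(t.o * sn)) * H) =
      u * v * ((Y 0 - S 0) * (Z 1 - S 1) - (Y 1 - S 1) * (Z 0 - S 0)) := by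
    linear_combination t.o * v * ((Z 0 - S 0) * cs - t.o * (Z 1 - S 1) * sn) * hN1 -
      t.o * u * ((Y 0 - S 0) * cs - t.o * (Y 1 - S 1) * sn) * hN2 +
      u * v * ((Y 0 - S 0) * (Z 1 - S 1) - (Y 1 - S 1) * (Z 0 - S 0)) *
        ((sn ^ 2 + cs ^ 2) * ho2 + hsc)
  rw [area] at hcross
  linear_combination τ * hcross + u * v * ar * ht2

theorem third_eq_self (a : Side) : third a a = a := by cases a <;> rfl

theorem Passes.ne {α β : ℝ} {a b : Side} {t : Placement} (h : Passes α β a b t) : a ≠ b := by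
  rintro rfl
  have h1 := h.1
  rw [third_eq_self] at h1
  exact absurd h1 (not_lt.mpr h.2.1.le)

/-- The point where the line meets a side of the folded triangle. -/
noncomputable def zeroPoint (X : Plane) (s : Side) (t : Placement) : Plane :=
  (lineHeight t (sideEnd X s) / (lineHeight t (sideEnd X s) - lineHeight t (sideStart X s))) •
      sideStart X s +
    (-lineHeight t (sideStart X s) /
      (lineHeight t (sideEnd X s) - lineHeight t (sideStart X s))) • sideEnd X s

theorem zeroPoint_spec {X : Plane} {s : Side} {t : Placement}
    (h : lineHeight t (sideStart X s) * lineHeight t (sideEnd X s) < 0) :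
    zeroPoint X s t ∈ openSide X s ∧ lineHeight t (zeroPoint X s t) = 0 := by
  have hne : lineHeight t (sideEnd X s) - lineHeight t (sideStart X s) ≠ 0 := by
    intro h0
    rw [sub_eq_zero] at h0
    rw [h0] at h
    nlinarith
  have hsum : lineHeight t (sideEnd X s) /
      (lineHeight t (sideEnd X s) - lineHeight t (sideStart X s)) +
      -lineHeight t (sideStart X s) /
      (lineHeight t (sideEnd X s) - lineHeight t (sideStart X s)) = 1 := by
    field_simp
    ring
  refine ⟨⟨_, _, ?_, ?_, hsum, rfl⟩, ?_⟩
  · rcases mul_neg_iff.mp h with ⟨h1, h2⟩ | ⟨h1, h2⟩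
    · exact div_pos_of_neg_of_neg h2 (by linarith)
    · exact div_pos h2 (by linarith)
  · rcases mul_neg_iff.mp h with ⟨h1, h2⟩ | ⟨h1, h2⟩
    · exact div_pos_of_neg_of_neg (by linarith) (by linarith)
    · exact div_pos (by linarith) (by linarith)
  · rw [zeroPoint, lineHeight_combo _ _ _ hsum]
    field_simp
    ring

theorem side_ends (X : Plane) {a b : Side} (h : a ≠ b) :
    (sideStart X a = vertex X (third a b) ∧ sideEnd X a = vertex X b) ∨
      (sideStart X a = vertex X b ∧ sideEnd X a = vertex X (third a b)) := by
  cases a <;> cases b <;> first | exact absurd rfl h | exact Or.inl ⟨rfl, rfl⟩ |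
    exact Or.inr ⟨rfl, rfl⟩

theorem turnSign_mul_self (a b : Side) : turnSign a b * turnSign a b = 1 := by
  cases a <;> cases b <;> simp [turnSign]

/-- The ends of the side through which the line leaves the triangle are on different
sides of the line. -/
theorem Passes.exit_neg {X : Plane} {a b : Side} {t : Placement} (ho : t.o = 1 ∨ t.o = -1)
    (h : Passes (X 0) (X 1) a b t) :
    lineHeight t (sideStart X b) * lineHeight t (sideEnd X b) < 0 := by
  have hne := h.ne
  obtain ⟨h1, h2, -⟩ := h
  have h12 := mul_neg_of_pos_of_neg h1 h2
  have e : (t.o * turnSign a b * vertexHeight (X 0) (X 1) t (third a b)) *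
      (t.o * turnSign a b * vertexHeight (X 0) (X 1) t a) =
      vertexHeight (X 0) (X 1) t (third a b) * vertexHeight (X 0) (X 1) t a := by
    have h2 := turnSign_mul_self a b
    have h3 : t.o * t.o = 1 := by rcases ho with h | h <;> simp [h]
    linear_combination (vertexHeight (X 0) (X 1) t (third a b) * vertexHeight (X 0) (X 1) t a) *
      (turnSign a b * turnSign a b * h3 + h2)
  rw [e] at h12
  rcases side_ends X hne.symm with ⟨e1, e2⟩ | ⟨e1, e2⟩ <;> rw [e1, e2, third_comm b a,
    lineHeight_vertex _ _ _ (by simpa using ho), lineHeight_vertex _ _ _ (by simpa using ho)]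
  · exact h12
  · rw [mul_comm]; exact h12

/-- Two points of the line, one ahead of the other, determine its direction. -/
theorem direction_eq_lineDir {t : Placement} (ho : t.o = 1 ∨ t.o = -1) {p q : Plane}
    (hp : lineHeight t p = 0) (hq : lineHeight t q = 0)
    (hl : 0 < (q 0 - p 0) * lineDir t 0 + (q 1 - p 1) * lineDir t 1) :
    direction p q = lineDir t := by
  set l := (q 0 - p 0) * lineDir t 0 + (q 1 - p 1) * lineDir t 1 with hl_def
  have hsc := Real.sin_sq_add_cos_sq t.φ
  have h3 : t.o * t.o = 1 := by rcases ho with h | h <;> simp [h]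
  have hN : (q 0 - p 0) * Real.sin t.φ + t.o * ((q 1 - p 1) * Real.cos t.φ) = 0 := by
    simp only [lineHeight] at hp hq
    linarith
  have d0 : lineDir t 0 = Real.cos t.φ := by simp [lineDir]
  have d1 : lineDir t 1 = -(t.o * Real.sin t.φ) := by simp [lineDir]
  rw [d0, d1] at hl_def
  have e : q - p = l • lineDir t := by
    ext i
    fin_cases i
    · simp only [Fin.zero_eta, PiLp.sub_apply, PiLp.smul_apply, smul_eq_mul, d0]
      linear_combination Real.sin t.φ * hN - Real.cos t.φ * hl_def - (q 0 - p 0) * hsc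
    · simp only [Fin.mk_one, PiLp.sub_apply, PiLp.smul_apply, smul_eq_mul, d1]
      linear_combination t.o * Real.cos t.φ * hN + t.o * Real.sin t.φ * hl_def -
        (q 1 - p 1) * t.o ^ 2 * hsc - (q 1 - p 1) * h3
  have hn : ‖lineDir t‖ = 1 := by
    rw [lineDir_eq ho]
    simp [EuclideanSpace.norm_eq]
  rw [direction, e, norm_smul, hn, mul_one, Real.norm_of_nonneg hl.le, smul_smul,
    inv_mul_cancel₀ hl.ne', one_smul]

/-- `Follows` spelled out along an infinite sequence of placements. -/
theorem follows_iff {α β : ℝ} : ∀ (l : Word) (g : ℕ → Side) (P : ℕ → Placement),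
    (∀ i (hi : i < l.length), l[i] = g (i + 1)) →
    (∀ i, P (i + 1) = cross α β (g (i + 1)) (P i)) →
    (Follows α β (g 0) (P 0) l ↔ ∀ i < l.length, Passes α β (g i) (g (i + 1)) (P i)) ∧
      run α β (P 0) l = P l.length
  | [], g, P, _, _ => by simp [Follows, run]
  | b :: l, g, P, hl, hP => by
    have h0 : b = g 1 := hl 0 (by simp)
    have ih := follows_iff l (fun i => g (i + 1)) (fun i => P (i + 1))
      (fun i hi => hl (i + 1) (by simpa using hi)) (fun i => hP (i + 1))
    simp only [zero_add] at ih
    rw [hP 0, zero_add] at ih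
    refine ⟨?_, ?_⟩
    · rw [Follows, h0, ih.1]
      constructor
      · rintro ⟨h1, h2⟩ i hi
        cases i with
        | zero => exact h1
        | succ i => exact h2 i (by simpa using hi)
      · intro h
        exact ⟨h 0 (by simp), fun i hi => h (i + 1) (by simpa using hi)⟩
    · rw [run, h0, ih.2, List.length_cons]

theorem letter_add_length (W : Word) (i : ℕ) : letter W (i + W.length) = letter W i := by
  simp [letter]

theorem letter_of_lt (W : Word) {i : ℕ} (h : i < W.length) : letter W i = W[i] := by
  rw [letter, Nat.mod_eq_of_lt h, List.getD_eq_getElem _ _ h]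

/-- A closed chain of placements along a word gives a periodic billiard path. -/
theorem exists_path_of_follows {X : Plane} (hX : X ∈ obtuseParameters) {W : Word} (hW : W ≠ [])
    {t : Placement} (ho : t.o = 1 ∨ t.o = -1) (hrun : run (X 0) (X 1) t W = t)
    (hfol : Follows (X 0) (X 1) (letter W (W.length - 1)) t W) :
    ∃ p, IsPeriodicBilliardPath X W p := by
  have hN : 0 < W.length := List.length_pos_iff.mpr hW
  set N := W.length with hN_def
  obtain ⟨P, hP0, hPs⟩ : ∃ P : ℕ → Placement, P 0 = t ∧
      ∀ i, P (i + 1) = cross (X 0) (X 1) (letter W i) (P i) :=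
    ⟨fun i => Nat.rec t (fun i r => cross (X 0) (X 1) (letter W i) r) i, rfl, fun i => rfl⟩
  let g : ℕ → Side := fun i => letter W (i + (N - 1))
  have hg : ∀ i, g (i + 1) = letter W i := by
    intro i
    simp only [g]
    rw [show i + 1 + (N - 1) = i + N by omega]
    exact letter_add_length W i
  obtain ⟨hiff, hend⟩ := follows_iff (α := X 0) (β := X 1) W g P
    (fun i hi => by rw [hg, letter_of_lt W hi]) (fun i => by rw [hg, hPs])
  have hpass0 : ∀ i < N, Passes (X 0) (X 1) (g i) (g (i + 1)) (P i) := by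
    apply hiff.mp
    have : g 0 = letter W (N - 1) := by simp [g]
    rw [this, hP0]
    exact hfol
  have hPN : ∀ i, P (i + N) = P i := by
    intro i
    induction i with
    | zero => rw [zero_add, hP0, ← hend, hP0, hrun]
    | succ i ih =>
      rw [show i + 1 + N = (i + N) + 1 by ring, hPs, hPs, ih, hN_def, letter_add_length]
  have hgN : ∀ i, g (i + N) = g i := by
    intro i
    simp only [g]
    rw [show i + N + (N - 1) = i + (N - 1) + N by ring]
    exact letter_add_length W _
  have hpass' : ∀ q i, i < N → Passes (X 0) (X 1) (g (i + N * q)) (g (i + N * q + 1))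
      (P (i + N * q)) := by
    intro q
    induction q with
    | zero => simpa using hpass0
    | succ q ih =>
      intro i hi
      have := ih i hi
      rw [show i + N * (q + 1) = i + N * q + N by ring, hgN, hPN,
        show i + N * q + N + 1 = i + N * q + 1 + N by ring, hgN]
      exact this
  have hpass : ∀ i, Passes (X 0) (X 1) (letter W i) (letter W (i + 1)) (P (i + 1)) := by
    intro i
    have := hpass' ((i + 1) / N) ((i + 1) % N) (Nat.mod_lt _ hN)
    rw [Nat.mod_add_div, hg, hg] at this
    exact this
  have hpass1 : ∀ i, Passes (X 0) (X 1) (g i) (letter W i) (P i) := by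
    intro i
    have := hpass' (i / N) (i % N) (Nat.mod_lt _ hN)
    rw [Nat.mod_add_div, hg] at this
    exact this
  have hPo : ∀ i, (P i).o = 1 ∨ (P i).o = -1 := by
    intro i
    induction i with
    | zero => rw [hP0]; exact ho
    | succ i ih => rw [hPs, cross_o]; rcases ih with h | h <;> simp [h]
  have hs : 0 < Real.sin (X 0 + X 1) := by
    obtain ⟨h0, h1, h2⟩ := hX
    exact Real.sin_pos_of_pos_of_lt_pi (by linarith) (by linarith [Real.pi_pos])
  let p : ℕ → Plane := fun i => zeroPoint X (letter W i) (P i)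
  have hp : ∀ i, p i ∈ openSide X (letter W i) ∧ lineHeight (P i) (p i) = 0 := fun i =>
    zeroPoint_spec ((hpass1 i).exit_neg (hPo i))
  have hp' : ∀ i, lineHeight (P (i + 1)) (p i) = 0 := by
    intro i
    rw [hPs, lineHeight_cross hs.ne' (hPo i) (hp i).1, (hp i).2]
  have hdir : ∀ i, direction (p i) (p (i + 1)) = lineDir (P (i + 1)) := by
    intro i
    have hab := (hpass i).ne
    have h1 := (hp i).1
    have h2 := (hp (i + 1)).1
    rw [openSide_eq X hab] at h1
    rw [openSide_eq X hab.symm, third_comm] at h2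
    obtain ⟨u', u, hu', hu, huu, e1⟩ := h1
    obtain ⟨v', v, hv', hv, hvv, e2⟩ := h2
    refine direction_eq_lineDir (hPo _) (hp' i) (hp (i + 1)).2 ?_
    have key := turning_formula X (hPo (i + 1)) hab (u := u) (v := v)
      (by rw [← e1, ← huu]; simp) (by rw [← e2, ← hvv]; simp) (hp' i) (hp (i + 1)).2 rfl
    have hpos : 0 < u * v * (sideTwo (X 0) (X 1) * Real.sin (X 0)) := by
      obtain ⟨h0, h1, h2⟩ := hX
      have := Real.sin_pos_of_pos_of_lt_pi h0 (by linarith [Real.pi_pos])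
      have := Real.sin_pos_of_pos_of_lt_pi h1 (by linarith [Real.pi_pos])
      unfold sideTwo
      positivity
    rw [← key] at hpos
    exact (pos_iff_pos_of_mul_pos hpos).mpr (hpass i).1
  refine ⟨p, fun i => (hpass i).ne, fun i => (hp i).1, ?_, ?_⟩
  · intro i
    simp only [p]
    rw [← hN_def, hPN, hN_def, letter_add_length]
  · intro i
    rw [hdir, hdir, reflection_lineDir hX (hPo _), hPs (i + 1)]

theorem exists_polar {a b : ℝ} (h : a ^ 2 + b ^ 2 = 1) :
    ∃ θ : ℝ, Real.cos θ = a ∧ Real.sin θ = b := by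
  have hn : ‖(⟨a, b⟩ : ℂ)‖ = 1 := by
    rw [Complex.norm_def, Complex.normSq_mk, show a * a + b * b = 1 by nlinarith, Real.sqrt_one]
  have h0 : (⟨a, b⟩ : ℂ) ≠ 0 := by
    intro h0
    rw [h0, norm_zero] at hn
    exact zero_ne_one hn
  refine ⟨Complex.arg ⟨a, b⟩, ?_, ?_⟩
  · rw [Complex.cos_arg h0, hn, div_one]
  · rw [Complex.sin_arg, hn, div_one]

theorem norm_direction {p q : Plane} (h : p ≠ q) : ‖direction p q‖ = 1 := by
  have : ‖q - p‖ ≠ 0 := norm_ne_zero_iff.mpr (sub_ne_zero.mpr h.symm)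
  rw [direction, norm_smul, norm_inv, norm_norm, inv_mul_cancel₀ this]

/-- Every line in the folded triangle comes from a placement of a given
orientation. -/
theorem exists_lineDir_eq {o : ℝ} (ho : o = 1 ∨ o = -1) {d : Plane} (hd : ‖d‖ = 1) (p : Plane) :
    ∃ t : Placement, t.o = o ∧ lineDir t = d ∧ lineHeight t p = 0 := by
  have h1 : d 0 ^ 2 + d 1 ^ 2 = 1 := by
    have : ‖d‖ ^ 2 = 1 := by rw [hd]; norm_num
    rw [EuclideanSpace.norm_sq_eq] at this
    simpa [Fin.sum_univ_two] using this
  have ho2 : o * o = 1 := by rcases ho with h | h <;> simp [h]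
  obtain ⟨θ, hc, hs⟩ := exists_polar (a := d 0) (b := -(o * d 1))
    (by linear_combination h1 + d 1 ^ 2 * ho2)
  refine ⟨⟨o, θ, -(p 0 * Real.sin θ + o * (p 1 * Real.cos θ))⟩, rfl, ?_, ?_⟩
  · ext i
    fin_cases i
    · simp [lineDir, hc]
    · simp only [Fin.mk_one, lineDir, hs]
      simp
      linear_combination d 1 * ho2
  · simp [lineHeight]

/-- The area of `T_X` is positive. -/
theorem area_pos {X : Plane} (hX : X ∈ obtuseParameters) :
    0 < sideTwo (X 0) (X 1) * Real.sin (X 0) := by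
  obtain ⟨h0, h1, h2⟩ := hX
  have := Real.sin_pos_of_pos_of_lt_pi h0 (by linarith [Real.pi_pos])
  have := Real.sin_pos_of_pos_of_lt_pi h1 (by linarith [Real.pi_pos])
  have := Real.sin_pos_of_pos_of_lt_pi (x := X 0 + X 1) (by linarith) (by linarith [Real.pi_pos])
  unfold sideTwo
  positivity

theorem ne_of_mem_openSide {X : Plane} (hX : X ∈ obtuseParameters) {a b : Side} (hab : a ≠ b)
    {p q : Plane} (hp : p ∈ openSide X a) (hq : q ∈ openSide X b) : p ≠ q := by
  rw [openSide_eq X hab] at hp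
  rw [openSide_eq X hab.symm, third_comm] at hq
  obtain ⟨u', u, hu', hu, huu, rfl⟩ := hp
  obtain ⟨v', v, hv', hv, hvv, rfl⟩ := hq
  intro h
  obtain rfl : u' = 1 - u := by linarith
  obtain rfl : v' = 1 - v := by linarith
  have e0 := congrArg (fun z : Plane => z 0) h
  have e1 := congrArg (fun z : Plane => z 1) h
  simp only [PiLp.add_apply, PiLp.smul_apply, smul_eq_mul] at e0 e1
  have key := cross_product_sides X hab
  have h0 : u * (turnSign a b * (sideTwo (X 0) (X 1) * Real.sin (X 0))) = 0 := by
    rw [← key]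
    linear_combination (vertex X a 1 - vertex X (third a b) 1) * e0 -
      (vertex X a 0 - vertex X (third a b) 0) * e1
  have h1 := area_pos hX
  have h2 : turnSign a b ≠ 0 := by
    intro h; have := turnSign_mul_self a b; rw [h] at this; norm_num at this
  rcases mul_eq_zero.mp h0 with h | h
  · exact hu.ne' h
  · rcases mul_eq_zero.mp h with h | h
    · exact h2 h
    · exact h1.ne' h

/-- The line through two successive bounce points passes through the triangle as prescribed. -/
theorem passes_of_points {X : Plane} (hX : X ∈ obtuseParameters) {a b : Side} (hab : a ≠ b)
    {p q : Plane} (hp : p ∈ openSide X a) (hq : q ∈ openSide X b) {t : Placement}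
    (ho : t.o = 1 ∨ t.o = -1) (hp0 : lineHeight t p = 0) (hd : direction p q = lineDir t) :
    lineHeight t q = 0 ∧ Passes (X 0) (X 1) a b t := by
  have hne := ne_of_mem_openSide hX hab hp hq
  have hr : 0 < ‖q - p‖ := norm_pos_iff.mpr (sub_ne_zero.mpr hne.symm)
  set r := ‖q - p‖ with hr_def
  have e : q - p = r • lineDir t := by
    rw [← hd, direction, smul_smul, mul_inv_cancel₀ hr.ne', one_smul]
  have e0 : q 0 - p 0 = r * Real.cos t.φ := by
    have := congrArg (fun z : Plane => z 0) e
    simpa [lineDir] using this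
  have e1 : q 1 - p 1 = r * -(t.o * Real.sin t.φ) := by
    have := congrArg (fun z : Plane => z 1) e
    simpa [lineDir] using this
  have ho2 : t.o * t.o = 1 := by rcases ho with h | h <;> simp [h]
  have hq0 : lineHeight t q = 0 := by
    simp only [lineHeight] at hp0 ⊢
    linear_combination hp0 + Real.sin t.φ * e0 + t.o * Real.cos t.φ * e1 -
      r * Real.sin t.φ * Real.cos t.φ * ho2
  refine ⟨hq0, ?_⟩
  rw [openSide_eq X hab] at hp
  rw [openSide_eq X hab.symm, third_comm] at hq
  obtain ⟨u', u, hu', hu, huu, ep⟩ := hp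
  obtain ⟨v', v, hv', hv, hvv, eq⟩ := hq
  obtain rfl : u' = 1 - u := by linarith
  obtain rfl : v' = 1 - v := by linarith
  have key := turning_formula X ho hab ep.symm eq.symm hp0 hq0 rfl
  have d0 : lineDir t 0 = Real.cos t.φ := by simp [lineDir]
  have d1 : lineDir t 1 = -(t.o * Real.sin t.φ) := by simp [lineDir]
  have hl : (q 0 - p 0) * lineDir t 0 + (q 1 - p 1) * lineDir t 1 = r := by
    rw [e0, e1, d0, d1]
    linear_combination r * Real.sin_sq_add_cos_sq t.φ + r * Real.sin t.φ ^ 2 * ho2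
  rw [hl] at key
  have hpos : 0 < r * (t.o * turnSign a b * vertexHeight (X 0) (X 1) t (third a b)) := by
    rw [key]
    have := area_pos hX
    positivity
  have h1 := (pos_iff_pos_of_mul_pos hpos).mp hr
  rw [← ep, lineHeight_combo _ _ _ (by ring), lineHeight_vertex _ _ _ (by simpa using ho),
    lineHeight_vertex _ _ _ (by simpa using ho)] at hp0
  rw [← eq, lineHeight_combo _ _ _ (by ring), lineHeight_vertex _ _ _ (by simpa using ho),
    lineHeight_vertex _ _ _ (by simpa using ho)] at hq0
  refine ⟨h1, ?_, ?_⟩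
  · have : v * (t.o * turnSign a b * vertexHeight (X 0) (X 1) t a) =
        -((1 - v) * (t.o * turnSign a b * vertexHeight (X 0) (X 1) t (third a b))) := by
      linear_combination t.o * turnSign a b * hq0
    have h2 : v * (t.o * turnSign a b * vertexHeight (X 0) (X 1) t a) < 0 := by
      rw [this]
      exact neg_neg_of_pos (mul_pos hv' h1)
    exact (pos_iff_neg_of_mul_neg h2).mp hv
  · have : u * (t.o * turnSign a b * vertexHeight (X 0) (X 1) t b) =
        -((1 - u) * (t.o * turnSign a b * vertexHeight (X 0) (X 1) t (third a b))) := by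
      linear_combination t.o * turnSign a b * hp0
    have h2 : u * (t.o * turnSign a b * vertexHeight (X 0) (X 1) t b) < 0 := by
      rw [this]
      exact neg_neg_of_pos (mul_pos hu' h1)
    exact (pos_iff_neg_of_mul_neg h2).mp hu

/-- A periodic billiard path, unfolded, gives a closed chain of placements. -/
theorem exists_follows_of_path {X : Plane} (hX : X ∈ obtuseParameters) {W : Word}
    (hW : W ≠ []) (heven : Even W.length) {p : ℕ → Plane} (hp : IsPeriodicBilliardPath X W p) :
    ∃ t : Placement, t.o = 1 ∧ (run (X 0) (X 1) t W).h = t.h ∧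
      Follows (X 0) (X 1) (letter W (W.length - 1)) t W := by
  have hN : 0 < W.length := List.length_pos_iff.mpr hW
  set N := W.length with hN_def
  have hne : ∀ i, p i ≠ p (i + 1) := fun i =>
    ne_of_mem_openSide hX (hp.side_ne i) (hp.mem_side i) (hp.mem_side (i + 1))
  obtain ⟨t₁, ho₁, hd₁, hh₁⟩ := exists_lineDir_eq (o := (-1) ^ (N - 1)) (neg_one_pow_eq_or ℝ _)
    (norm_direction (hne 0)) (p 0)
  obtain ⟨P, hP0, hPs⟩ : ∃ P : ℕ → Placement, P 0 = t₁ ∧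
      ∀ i, P (i + 1) = cross (X 0) (X 1) (letter W (i + 1)) (P i) :=
    ⟨fun i => Nat.rec t₁ (fun i r => cross (X 0) (X 1) (letter W (i + 1)) r) i, rfl, fun i => rfl⟩
  have hs : 0 < Real.sin (X 0 + X 1) := by
    obtain ⟨h0, h1, h2⟩ := hX
    exact Real.sin_pos_of_pos_of_lt_pi (by linarith) (by linarith [Real.pi_pos])
  have hPo' : ∀ i, (P i).o = (-1) ^ (N - 1 + i) := by
    intro i
    induction i with
    | zero => rw [hP0, ho₁, add_zero]
    | succ i ih => rw [hPs, cross_o, ih, ← add_assoc, pow_succ]; ring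
  have hPo : ∀ i, (P i).o = 1 ∨ (P i).o = -1 := fun i => by
    rw [hPo']; exact neg_one_pow_eq_or ℝ _
  have inv : ∀ i, direction (p i) (p (i + 1)) = lineDir (P i) ∧ lineHeight (P i) (p i) = 0 := by
    intro i
    induction i with
    | zero => rw [hP0]; exact ⟨hd₁.symm, hh₁⟩
    | succ i ih =>
      obtain ⟨h1, -⟩ := passes_of_points hX (hp.side_ne i) (hp.mem_side i) (hp.mem_side (i + 1))
        (hPo i) ih.2 ih.1
      rw [hPs]
      constructor
      · rw [← reflection_lineDir hX (hPo i), ← ih.1, hp.bounce]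
      · rw [lineHeight_cross hs.ne' (hPo i) (hp.mem_side (i + 1)), h1]
  have hpass : ∀ i, Passes (X 0) (X 1) (letter W i) (letter W (i + 1)) (P i) := fun i =>
    (passes_of_points hX (hp.side_ne i) (hp.mem_side i) (hp.mem_side (i + 1))
        (hPo i) (inv i).2 (inv i).1).2
  obtain ⟨hiff, hend⟩ := follows_iff (α := X 0) (β := X 1) W (fun i => letter W (i + (N - 1)))
    (fun i => P (i + (N - 1)))
    (fun i hi => by
      rw [show i + 1 + (N - 1) = i + N by omega, hN_def, letter_add_length, letter_of_lt W hi])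
    (fun i => by
      rw [show i + 1 + (N - 1) = i + (N - 1) + 1 by omega, hPs])
  simp only [zero_add] at hiff hend
  have ho1 : (P (N - 1)).o = 1 := by
    rw [hPo', ← two_mul, pow_mul]; norm_num
  refine ⟨P (N - 1), ho1, ?_, hiff.mpr fun i _ => ?_⟩
  · rw [hend, ← hN_def, add_comm]
    have ho2 : (P (N - 1 + N)).o = 1 := by
      rw [hPo', ← add_assoc, ← two_mul, pow_add, pow_mul, heven.neg_one_pow]; norm_num
    obtain ⟨d1, h1⟩ := inv (N - 1)
    obtain ⟨d2, h2⟩ := inv (N - 1 + N)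
    have e1 : p (N - 1 + N) = p (N - 1) := hp.periodic _
    have e2 : p (N - 1 + N + 1) = p (N - 1 + 1) := by
      rw [show N - 1 + N + 1 = N - 1 + 1 + N by ring]; exact hp.periodic _
    rw [e1, e2, d1] at d2
    rw [e1] at h2
    have c0 := congrArg (fun z : Plane => z 0) d2
    have c1 := congrArg (fun z : Plane => z 1) d2
    simp [lineDir, ho1, ho2] at c0 c1
    simp only [lineHeight, ho1, ho2, c0, c1] at h1 h2
    linarith
  · have := hpass (i + (N - 1))
    rwa [show i + 1 + (N - 1) = i + (N - 1) + 1 by omega]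

open Real

/-! ### Fans -/

/-- A line passes a fan of `2 m` triangles around one end of the long side, in normal form. The
centre of the fan has distance `g` from the line, the first long side of the fan makes the angle `y`
with the line, the triangles have angle `α` at the centre, and `r` is the length of the short sides
at the centre. All vertices of the fan, with the exception of the first and the last, are on the
other side of the line. -/
def Fan (α r g y : ℝ) (m : ℕ) : Prop :=
  0 < g ∧ (∀ l : ℕ, l < m → g < r * sin (y + (2 * l + 1) * α)) ∧
    ∀ l : ℕ, l < m → 0 < l → g < sin (y + 2 * l * α)

/-- Splitting off the first two triangles of a fan. -/
theorem fan_succ {α r g y : ℝ} {m : ℕ} : Fan α r g y (m + 2) ↔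
    g < r * sin (y + α) ∧ g < sin (y + 2 * α) ∧ Fan α r g (y + 2 * α) (m + 1) := by
  constructor
  · rintro ⟨h1, h2, h3⟩
    refine ⟨by simpa using h2 0 (by omega), by simpa using h3 1 (by omega) one_pos, h1,
      fun l hl => ?_, fun l hl hl0 => ?_⟩
    · have := h2 (l + 1) (by omega)
      push_cast at this
      rwa [show y + 2 * α + (2 * l + 1) * α = y + (2 * (l + 1) + 1) * α by ring]
    · have := h3 (l + 1) (by omega) (by omega)
      push_cast at this
      rwa [show y + 2 * α + 2 * l * α = y + 2 * (l + 1) * α by ring]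
  · rintro ⟨h1, h2, h3, h4, h5⟩
    refine ⟨h3, fun l hl => ?_, fun l hl hl0 => ?_⟩
    · cases l with
      | zero => simpa using h1
      | succ l =>
        have := h4 l (by omega)
        push_cast
        rwa [show y + 2 * α + (2 * l + 1) * α = y + (2 * (l + 1) + 1) * α by ring] at this
    · cases l with
      | zero => exact absurd hl0 (lt_irrefl 0)
      | succ l =>
        cases l with
        | zero => simpa using h2
        | succ l =>
          have := h5 (l + 1) (by omega) (by omega)
          push_cast at this ⊢
          rwa [show y + 2 * α + 2 * (l + 1) * α = y + 2 * (l + 1 + 1) * α by ring] at this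

theorem fan_one {α r g y : ℝ} : Fan α r g y 1 ↔ 0 < g ∧ g < r * sin (y + α) := by
  constructor
  · rintro ⟨h1, h2, -⟩
    exact ⟨h1, by simpa using h2 0 one_pos⟩
  · rintro ⟨h1, h2⟩
    refine ⟨h1, fun l hl => ?_, fun l hl hl0 => by omega⟩
    obtain rfl : l = 0 := by omega
    simpa using h2

/-- The sign `1` if the long side is crossed on entering a fan, and `-1` at a corner. -/
def startSign : Side → ℝ
  | Side.three => 1
  | _ => -1

theorem sin_orient {o : ℝ} (ho : o = 1 ∨ o = -1) (x : ℝ) : o * sin x = sin (o * x) := by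
  rcases ho with h | h <;> simp [h]

section Darts

variable {α β : ℝ} {t : Placement}

/-- The heights of the vertices of the first triangle of a fan around vertex `1`, up to
orientation. The angle `o φ + π` will be the angle `y` of `Fan`. -/
theorem vertexHeight_fan_one (ho : t.o = 1 ∨ t.o = -1) :
    t.o * vertexHeight α β t Side.two = t.o * t.h - sin (t.o * t.φ + π) ∧
    t.o * vertexHeight α β t Side.three =
      t.o * t.h - sideTwo α β * sin (t.o * t.φ + π + α) := by
  have h2 : t.o * t.o = 1 := by rcases ho with h | h <;> simp [h]
  constructor
  · rw [vertexHeight, mul_add, sin_orient ho, sin_add_pi]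
    ring
  · rw [vertexHeight, mul_add, mul_left_comm, sin_orient ho,
      show t.o * (t.φ + t.o * α) = t.o * t.φ + α by linear_combination α * h2,
      show t.o * t.φ + π + α = t.o * t.φ + α + π by ring, sin_add_pi]
    ring

/-- The heights of the vertices of the first triangle of a fan around vertex `2`, up to
orientation. -/
theorem vertexHeight_fan_two (h : sin (α + β) ≠ 0) (ho : t.o = 1 ∨ t.o = -1) :
    -t.o * vertexHeight α β t Side.one =
      -t.o * (t.h + sin t.φ) - sin (-t.o * t.φ) ∧
    -t.o * vertexHeight α β t Side.three =
      -t.o * (t.h + sin t.φ) - sideTwo β α * sin (-t.o * t.φ + β) := by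
  have h2 : t.o * t.o = 1 := by rcases ho with h | h <;> simp [h]
  constructor
  · rw [vertexHeight, neg_mul t.o t.φ, sin_neg, ← sin_orient ho]
    ring
  · rw [vertexHeight_three h ho,
      show -t.o * t.φ + β = -(t.o * (t.φ - t.o * β)) by linear_combination (-β) * h2, sin_neg,
      ← sin_orient ho]
    ring

/-- Entering a fan around vertex `1`. -/
theorem passes_fan_one (ho : t.o = 1 ∨ t.o = -1) {p : Side} (hp : p ≠ Side.two) :
    Passes α β p Side.two t ↔
      startSign p * (t.o * t.h - sin (t.o * t.φ + π)) < 0 ∧ 0 < t.o * t.h ∧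
        t.o * t.h < sideTwo α β * sin (t.o * t.φ + π + α) := by
  obtain ⟨e1, e2⟩ := vertexHeight_fan_one (α := α) (β := β) ho
  have e3 : vertexHeight α β t Side.one = t.h := rfl
  rw [← e1]
  rw [eq_sub_iff_add_eq, ← eq_sub_iff_add_eq'] at e2
  rw [e2]
  cases p
  · simp only [Passes, third, turnSign, startSign, e3]
    constructor
    · rintro ⟨h1, h2, h3⟩
      refine ⟨?_, ?_, ?_⟩ <;> linarith
    · rintro ⟨h1, h2, h3⟩
      refine ⟨?_, ?_, ?_⟩ <;> linarith
  · exact absurd rfl hp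
  · simp only [Passes, third, turnSign, startSign, e3]
    constructor
    · rintro ⟨h1, h2, h3⟩
      refine ⟨?_, ?_, ?_⟩ <;> linarith
    · rintro ⟨h1, h2, h3⟩
      refine ⟨?_, ?_, ?_⟩ <;> linarith

/-- Entering a fan around vertex `2`. -/
theorem passes_fan_two (h : sin (α + β) ≠ 0) (ho : t.o = 1 ∨ t.o = -1) {p : Side}
    (hp : p ≠ Side.one) :
    Passes α β p Side.one t ↔
      startSign p * (-t.o * (t.h + sin t.φ) - sin (-t.o * t.φ)) < 0 ∧
        0 < -t.o * (t.h + sin t.φ) ∧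
        -t.o * (t.h + sin t.φ) < sideTwo β α * sin (-t.o * t.φ + β) := by
  obtain ⟨e1, e2⟩ := vertexHeight_fan_two h ho
  have e3 : vertexHeight α β t Side.two = t.h + sin t.φ := rfl
  rw [← e1]
  rw [eq_sub_iff_add_eq, ← eq_sub_iff_add_eq'] at e2
  rw [e2]
  cases p
  · exact absurd rfl hp
  · simp only [Passes, third, turnSign, startSign, e3]
    constructor
    · rintro ⟨h1, h2, h3⟩
      refine ⟨?_, ?_, ?_⟩ <;> linarith
    · rintro ⟨h1, h2, h3⟩
      refine ⟨?_, ?_, ?_⟩ <;> linarith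
  · simp only [Passes, third, turnSign, startSign, e3]
    constructor
    · rintro ⟨h1, h2, h3⟩
      refine ⟨?_, ?_, ?_⟩ <;> linarith
    · rintro ⟨h1, h2, h3⟩
      refine ⟨?_, ?_, ?_⟩ <;> linarith

/-- Leaving a triangle of a fan around vertex `1` through the long side. -/
theorem passes_long_one (ho : t.o = 1 ∨ t.o = -1) :
    Passes α β Side.two Side.three (cross α β Side.two t) ↔
      t.o * t.h < sin (t.o * t.φ + π + 2 * α) ∧ 0 < t.o * t.h ∧
        t.o * t.h < sideTwo α β * sin (t.o * t.φ + π + α) := by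
  have ho' : (cross α β Side.two t).o = 1 ∨ (cross α β Side.two t).o = -1 := by
    rw [cross_o]; rcases ho with ho | ho <;> simp [ho]
  obtain ⟨-, e2⟩ := vertexHeight_fan_one (α := α) (β := β) ho
  have h2 : t.o * t.o = 1 := by rcases ho with h | h <;> simp [h]
  have e4 : vertexHeight α β (cross α β Side.two t) Side.three =
      vertexHeight α β t Side.three := by
    simp only [vertexHeight, cross]
    ring_nf
  have e5 : t.o * vertexHeight α β (cross α β Side.two t) Side.two =
      t.o * t.h - sin (t.o * t.φ + π + 2 * α) := by
    rw [vertexHeight, mul_add, sin_orient ho, show t.o * t.φ + π + 2 * α =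
      t.o * t.φ + 2 * α + π by ring, sin_add_pi]
    simp only [cross]
    rw [show t.o * (t.φ + 2 * t.o * α) = t.o * t.φ + 2 * α by linear_combination 2 * α * h2]
    ring
  have e6 : vertexHeight α β (cross α β Side.two t) Side.one = t.h := rfl
  have e7 : (cross α β Side.two t).o = -t.o := rfl
  simp only [Passes, third, turnSign, e4, e6, e7, mul_neg, mul_one, neg_neg, e5, e2]
  constructor
  · rintro ⟨h1, h2, h3⟩
    refine ⟨?_, ?_, ?_⟩ <;> linarith
  · rintro ⟨h1, h2, h3⟩
    refine ⟨?_, ?_, ?_⟩ <;> linarith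

/-- Leaving a triangle of a fan around vertex `2` through the long side. -/
theorem passes_long_two (h : sin (α + β) ≠ 0) (ho : t.o = 1 ∨ t.o = -1) :
    Passes α β Side.one Side.three (cross α β Side.one t) ↔
      -t.o * (t.h + sin t.φ) < sin (-t.o * t.φ + 2 * β) ∧ 0 < -t.o * (t.h + sin t.φ) ∧
        -t.o * (t.h + sin t.φ) < sideTwo β α * sin (-t.o * t.φ + β) := by
  have h2 : t.o * t.o = 1 := by rcases ho with h | h <;> simp [h]
  obtain ⟨-, e2⟩ := vertexHeight_fan_two h ho
  have e4 : vertexHeight α β (cross α β Side.one t) Side.three =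
      vertexHeight α β t Side.three := vertexHeight_cross h ho (by simp)
  have e5 : -t.o * vertexHeight α β (cross α β Side.one t) Side.one =
      -t.o * (t.h + sin t.φ) - sin (-t.o * t.φ + 2 * β) := by
    simp only [vertexHeight, cross]
    rw [show -t.o * t.φ + 2 * β = -(t.o * (t.φ - 2 * t.o * β)) by
      linear_combination (-2 * β) * h2, sin_neg, ← sin_orient ho]
    ring
  have e6 : vertexHeight α β (cross α β Side.one t) Side.two = t.h + sin t.φ := by
    simp [vertexHeight, cross]
  have e7 : (cross α β Side.one t).o = -t.o := rfl
  simp only [Passes, third, turnSign, e4, e6, e7, mul_one, e5, e2]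
  constructor
  · rintro ⟨h1, h2, h3⟩
    refine ⟨?_, ?_, ?_⟩ <;> linarith
  · rintro ⟨h1, h2, h3⟩
    refine ⟨?_, ?_, ?_⟩ <;> linarith

end Darts

/-- The word `(23)^m 2`, which stands for the passage of a fan of `2 (m + 1)` triangles around
vertex `1`. -/
def dartOne : ℕ → Word
  | 0 => [Side.two]
  | m + 1 => Side.two :: Side.three :: dartOne m

/-- The word `(13)^m 1`, which stands for the passage of a fan of `2 (m + 1)` triangles around
vertex `2`. -/
def dartTwo : ℕ → Word
  | 0 => [Side.one]
  | m + 1 => Side.one :: Side.three :: dartTwo m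

theorem cross_three_two (α β : ℝ) (t : Placement) :
    cross α β Side.three (cross α β Side.two t) = ⟨t.o, t.φ + 2 * t.o * α, t.h⟩ := by
  simp [cross]

theorem cross_three_one (α β : ℝ) (t : Placement) :
    cross α β Side.three (cross α β Side.one t) =
      ⟨t.o, t.φ - 2 * t.o * β, t.h + sin t.φ - sin (t.φ - 2 * t.o * β)⟩ := by
  simp [cross]

/-- Following a dart means to pass a fan, after having crossed the side before it. -/
theorem follows_dartOne {α β : ℝ} : ∀ (m : ℕ) {t : Placement} (_ : t.o = 1 ∨ t.o = -1) {p : Side}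
    (_ : p ≠ Side.two), Follows α β p t (dartOne m) ↔
      startSign p * (t.o * t.h - sin (t.o * t.φ + π)) < 0 ∧
        Fan α (sideTwo α β) (t.o * t.h) (t.o * t.φ + π) (m + 1)
  | 0, t, ho, p, hp => by
    rw [dartOne, Follows, Follows, passes_fan_one ho hp, fan_one, and_true]
  | m + 1, t, ho, p, hp => by
    have h2 : t.o * t.o = 1 := by rcases ho with h | h <;> simp [h]
    rw [dartOne, Follows, Follows, passes_fan_one ho hp, passes_long_one ho, cross_three_two,
      follows_dartOne m (by exact ho) (by simp), fan_succ]
    simp only [startSign]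
    rw [show t.o * (t.φ + 2 * t.o * α) + π = t.o * t.φ + π + 2 * α by
      linear_combination 2 * α * h2]
    constructor
    · rintro ⟨⟨h1, h2, h3⟩, ⟨h4, h5, h6⟩, h7, h8⟩
      exact ⟨h1, h3, h4, h8⟩
    · rintro ⟨h1, h3, h4, h8⟩
      exact ⟨⟨h1, h8.1, h3⟩, ⟨h4, h8.1, h3⟩, by linarith, h8⟩

theorem follows_dartTwo {α β : ℝ} (h : sin (α + β) ≠ 0) : ∀ (m : ℕ) {t : Placement}
    (_ : t.o = 1 ∨ t.o = -1) {p : Side} (_ : p ≠ Side.one), Follows α β p t (dartTwo m) ↔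
      startSign p * (-t.o * (t.h + sin t.φ) - sin (-t.o * t.φ)) < 0 ∧
        Fan β (sideTwo β α) (-t.o * (t.h + sin t.φ)) (-t.o * t.φ) (m + 1)
  | 0, t, ho, p, hp => by
    rw [dartTwo, Follows, Follows, passes_fan_two h ho hp, fan_one, and_true]
  | m + 1, t, ho, p, hp => by
    have h2 : t.o * t.o = 1 := by rcases ho with h | h <;> simp [h]
    rw [dartTwo, Follows, Follows, passes_fan_two h ho hp, passes_long_two h ho, cross_three_one,
      follows_dartTwo h m (by exact ho) (by simp), fan_succ]
    simp only [startSign, sub_add_cancel]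
    rw [show -t.o * (t.φ - 2 * t.o * β) = -t.o * t.φ + 2 * β by
      linear_combination 2 * β * h2]
    constructor
    · rintro ⟨⟨h1, h2, h3⟩, ⟨h4, h5, h6⟩, h7, h8⟩
      exact ⟨h1, h3, h4, h8⟩
    · rintro ⟨h1, h3, h4, h8⟩
      exact ⟨⟨h1, h8.1, h3⟩, ⟨h4, h8.1, h3⟩, by linarith, h8⟩

section

/-- The last letter of the word `a :: l`. -/
def lastLetter : Side → Word → Side
  | a, [] => a
  | _, b :: l => lastLetter b l

theorem lastLetter_append : ∀ (a : Side) (l l' : Word),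
    lastLetter a (l ++ l') = lastLetter (lastLetter a l) l'
  | _, [], _ => rfl
  | _, b :: l, l' => lastLetter_append b l l'

theorem run_append {α β : ℝ} : ∀ (t : Placement) (l l' : Word),
    run α β t (l ++ l') = run α β (run α β t l) l'
  | _, [], _ => rfl
  | t, b :: l, l' => run_append (cross α β b t) l l'

theorem follows_append {α β : ℝ} : ∀ (a : Side) (t : Placement) (l l' : Word),
    Follows α β a t (l ++ l') ↔
      Follows α β a t l ∧ Follows α β (lastLetter a l) (run α β t l) l'
  | _, _, [], _ => by simp [Follows, lastLetter, run]
  | a, t, b :: l, l' => by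
    rw [List.cons_append, Follows, Follows, follows_append b _ l l', and_assoc]
    rfl

/-! ### Words of fans -/

theorem wordPow_succ' (w : Word) (k : ℕ) : wordPow w (k + 1) = wordPow w k ++ w := by
  induction k with
  | zero => simp [wordPow]
  | succ k ih =>
    rw [wordPow, ih, ← List.append_assoc, ← ih, wordPow]

theorem w23_succ (m : ℕ) : w23 (m + 1) = dartOne m ++ [Side.three] := by
  induction m with
  | zero => rfl
  | succ m ih =>
    rw [w23, wordPow, ← w23, ih]
    rfl

theorem w13_succ (m : ℕ) : w13 (m + 1) = dartTwo m ++ [Side.three] := by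
  induction m with
  | zero => rfl
  | succ m ih =>
    rw [w13, wordPow, ← w13, ih]
    rfl

theorem lastLetter_dartOne (a : Side) (m : ℕ) : lastLetter a (dartOne m) = Side.two := by
  induction m generalizing a with
  | zero => rfl
  | succ m ih => exact ih _

theorem lastLetter_dartTwo (a : Side) (m : ℕ) : lastLetter a (dartTwo m) = Side.one := by
  induction m generalizing a with
  | zero => rfl
  | succ m ih => exact ih _

section

variable {α β : ℝ}

theorem run_dartOne (m : ℕ) (t : Placement) :
    run α β t (dartOne m) = ⟨-t.o, t.φ + 2 * (m + 1) * t.o * α, t.h⟩ := by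
  induction m generalizing t with
  | zero => simp [dartOne, run, cross]
  | succ m ih =>
    rw [dartOne, run, run, cross_three_two, ih]
    push_cast
    congr 1
    ring

theorem run_dartTwo (m : ℕ) (t : Placement) :
    run α β t (dartTwo m) = ⟨-t.o, t.φ - 2 * (m + 1) * t.o * β,
      t.h + sin t.φ - sin (t.φ - 2 * (m + 1) * t.o * β)⟩ := by
  induction m generalizing t with
  | zero => simp [dartTwo, run, cross]
  | succ m ih =>
    rw [dartTwo, run, run, cross_three_one, ih]
    push_cast
    have e : t.φ - 2 * t.o * β - 2 * (m + 1) * t.o * β = t.φ - 2 * (m + 1 + 1) * t.o * β := by ring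
    simp only [e]
    congr 1
    ring

theorem run_w23 (m : ℕ) (t : Placement) :
    run α β t (w23 (m + 1)) = ⟨t.o, t.φ + 2 * (m + 1) * t.o * α, t.h⟩ := by
  rw [w23_succ, run_append, run_dartOne, run, run, cross, neg_neg]

theorem run_w13 (m : ℕ) (t : Placement) :
    run α β t (w13 (m + 1)) = ⟨t.o, t.φ - 2 * (m + 1) * t.o * β,
      t.h + sin t.φ - sin (t.φ - 2 * (m + 1) * t.o * β)⟩ := by
  rw [w13_succ, run_append, run_dartTwo, run, run, cross, neg_neg]

theorem lastLetter_w23 (a : Side) (m : ℕ) : lastLetter a (w23 (m + 1)) = Side.three := by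
  rw [w23_succ, lastLetter_append]; rfl

theorem lastLetter_w13 (a : Side) (m : ℕ) : lastLetter a (w13 (m + 1)) = Side.three := by
  rw [w13_succ, lastLetter_append]; rfl

theorem dartOne_eq_cross (m : ℕ) {t : Placement} : run α β t (dartOne m) =
    cross α β Side.two ⟨t.o, t.φ + 2 * m * t.o * α, t.h⟩ := by
  rw [run_dartOne, cross]
  congr 1
  ring

theorem dartTwo_eq_cross (m : ℕ) {t : Placement} : run α β t (dartTwo m) =
    cross α β Side.one ⟨t.o, t.φ - 2 * m * t.o * β,
      t.h + sin t.φ - sin (t.φ - 2 * m * t.o * β)⟩ := by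
  rw [run_dartTwo, cross]
  simp only [sub_add_cancel]
  have e : t.φ - 2 * (m + 1) * t.o * β = t.φ - 2 * m * t.o * β - 2 * t.o * β := by ring
  rw [e]

/-- A fan around vertex `1` and its last long side, which the line crosses if the other
end of this side is on the other side of the line. -/
theorem follows_w23 (m : ℕ) {t : Placement} (ho : t.o = 1 ∨ t.o = -1) {p : Side}
    (hp : p ≠ Side.two) : Follows α β p t (w23 (m + 1)) ↔
      startSign p * (t.o * t.h - sin (t.o * t.φ + π)) < 0 ∧
        Fan α (sideTwo α β) (t.o * t.h) (t.o * t.φ + π) (m + 1) ∧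
        t.o * t.h < sin (t.o * t.φ + π + 2 * (m + 1) * α) := by
  have h2 : t.o * t.o = 1 := by rcases ho with h | h <;> simp [h]
  rw [w23_succ, follows_append, follows_dartOne m ho hp, lastLetter_dartOne, dartOne_eq_cross,
    Follows, Follows, passes_long_one (by exact ho), and_assoc]
  simp only
  rw [show t.o * (t.φ + 2 * m * t.o * α) + π + 2 * α = t.o * t.φ + π + 2 * (m + 1) * α by
      linear_combination 2 * m * α * h2,
    show t.o * (t.φ + 2 * m * t.o * α) + π + α = t.o * t.φ + π + (2 * m + 1) * α by
      linear_combination 2 * m * α * h2]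
  constructor
  · rintro ⟨h1, h2, ⟨h3, -⟩, -⟩
    exact ⟨h1, h2, h3⟩
  · rintro ⟨h1, h2, h3⟩
    exact ⟨h1, h2, ⟨h3, h2.1, h2.2.1 m (by omega)⟩, trivial⟩

/-- A fan around vertex `2` and its last long side. -/
theorem follows_w13 (h : sin (α + β) ≠ 0) (m : ℕ) {t : Placement} (ho : t.o = 1 ∨ t.o = -1)
    {p : Side} (hp : p ≠ Side.one) : Follows α β p t (w13 (m + 1)) ↔
      startSign p * (-t.o * (t.h + sin t.φ) - sin (-t.o * t.φ)) < 0 ∧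
        Fan β (sideTwo β α) (-t.o * (t.h + sin t.φ)) (-t.o * t.φ) (m + 1) ∧
        -t.o * (t.h + sin t.φ) < sin (-t.o * t.φ + 2 * (m + 1) * β) := by
  have h2 : t.o * t.o = 1 := by rcases ho with h | h <;> simp [h]
  rw [w13_succ, follows_append, follows_dartTwo h m ho hp, lastLetter_dartTwo, dartTwo_eq_cross,
    Follows, Follows, passes_long_two h (by exact ho), and_assoc]
  simp only [sub_add_cancel]
  rw [show -t.o * (t.φ - 2 * m * t.o * β) + 2 * β = -t.o * t.φ + 2 * (m + 1) * β by
      linear_combination 2 * m * β * h2,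
    show -t.o * (t.φ - 2 * m * t.o * β) + β = -t.o * t.φ + (2 * m + 1) * β by
      linear_combination 2 * m * β * h2]
  constructor
  · rintro ⟨h1, h2, ⟨h3, -⟩, -⟩
    exact ⟨h1, h2, h3⟩
  · rintro ⟨h1, h2, h3⟩
    exact ⟨h1, h2, ⟨h3, h2.1, h2.2.1 m (by omega)⟩, trivial⟩

/-! ### Shifting the angle by full turns -/

/-- Adding full turns to the angle of a placement. Angles are real numbers, and a closed path may
return to its first placement with another lift of the angle. -/
noncomputable def turn (z : ℤ) (t : Placement) : Placement := ⟨t.o, t.φ + z * (2 * π), t.h⟩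

theorem turn_add (z w : ℤ) (t : Placement) : turn z (turn w t) = turn (z + w) t := by
  simp [turn]; ring

theorem turn_zero (t : Placement) : turn 0 t = t := by simp [turn]

theorem cross_turn (s : Side) (z : ℤ) (t : Placement) :
    cross α β s (turn z t) = turn z (cross α β s t) := by
  cases s
  · simp only [cross, turn, sin_add_int_mul_two_pi]
    rw [show t.φ + z * (2 * π) - 2 * t.o * β = t.φ - 2 * t.o * β + z * (2 * π) by ring,
      sin_add_int_mul_two_pi]
  · simp only [cross, turn]
    congr 1
    ring
  · rfl

theorem vertexHeight_turn (s : Side) (z : ℤ) (t : Placement) :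
    vertexHeight α β (turn z t) s = vertexHeight α β t s := by
  cases s
  · rfl
  · simp [vertexHeight, turn]
  · simp only [vertexHeight, turn]
    rw [show t.φ + z * (2 * π) + t.o * α = t.φ + t.o * α + z * (2 * π) by ring,
      sin_add_int_mul_two_pi]

theorem run_turn (l : Word) (z : ℤ) (t : Placement) :
    run α β (turn z t) l = turn z (run α β t l) := by
  induction l generalizing t with
  | nil => rfl
  | cons b l ih => rw [run, cross_turn, ih, run]

theorem follows_turn (l : Word) (a : Side) (z : ℤ) (t : Placement) :
    Follows α β a (turn z t) l ↔ Follows α β a t l := by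
  induction l generalizing t a with
  | nil => rfl
  | cons b l ih =>
    rw [Follows, Follows, cross_turn, ih, Passes, Passes]
    simp only [vertexHeight_turn]
    rfl

end

end

section

/-! ### Zigzags -/

/-- The turning angle of the path of long sides at a fan of `2 m` triangles with angle `α`. -/
noncomputable def turnAngle (m : ℕ) (α : ℝ) : ℝ := π - 2 * m * α

/-- The heights of the upper vertices of a zigzag of unit steps: a step down turns by `-θ`
from the previous step up, a step up turns by `θ'` from the previous step down. The zigzag starts at
height `p`, and the angle of the step up before it is `y`. -/
noncomputable def zigHeight (θ θ' y p : ℝ) : ℕ → ℝ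
  | 0 => p
  | j + 1 => zigHeight θ θ' y p j + (sin (y + j * (θ' - θ) - θ) + sin (y + (j + 1) * (θ' - θ)))

/-- The condition that the line passes `2 k` consecutive fans of `2 m` triangles, alternately around
the two ends of the long side: those on the left have angle `α` and short sides `r` at the centre,
those on the right have angle `β` and short sides `s`. -/
def ZigFans (m : ℕ) (α r β s y p : ℝ) (k : ℕ) : Prop :=
  ∀ j : ℕ, j < k →
    Fan α r (zigHeight (turnAngle m α) (turnAngle m β) y p j)
      (y + j * (turnAngle m β - turnAngle m α)) m ∧
    Fan β s (-(zigHeight (turnAngle m α) (turnAngle m β) y p j +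
        sin (y + j * (turnAngle m β - turnAngle m α) - turnAngle m α)))
      (turnAngle m α - (y + j * (turnAngle m β - turnAngle m α))) m

/-- The placement at which a fan around vertex `1` on the left begins: its previous long side has
angle `y`, and its centre has height `p`. -/
noncomputable def startOne (y p : ℝ) : Placement := ⟨1, y - π, p⟩

/-- The placement at which a fan around vertex `2` on the left begins. -/
noncomputable def startTwo (y p : ℝ) : Placement := ⟨-1, y, p - sin y⟩

variable {α β : ℝ}

/-! The word `u = (23)^{n-1} (13)^{n-1}` is one double step of a zigzag with centres of type `1` on
the left, `v = (13)^{n-1} (23)^{n-1}` one of a zigzag with centres of type `2` on the left. -/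

theorem run_u (m : ℕ) (y p : ℝ) : run α β (startOne y p) (w23 (m + 1) ++ w13 (m + 1)) =
    startOne (y + (turnAngle (m + 1) β - turnAngle (m + 1) α))
      (p + (sin (y - turnAngle (m + 1) α) +
        sin (y + (turnAngle (m + 1) β - turnAngle (m + 1) α)))) := by
  rw [run_append, run_w23, run_w13]
  simp only [startOne, turnAngle]
  push_cast
  have e1 : y - π + 2 * (m + 1) * 1 * α = y - (π - 2 * (m + 1) * α) := by ring
  have e2 : y - (π - 2 * (m + 1) * α) - 2 * (m + 1) * 1 * β =
    y + (π - 2 * (m + 1) * β - (π - 2 * (m + 1) * α)) - π := by ring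
  rw [e1, e2, sin_sub_pi]
  congr 1
  ring

theorem run_v (m : ℕ) (y p : ℝ) : run α β (startTwo y p) (w13 (m + 1) ++ w23 (m + 1)) =
    startTwo (y + (turnAngle (m + 1) α - turnAngle (m + 1) β))
      (p + (sin (y - turnAngle (m + 1) β) +
        sin (y + (turnAngle (m + 1) α - turnAngle (m + 1) β)))) := by
  rw [run_append, run_w13, run_w23]
  simp only [startTwo, turnAngle]
  push_cast
  have e1 : y - 2 * (m + 1) * -1 * β = y - (π - 2 * (m + 1) * β) + π := by ring
  have e2 : y - (π - 2 * (m + 1) * β) + π + 2 * (m + 1) * -1 * α =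
    y + (π - 2 * (m + 1) * α - (π - 2 * (m + 1) * β)) := by ring
  rw [e1, e2, sin_add_pi]
  congr 1
  ring

theorem sin_neg_add_pi (x : ℝ) : sin (-x + π) = sin x := by
  rw [neg_add_eq_sub, sin_pi_sub]

theorem follows_u_dart (h : sin (α + β) ≠ 0) (m : ℕ) (y p : ℝ) {a : Side} (ha : a ≠ Side.two) :
    Follows α β a (startOne y p) (w23 (m + 1) ++ dartTwo m) ↔
      startSign a * (p - sin y) < 0 ∧ Fan α (sideTwo α β) p y (m + 1) ∧
        Fan β (sideTwo β α) (-(p + sin (y - turnAngle (m + 1) α))) (turnAngle (m + 1) α - y)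
          (m + 1) := by
  rw [follows_append, follows_w23 m (Or.inl rfl) ha, run_w23, lastLetter_w23,
    follows_dartTwo h m (Or.inl rfl) (by simp)]
  simp only [startOne, turnAngle, startSign]
  push_cast
  rw [show y - π + 2 * (m + 1) * 1 * α = y - (π - 2 * (m + 1) * α) by ring,
    show 1 * (y - π) + π = y by ring,
    show -1 * (y - (π - 2 * (m + 1) * α)) = π - 2 * (m + 1) * α - y by ring,
    show y + 2 * (m + 1) * α = y - (π - 2 * (m + 1) * α) + π by ring, sin_add_pi,
    show π - 2 * (m + 1) * α - y = -(y - (π - 2 * (m + 1) * α)) by ring, sin_neg, one_mul,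
    neg_one_mul]
  constructor
  · rintro ⟨⟨h1, h2, h3⟩, h4, h5⟩
    exact ⟨h1, h2, h5⟩
  · rintro ⟨h1, h2, h5⟩
    refine ⟨⟨h1, h2, ?_⟩, ?_, h5⟩
    · linarith [h5.1]
    · linarith [h2.1]

theorem follows_u (h : sin (α + β) ≠ 0) (m : ℕ) (y p : ℝ) {a : Side} (ha : a ≠ Side.two) :
    Follows α β a (startOne y p) (w23 (m + 1) ++ w13 (m + 1)) ↔
      startSign a * (p - sin y) < 0 ∧ Fan α (sideTwo α β) p y (m + 1) ∧
        Fan β (sideTwo β α) (-(p + sin (y - turnAngle (m + 1) α))) (turnAngle (m + 1) α - y)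
          (m + 1) ∧
        0 < p + (sin (y - turnAngle (m + 1) α) +
          sin (y + (turnAngle (m + 1) β - turnAngle (m + 1) α))) := by
  rw [follows_append, follows_w23 m (Or.inl rfl) ha, run_w23, lastLetter_w23,
    follows_w13 h m (Or.inl rfl) (by simp)]
  simp only [startOne, turnAngle, startSign]
  push_cast
  rw [show y - π + 2 * (m + 1) * 1 * α = y - (π - 2 * (m + 1) * α) by ring,
    show 1 * (y - π) + π = y by ring,
    show -1 * (y - (π - 2 * (m + 1) * α)) + 2 * (m + 1) * β =
      -(y + (π - 2 * (m + 1) * β - (π - 2 * (m + 1) * α))) + π by ring, sin_neg_add_pi,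
    show -1 * (y - (π - 2 * (m + 1) * α)) = π - 2 * (m + 1) * α - y by ring,
    show y + 2 * (m + 1) * α = y - (π - 2 * (m + 1) * α) + π by ring, sin_add_pi,
    show π - 2 * (m + 1) * α - y = -(y - (π - 2 * (m + 1) * α)) by ring, sin_neg, one_mul,
    neg_one_mul]
  constructor
  · rintro ⟨⟨h1, h2, h3⟩, h4, h5, h6⟩
    exact ⟨h1, h2, h5, by linarith⟩
  · rintro ⟨h1, h2, h5, h6⟩
    refine ⟨⟨h1, h2, ?_⟩, ?_, h5, ?_⟩
    · linarith [h5.1]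
    · linarith [h2.1]
    · linarith

theorem follows_v_dart (h : sin (α + β) ≠ 0) (m : ℕ) (y p : ℝ) {a : Side} (ha : a ≠ Side.one) :
    Follows α β a (startTwo y p) (w13 (m + 1) ++ dartOne m) ↔
      startSign a * (p - sin y) < 0 ∧ Fan β (sideTwo β α) p y (m + 1) ∧
        Fan α (sideTwo α β) (-(p + sin (y - turnAngle (m + 1) β))) (turnAngle (m + 1) β - y)
          (m + 1) := by
  rw [follows_append, follows_w13 h m (Or.inr rfl) ha, run_w13, lastLetter_w13,
    follows_dartOne m (Or.inr rfl) (by simp)]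
  simp only [startTwo, turnAngle, startSign]
  push_cast
  rw [show y - 2 * (m + 1) * -1 * β = y - (π - 2 * (m + 1) * β) + π by ring, sin_add_pi,
    show -1 * (y - (π - 2 * (m + 1) * β) + π) + π = π - 2 * (m + 1) * β - y by ring,
    show - -1 * y + 2 * (m + 1) * β = y - (π - 2 * (m + 1) * β) + π by ring, sin_add_pi,
    show π - 2 * (m + 1) * β - y = -(y - (π - 2 * (m + 1) * β)) by ring, sin_neg, neg_neg, one_mul,
    neg_one_mul, sub_add_cancel, one_mul, one_mul]
  simp only [sub_neg_eq_add]
  constructor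
  · rintro ⟨⟨h1, h2, h3⟩, h4, h5⟩
    exact ⟨h1, h2, h5⟩
  · rintro ⟨h1, h2, h5⟩
    refine ⟨⟨h1, h2, ?_⟩, ?_, h5⟩
    · linarith [h5.1]
    · linarith [h2.1]

theorem follows_v (h : sin (α + β) ≠ 0) (m : ℕ) (y p : ℝ) {a : Side} (ha : a ≠ Side.one) :
    Follows α β a (startTwo y p) (w13 (m + 1) ++ w23 (m + 1)) ↔
      startSign a * (p - sin y) < 0 ∧ Fan β (sideTwo β α) p y (m + 1) ∧
        Fan α (sideTwo α β) (-(p + sin (y - turnAngle (m + 1) β))) (turnAngle (m + 1) β - y)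
          (m + 1) ∧
        0 < p + (sin (y - turnAngle (m + 1) β) +
          sin (y + (turnAngle (m + 1) α - turnAngle (m + 1) β))) := by
  rw [follows_append, follows_w13 h m (Or.inr rfl) ha, run_w13, lastLetter_w13,
    follows_w23 m (Or.inr rfl) (by simp)]
  simp only [startTwo, turnAngle, startSign]
  push_cast
  rw [show y - 2 * (m + 1) * -1 * β = y - (π - 2 * (m + 1) * β) + π by ring, sin_add_pi,
    show -1 * (y - (π - 2 * (m + 1) * β) + π) + π + 2 * (m + 1) * α =
      -(y + (π - 2 * (m + 1) * α - (π - 2 * (m + 1) * β))) + π by ring, sin_neg_add_pi,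
    show -1 * (y - (π - 2 * (m + 1) * β) + π) + π = π - 2 * (m + 1) * β - y by ring,
    show - -1 * y + 2 * (m + 1) * β = y - (π - 2 * (m + 1) * β) + π by ring, sin_add_pi,
    show π - 2 * (m + 1) * β - y = -(y - (π - 2 * (m + 1) * β)) by ring, sin_neg, neg_neg, one_mul,
    neg_one_mul, sub_add_cancel, one_mul, one_mul]
  simp only [sub_neg_eq_add]
  constructor
  · rintro ⟨⟨h1, h2, h3⟩, h4, h5, h6⟩
    exact ⟨h1, h2, h5, by linarith⟩
  · rintro ⟨h1, h2, h5, h6⟩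
    refine ⟨⟨h1, h2, ?_⟩, ?_, h5, ?_⟩
    · linarith [h5.1]
    · linarith [h2.1]
    · linarith

theorem lastLetter_pow_u (m k : ℕ) :
    lastLetter Side.three (wordPow (w23 (m + 1) ++ w13 (m + 1)) k) = Side.three := by
  induction k with
  | zero => rfl
  | succ k ih => rw [wordPow, lastLetter_append, lastLetter_append, lastLetter_w13, ih]

theorem lastLetter_pow_v (m k : ℕ) :
    lastLetter Side.three (wordPow (w13 (m + 1) ++ w23 (m + 1)) k) = Side.three := by
  induction k with
  | zero => rfl
  | succ k ih => rw [wordPow, lastLetter_append, lastLetter_append, lastLetter_w23, ih]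

theorem lastLetter_pow_u_succ (m k : ℕ) (a : Side) :
    lastLetter a (wordPow (w23 (m + 1) ++ w13 (m + 1)) (k + 1)) = Side.three := by
  rw [wordPow, lastLetter_append, lastLetter_append, lastLetter_w13, lastLetter_pow_u]

theorem lastLetter_pow_v_succ (m k : ℕ) (a : Side) :
    lastLetter a (wordPow (w13 (m + 1) ++ w23 (m + 1)) (k + 1)) = Side.three := by
  rw [wordPow, lastLetter_append, lastLetter_append, lastLetter_w23, lastLetter_pow_v]

theorem run_pow_u (m : ℕ) (y p : ℝ) (k : ℕ) :
    run α β (startOne y p) (wordPow (w23 (m + 1) ++ w13 (m + 1)) k) =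
      startOne (y + k * (turnAngle (m + 1) β - turnAngle (m + 1) α))
        (zigHeight (turnAngle (m + 1) α) (turnAngle (m + 1) β) y p k) := by
  induction k with
  | zero => simp [wordPow, run, zigHeight]
  | succ k ih =>
    rw [wordPow_succ', run_append, ih, run_u, zigHeight]
    push_cast
    rw [show y + k * (turnAngle (m + 1) β - turnAngle (m + 1) α) +
      (turnAngle (m + 1) β - turnAngle (m + 1) α) =
      y + (k + 1) * (turnAngle (m + 1) β - turnAngle (m + 1) α) by ring]

theorem run_pow_v (m : ℕ) (y p : ℝ) (k : ℕ) :
    run α β (startTwo y p) (wordPow (w13 (m + 1) ++ w23 (m + 1)) k) =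
      startTwo (y + k * (turnAngle (m + 1) α - turnAngle (m + 1) β))
        (zigHeight (turnAngle (m + 1) β) (turnAngle (m + 1) α) y p k) := by
  induction k with
  | zero => simp [wordPow, run, zigHeight]
  | succ k ih =>
    rw [wordPow_succ', run_append, ih, run_v, zigHeight]
    push_cast
    rw [show y + k * (turnAngle (m + 1) α - turnAngle (m + 1) β) +
      (turnAngle (m + 1) α - turnAngle (m + 1) β) =
      y + (k + 1) * (turnAngle (m + 1) α - turnAngle (m + 1) β) by ring]

theorem follows_pow_u (h : sin (α + β) ≠ 0) (m : ℕ) (y p : ℝ) {a : Side} (ha : a ≠ Side.two)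
    (k : ℕ) : Follows α β a (startOne y p) (wordPow (w23 (m + 1) ++ w13 (m + 1)) (k + 1)) ↔
      startSign a * (p - sin y) < 0 ∧
        ZigFans (m + 1) α (sideTwo α β) β (sideTwo β α) y p (k + 1) ∧
        0 < zigHeight (turnAngle (m + 1) α) (turnAngle (m + 1) β) y p (k + 1) := by
  induction k with
  | zero =>
    rw [wordPow, wordPow, List.append_nil, follows_u h m y p ha]
    simp [ZigFans, zigHeight]
    tauto
  | succ k ih =>
    rw [wordPow_succ', follows_append, ih, lastLetter_pow_u_succ, run_pow_u,
      follows_u h m _ _ (by simp)]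
    have e1 : y + ((k + 1 : ℕ) : ℝ) * (turnAngle (m + 1) β - turnAngle (m + 1) α) +
      (turnAngle (m + 1) β - turnAngle (m + 1) α) =
      y + (((k + 1 : ℕ) : ℝ) + 1) * (turnAngle (m + 1) β - turnAngle (m + 1) α) := by ring
    rw [e1, ← zigHeight]
    simp only [startSign]
    constructor
    · rintro ⟨⟨h1, h2, h3⟩, h4, h5, h6, h7⟩
      refine ⟨h1, fun j hj => ?_, h7⟩
      rcases Nat.lt_succ_iff_lt_or_eq.mp hj with hj | rfl
      · exact h2 j hj
      · exact ⟨h5, h6⟩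
    · rintro ⟨h1, h2, h3⟩
      obtain ⟨h5, h6⟩ := h2 (k + 1) (by omega)
      refine ⟨⟨h1, fun j hj => h2 j (by omega), h5.1⟩, ?_, h5, h6, h3⟩
      have h7 := (h2 k (by omega)).2.1
      rw [zigHeight]
      push_cast at h7 ⊢
      linarith

theorem follows_pow_v (h : sin (α + β) ≠ 0) (m : ℕ) (y p : ℝ) {a : Side} (ha : a ≠ Side.one)
    (k : ℕ) : Follows α β a (startTwo y p) (wordPow (w13 (m + 1) ++ w23 (m + 1)) (k + 1)) ↔
      startSign a * (p - sin y) < 0 ∧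
        ZigFans (m + 1) β (sideTwo β α) α (sideTwo α β) y p (k + 1) ∧
        0 < zigHeight (turnAngle (m + 1) β) (turnAngle (m + 1) α) y p (k + 1) := by
  induction k with
  | zero =>
    rw [wordPow, wordPow, List.append_nil, follows_v h m y p ha]
    simp [ZigFans, zigHeight]
    tauto
  | succ k ih =>
    rw [wordPow_succ', follows_append, ih, lastLetter_pow_v_succ, run_pow_v,
      follows_v h m _ _ (by simp)]
    have e1 : y + ((k + 1 : ℕ) : ℝ) * (turnAngle (m + 1) α - turnAngle (m + 1) β) +
      (turnAngle (m + 1) α - turnAngle (m + 1) β) =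
      y + (((k + 1 : ℕ) : ℝ) + 1) * (turnAngle (m + 1) α - turnAngle (m + 1) β) := by ring
    rw [e1, ← zigHeight]
    simp only [startSign]
    constructor
    · rintro ⟨⟨h1, h2, h3⟩, h4, h5, h6, h7⟩
      refine ⟨h1, fun j hj => ?_, h7⟩
      rcases Nat.lt_succ_iff_lt_or_eq.mp hj with hj | rfl
      · exact h2 j hj
      · exact ⟨h5, h6⟩
    · rintro ⟨h1, h2, h3⟩
      obtain ⟨h5, h6⟩ := h2 (k + 1) (by omega)
      refine ⟨⟨h1, fun j hj => h2 j (by omega), h5.1⟩, ?_, h5, h6, h3⟩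
      have h7 := (h2 k (by omega)).2.1
      rw [zigHeight]
      push_cast at h7 ⊢
      linarith

end

section

/-- The path of long sides which runs through the centres of the fans of the word `W_{nk}`,
`n = m + 2`. It has four zigzags; in the `i`-th one, `yᵢ` is the angle of the long side before the
first upper vertex, `pᵢ` the height of the first upper vertex, `yᵢ'` and `pᵢ'` the same for the
upper vertex after the last lower one. In the first two zigzags the last upper vertex is in fact on
the right of the line: it is the next corner of the path. Angles are real numbers, not taken modulo
`2 π`. -/
structure Corridor (m k : ℕ) (α β : ℝ) where
  (y₁ y₁' y₂ y₂' y₃ y₃' y₄ y₄' p₁ p₁' p₂ p₂' p₃ p₃' p₄ p₄' : ℝ)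
  hy₁' : y₁' = y₁ + ((k + 2 : ℕ) : ℝ) * (turnAngle (m + 1) β - turnAngle (m + 1) α)
  hp₁' : p₁' = zigHeight (turnAngle (m + 1) α) (turnAngle (m + 1) β) y₁ p₁ (k + 2)
  hy₂ : y₂ = y₁' + turnAngle (m + 2) α
  hp₂ : p₂ = p₁' + sin y₂
  hy₂' : y₂' = y₂ + ((k + 1 : ℕ) : ℝ) * (turnAngle (m + 1) α - turnAngle (m + 1) β)
  hp₂' : p₂' = zigHeight (turnAngle (m + 1) β) (turnAngle (m + 1) α) y₂ p₂ (k + 1)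
  hy₃ : y₃ = y₂' + turnAngle (m + 2) β
  hp₃ : p₃ = p₂' + sin y₃
  hy₃' : y₃' = y₃ + (k : ℝ) * (turnAngle (m + 1) β - turnAngle (m + 1) α)
  hp₃' : p₃' = zigHeight (turnAngle (m + 1) α) (turnAngle (m + 1) β) y₃ p₃ k
  hy₄ : y₄ = y₃' - turnAngle (m + 2) α
  hp₄ : p₄ = p₃' + sin y₄
  hy₄' : y₄' = y₄ + ((k + 1 : ℕ) : ℝ) * (turnAngle (m + 1) α - turnAngle (m + 1) β)
  hp₄' : p₄' = zigHeight (turnAngle (m + 1) β) (turnAngle (m + 1) α) y₄ p₄ (k + 1)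

/-- The corridor is determined by its first angle and its first height. -/
theorem exists_corridor (m k : ℕ) (α β y p : ℝ) : ∃ c : Corridor m k α β, c.y₁ = y ∧ c.p₁ = p :=
  ⟨⟨y, _, _, _, _, _, _, _, p, _, _, _, _, _, _, _, rfl, rfl, rfl, rfl, rfl, rfl, rfl, rfl, rfl,
    rfl, rfl, rfl, rfl, rfl⟩, rfl, rfl⟩

/-- The condition that the line passes all the fans of the word, and that the path closes up. -/
structure Corridor.Open {m k : ℕ} {α β : ℝ} (c : Corridor m k α β) : Prop where
  fans₁ : ZigFans (m + 1) α (sideTwo α β) β (sideTwo β α) c.y₁ c.p₁ (k + 2)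
  corner₁ : Fan α (sideTwo α β) (-c.p₁') (-c.y₁') (m + 2)
  fans₂ : ZigFans (m + 1) β (sideTwo β α) α (sideTwo α β) c.y₂ c.p₂ (k + 1)
  corner₂ : Fan β (sideTwo β α) (-c.p₂') (-c.y₂') (m + 2)
  fans₃ : ZigFans (m + 1) α (sideTwo α β) β (sideTwo β α) c.y₃ c.p₃ k
  corner₃ : Fan α (sideTwo α β) c.p₃' c.y₃' (m + 2)
  fans₄ : ZigFans (m + 1) β (sideTwo β α) α (sideTwo α β) c.y₄ c.p₄ (k + 1)
  corner₄ : Fan β (sideTwo β α) c.p₄' c.y₄' (m + 2)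
  closed : c.p₄' + sin c.y₁ = c.p₁

/-- The path of long sides closes up in direction, whatever the triangle: the turns cancel. -/
theorem Corridor.y₁_eq {m k : ℕ} {α β : ℝ} (c : Corridor m k α β) :
    c.y₁ = c.y₄' - turnAngle (m + 2) β := by
  have h₁ := c.hy₁'; have h₂ := c.hy₂; have h₃ := c.hy₂'; have h₄ := c.hy₃; have h₅ := c.hy₃'
  have h₆ := c.hy₄; have h₇ := c.hy₄'
  rw [h₇, h₆, h₅, h₄, h₃, h₂, h₁]
  simp only [turnAngle]
  push_cast
  ring

theorem fan_sub_two_pi {α r g y : ℝ} {m : ℕ} : Fan α r g (y + 2 * π) m ↔ Fan α r g y m := by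
  have e : ∀ x, sin (y + 2 * π + x) = sin (y + x) := fun x => by
    rw [add_right_comm, sin_add_two_pi]
  simp only [Fan, e]

variable {α β : ℝ}

theorem follows_part_one (h : sin (α + β) ≠ 0) (m k : ℕ) (y p : ℝ) {a : Side} (ha : a ≠ Side.two) :
    Follows α β a (startOne y p)
        (wordPow (w23 (m + 1) ++ w13 (m + 1)) k ++ (w23 (m + 1) ++ dartTwo m)) ↔
      startSign a * (p - sin y) < 0 ∧
        ZigFans (m + 1) α (sideTwo α β) β (sideTwo β α) y p (k + 1) := by
  rw [follows_append]
  cases k with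
  | zero =>
    rw [wordPow, Follows, lastLetter, run, follows_u_dart h m y p ha]
    simp [ZigFans, zigHeight]
  | succ k =>
    rw [follows_pow_u h m y p ha, lastLetter_pow_u_succ, run_pow_u,
      follows_u_dart h m _ _ (by simp)]
    simp only [startSign]
    constructor
    · rintro ⟨⟨h1, h2, h3⟩, h4, h5, h6⟩
      refine ⟨h1, fun j hj => ?_⟩
      rcases Nat.lt_succ_iff_lt_or_eq.mp hj with hj | rfl
      · exact h2 j hj
      · exact ⟨h5, h6⟩
    · rintro ⟨h1, h2⟩
      obtain ⟨h5, h6⟩ := h2 (k + 1) (by omega)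
      refine ⟨⟨h1, fun j hj => h2 j (by omega), h5.1⟩, ?_, h5, h6⟩
      have h7 := (h2 k (by omega)).2.1
      rw [zigHeight]
      push_cast at h7 ⊢
      linarith

theorem follows_part_two (h : sin (α + β) ≠ 0) (m k : ℕ) (y p : ℝ) {a : Side} (ha : a ≠ Side.one) :
    Follows α β a (startTwo y p)
        (wordPow (w13 (m + 1) ++ w23 (m + 1)) k ++ (w13 (m + 1) ++ dartOne m)) ↔
      startSign a * (p - sin y) < 0 ∧
        ZigFans (m + 1) β (sideTwo β α) α (sideTwo α β) y p (k + 1) := by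
  rw [follows_append]
  cases k with
  | zero =>
    rw [wordPow, Follows, lastLetter, run, follows_v_dart h m y p ha]
    simp [ZigFans, zigHeight]
  | succ k =>
    rw [follows_pow_v h m y p ha, lastLetter_pow_v_succ, run_pow_v,
      follows_v_dart h m _ _ (by simp)]
    simp only [startSign]
    constructor
    · rintro ⟨⟨h1, h2, h3⟩, h4, h5, h6⟩
      refine ⟨h1, fun j hj => ?_⟩
      rcases Nat.lt_succ_iff_lt_or_eq.mp hj with hj | rfl
      · exact h2 j hj
      · exact ⟨h5, h6⟩
    · rintro ⟨h1, h2⟩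
      obtain ⟨h5, h6⟩ := h2 (k + 1) (by omega)
      refine ⟨⟨h1, fun j hj => h2 j (by omega), h5.1⟩, ?_, h5, h6⟩
      have h7 := (h2 k (by omega)).2.1
      rw [zigHeight]
      push_cast at h7 ⊢
      linarith

theorem follows_part_three (h : sin (α + β) ≠ 0) (m k : ℕ) (y p : ℝ) :
    Follows α β Side.three (startOne y p)
        (wordPow (w23 (m + 1) ++ w13 (m + 1)) k ++ dartOne (m + 1)) ↔
      p - sin y < 0 ∧ ZigFans (m + 1) α (sideTwo α β) β (sideTwo β α) y p k ∧
      Fan α (sideTwo α β) (zigHeight (turnAngle (m + 1) α) (turnAngle (m + 1) β) y p k)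
        (y + k * (turnAngle (m + 1) β - turnAngle (m + 1) α)) (m + 2) := by
  rw [follows_append, lastLetter_pow_u, run_pow_u, follows_dartOne _ (Or.inl rfl) (by simp)]
  simp only [startOne, startSign, one_mul, sub_add_cancel]
  cases k with
  | zero => simp [wordPow, Follows, zigHeight, ZigFans]
  | succ k =>
    have := follows_pow_u h m y p (a := Side.three) (by simp) k
    rw [startOne] at this
    rw [this]
    simp only [startSign, one_mul]
    constructor
    · rintro ⟨⟨h1, h2, h3⟩, h4, h5⟩
      exact ⟨h1, h2, h5⟩
    · rintro ⟨h1, h2, h5⟩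
      refine ⟨⟨h1, h2, h5.1⟩, ?_, h5⟩
      have h7 := (h2 k (by omega)).2.1
      rw [zigHeight]
      push_cast at h7 ⊢
      linarith

theorem follows_part_four (h : sin (α + β) ≠ 0) (m k : ℕ) (y p : ℝ) :
    Follows α β Side.two (startTwo y p)
        (wordPow (w13 (m + 1) ++ w23 (m + 1)) (k + 1) ++ dartTwo (m + 1)) ↔
      0 < p - sin y ∧ ZigFans (m + 1) β (sideTwo β α) α (sideTwo α β) y p (k + 1) ∧
      Fan β (sideTwo β α) (zigHeight (turnAngle (m + 1) β) (turnAngle (m + 1) α) y p (k + 1))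
        (y + ((k + 1 : ℕ) : ℝ) * (turnAngle (m + 1) α - turnAngle (m + 1) β)) (m + 2) := by
  rw [follows_append, lastLetter_pow_v_succ, run_pow_v, follows_dartTwo h _ (Or.inr rfl) (by simp),
    follows_pow_v h m y p (by simp)]
  simp only [startTwo, startSign, one_mul, neg_neg, sub_add_cancel, neg_one_mul, neg_lt_zero]
  constructor
  · rintro ⟨⟨h1, h2, h3⟩, h4, h5⟩
    exact ⟨h1, h2, h5⟩
  · rintro ⟨h1, h2, h5⟩
    refine ⟨⟨h1, h2, h5.1⟩, ?_, h5⟩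
    have h7 := (h2 k (by omega)).2.1
    rw [zigHeight]
    push_cast at h7 ⊢
    linarith

/-- The word `W_{nk}` as a sequence of fans, without its removed digits. -/
theorem tileWord_eq (m k : ℕ) : tileWord (m + 2) k =
    (wordPow (w23 (m + 1) ++ w13 (m + 1)) (k + 1) ++ (w23 (m + 1) ++ dartTwo m)) ++
    (w23 (m + 2) ++ (wordPow (w13 (m + 1) ++ w23 (m + 1)) k ++ (w13 (m + 1) ++ dartOne m))) ++
    (w13 (m + 2) ++ (wordPow (w23 (m + 1) ++ w13 (m + 1)) k ++ dartOne (m + 1))) ++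
    (wordPow (w13 (m + 1) ++ w23 (m + 1)) (k + 1) ++ dartTwo (m + 1)) := by
  have e1 : ∀ l : Word, (l ++ [Side.three]).dropLast = l := fun l => List.dropLast_concat
  have a1 : (wordPow (w23 (m + 1) ++ w13 (m + 1)) (k + 2)).dropLast =
      wordPow (w23 (m + 1) ++ w13 (m + 1)) (k + 1) ++ (w23 (m + 1) ++ dartTwo m) := by
    rw [wordPow_succ', ← e1 (_ ++ (w23 (m + 1) ++ dartTwo m)), w13_succ]
    simp only [List.append_assoc]
  have a2 : (w23 (m + 2) ++ wordPow (w13 (m + 1) ++ w23 (m + 1)) (k + 1)).dropLast =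
      w23 (m + 2) ++ (wordPow (w13 (m + 1) ++ w23 (m + 1)) k ++ (w13 (m + 1) ++ dartOne m)) := by
    rw [wordPow_succ', ← e1 (w23 (m + 2) ++ (_ ++ (w13 (m + 1) ++ dartOne m))), w23_succ m]
    simp only [List.append_assoc]
  have a3 : (w13 (m + 2) ++ wordPow (w23 (m + 1) ++ w13 (m + 1)) k ++ w23 (m + 2)).dropLast =
      w13 (m + 2) ++ (wordPow (w23 (m + 1) ++ w13 (m + 1)) k ++ dartOne (m + 1)) := by
    rw [← e1 (w13 (m + 2) ++ (_ ++ dartOne (m + 1))), w23_succ (m + 1)]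
    simp only [List.append_assoc]
  have a4 : (wordPow (w13 (m + 1) ++ w23 (m + 1)) (k + 1) ++ w13 (m + 2)).dropLast =
      wordPow (w13 (m + 1) ++ w23 (m + 1)) (k + 1) ++ dartTwo (m + 1) := by
    rw [← e1 (wordPow (w13 (m + 1) ++ w23 (m + 1)) (k + 1) ++ dartTwo (m + 1)), w13_succ (m + 1)]
    simp only [List.append_assoc]
  rw [tileWord, ← a1, ← a2, ← a3, ← a4]
  rfl

end

section

variable {α β : ℝ} {m k : ℕ}

theorem run_part_one (m k : ℕ) (y p : ℝ) : run α β (startOne y p)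
      (wordPow (w23 (m + 1) ++ w13 (m + 1)) k ++ (w23 (m + 1) ++ dartTwo m)) =
    ⟨-1, y + ((k + 1 : ℕ) : ℝ) * (turnAngle (m + 1) β - turnAngle (m + 1) α) - π,
      zigHeight (turnAngle (m + 1) α) (turnAngle (m + 1) β) y p (k + 1)⟩ := by
  have h := run_pow_u (α := α) (β := β) m y p (k + 1)
  rw [wordPow_succ', w13_succ m, ← List.append_assoc, ← List.append_assoc, run_append,
    run, run, ← w13_succ] at h
  rw [← List.append_assoc]
  set t := run α β (startOne y p)
    (wordPow (w23 (m + 1) ++ w13 (m + 1)) k ++ w23 (m + 1) ++ dartTwo m) with ht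
  have h1 := congrArg Placement.o h
  have h2 := congrArg Placement.φ h
  have h3 := congrArg Placement.h h
  simp only [cross, startOne] at h1 h2 h3
  ext
  · linarith
  · exact h2
  · exact h3

theorem run_part_two (m k : ℕ) (y p : ℝ) : run α β (startTwo y p)
      (wordPow (w13 (m + 1) ++ w23 (m + 1)) k ++ (w13 (m + 1) ++ dartOne m)) =
    ⟨1, y + ((k + 1 : ℕ) : ℝ) * (turnAngle (m + 1) α - turnAngle (m + 1) β),
      zigHeight (turnAngle (m + 1) β) (turnAngle (m + 1) α) y p (k + 1) -
      sin (y + ((k + 1 : ℕ) : ℝ) * (turnAngle (m + 1) α - turnAngle (m + 1) β))⟩ := by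
  have h := run_pow_v (α := α) (β := β) m y p (k + 1)
  rw [wordPow_succ', w23_succ m, ← List.append_assoc, ← List.append_assoc, run_append,
    run, run, ← w23_succ] at h
  rw [← List.append_assoc]
  set t := run α β (startTwo y p)
    (wordPow (w13 (m + 1) ++ w23 (m + 1)) k ++ w13 (m + 1) ++ dartOne m) with ht
  have h1 := congrArg Placement.o h
  have h2 := congrArg Placement.φ h
  have h3 := congrArg Placement.h h
  simp only [cross, startTwo] at h1 h2 h3
  ext
  · linarith
  · exact h2
  · exact h3

theorem follows_corner_one (m : ℕ) (y p : ℝ) :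
    Follows α β Side.one ⟨-1, y - π, p⟩ (w23 (m + 2)) ↔ p - sin y < 0 ∧
      Fan α (sideTwo α β) (-p) (-y) (m + 2) ∧ 0 < p + sin (y + turnAngle (m + 2) α) := by
  rw [follows_w23 (m + 1) (Or.inr rfl) (by simp)]
  simp only [startSign, turnAngle]
  push_cast
  rw [show -1 * (y - π) + π = -y + 2 * π by ring, fan_sub_two_pi, sin_add_two_pi, neg_one_mul p,
    show -y + 2 * π + 2 * ((m : ℝ) + 1 + 1) * α = -(y + (π - 2 * (m + 2) * α)) + π + 2 * π by ring,
    sin_add_two_pi, sin_neg_add_pi, sin_neg]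
  constructor
  · rintro ⟨h1, h2, h3⟩
    exact ⟨by linarith, h2, by linarith⟩
  · rintro ⟨h1, h2, h3⟩
    exact ⟨by linarith, h2, by linarith⟩

theorem run_corner_one (m : ℕ) (y p : ℝ) :
    run α β ⟨-1, y - π, p⟩ (w23 (m + 2)) =
      turn (-1) (startTwo (y + turnAngle (m + 2) α) (p + sin (y + turnAngle (m + 2) α))) := by
  rw [run_w23]
  simp only [turn, startTwo, turnAngle]
  congr 1
  · push_cast
    ring
  · ring

theorem follows_corner_two (h : sin (α + β) ≠ 0) (m : ℕ) (y p : ℝ) :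
    Follows α β Side.two ⟨1, y, p - sin y⟩ (w13 (m + 2)) ↔ p - sin y < 0 ∧
      Fan β (sideTwo β α) (-p) (-y) (m + 2) ∧ 0 < p + sin (y + turnAngle (m + 2) β) := by
  rw [follows_w13 h (m + 1) (Or.inl rfl) (by simp)]
  simp only [startSign, turnAngle, sub_add_cancel]
  push_cast
  rw [show -1 * y + 2 * ((m : ℝ) + 1 + 1) * β = -(y + (π - 2 * (m + 2) * β)) + π by ring,
    sin_neg_add_pi, neg_one_mul, neg_one_mul, neg_one_mul, sin_neg]
  constructor
  · rintro ⟨h1, h2, h3⟩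
    exact ⟨by linarith, h2, by linarith⟩
  · rintro ⟨h1, h2, h3⟩
    exact ⟨by linarith, h2, by linarith⟩

theorem run_corner_two (m : ℕ) (y p : ℝ) :
    run α β ⟨1, y, p - sin y⟩ (w13 (m + 2)) =
      startOne (y + turnAngle (m + 2) β) (p + sin (y + turnAngle (m + 2) β)) := by
  rw [run_w13]
  simp only [startOne, turnAngle]
  have e : y - 2 * (((m + 1 : ℕ) : ℝ) + 1) * 1 * β = y + (π - 2 * ((m + 2 : ℕ) : ℝ) * β) - π := by
    push_cast; ring
  rw [e, sin_sub_pi]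
  congr 1
  ring

theorem run_part_three (m k : ℕ) (y p : ℝ) : run α β (startOne y p)
      (wordPow (w23 (m + 1) ++ w13 (m + 1)) k ++ dartOne (m + 1)) =
    startTwo (y + (k : ℝ) * (turnAngle (m + 1) β - turnAngle (m + 1) α) - turnAngle (m + 2) α)
      (zigHeight (turnAngle (m + 1) α) (turnAngle (m + 1) β) y p k +
      sin (y + (k : ℝ) * (turnAngle (m + 1) β - turnAngle (m + 1) α) - turnAngle (m + 2) α)) := by
  rw [run_append, run_pow_u, run_dartOne]
  simp only [startOne, startTwo]
  rw [add_sub_cancel_right]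
  congr 1
  simp only [turnAngle]
  push_cast
  ring

theorem run_part_four (m k : ℕ) (y p : ℝ) : run α β (startTwo y p)
      (wordPow (w13 (m + 1) ++ w23 (m + 1)) (k + 1) ++ dartTwo (m + 1)) =
    turn 1 (startOne (y + ((k + 1 : ℕ) : ℝ) * (turnAngle (m + 1) α - turnAngle (m + 1) β) -
      turnAngle (m + 2) β)
      (zigHeight (turnAngle (m + 1) β) (turnAngle (m + 1) α) y p (k + 1) +
      sin (y + ((k + 1 : ℕ) : ℝ) * (turnAngle (m + 1) α - turnAngle (m + 1) β) -
        turnAngle (m + 2) β))) := by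
  rw [run_append, run_pow_v, run_dartTwo]
  simp only [startOne, startTwo, turn]
  have e : ∀ x : ℝ, x - 2 * (((m + 1 : ℕ) : ℝ) + 1) * -1 * β =
      x - (π - 2 * ((m + 2 : ℕ) : ℝ) * β) + π := by
    intro x; push_cast; ring
  rw [e, sin_add_pi]
  simp only [turnAngle]
  congr 1
  · norm_num
  · push_cast
    ring
  · ring

/-- Following the word `W_{nk}` means to pass all the fans of the corridor. -/
theorem follows_tileWord (h : sin (α + β) ≠ 0) (c : Corridor m k α β) :
    (Follows α β Side.one (startOne c.y₁ c.p₁) (tileWord (m + 2) k) ∧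
      (run α β (startOne c.y₁ c.p₁) (tileWord (m + 2) k)).h = c.p₁ ↔ c.Open) ∧
    run α β (startOne c.y₁ c.p₁) (tileWord (m + 2) k) = startOne c.y₁ (c.p₄' + sin c.y₁) := by
  have hr1 := run_part_one (α := α) (β := β) m (k + 1) c.y₁ c.p₁
  rw [← c.hy₁', ← c.hp₁'] at hr1
  have hr1' := run_corner_one (α := α) (β := β) m c.y₁' c.p₁'
  rw [← c.hy₂, ← c.hp₂] at hr1'
  have hr2 := run_part_two (α := α) (β := β) m k c.y₂ c.p₂
  rw [← c.hy₂', ← c.hp₂'] at hr2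
  have hr2' := run_corner_two (α := α) (β := β) m c.y₂' c.p₂'
  rw [← c.hy₃, ← c.hp₃] at hr2'
  have hr3 := run_part_three (α := α) (β := β) m k c.y₃ c.p₃
  rw [← c.hy₃', ← c.hp₃', ← c.hy₄, ← c.hp₄] at hr3
  have hr4 := run_part_four (α := α) (β := β) m k c.y₄ c.p₄
  rw [← c.hy₄', ← c.hp₄', ← c.y₁_eq] at hr4
  have f1 := follows_part_one h m (k + 1) c.y₁ c.p₁ (a := Side.one) (by simp)
  have f1' := follows_corner_one (α := α) (β := β) m c.y₁' c.p₁'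
  rw [← c.hy₂, ← c.hp₂] at f1'
  have f2 := follows_part_two h m k c.y₂ c.p₂ (a := Side.three) (by simp)
  have f2' := follows_corner_two h m c.y₂' c.p₂'
  rw [← c.hy₃, ← c.hp₃] at f2'
  have f3 := follows_part_three h m k c.y₃ c.p₃
  rw [← c.hy₃', ← c.hp₃'] at f3
  have f4 := follows_part_four h m k c.y₄ c.p₄
  rw [← c.hy₄', ← c.hp₄'] at f4
  have l1 : ∀ a l, lastLetter a (l ++ (w23 (m + 1) ++ dartTwo m)) = Side.one := by
    intro a l
    rw [lastLetter_append, lastLetter_append, lastLetter_dartTwo]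
  have l2 : ∀ a l, lastLetter a (l ++ (w13 (m + 1) ++ dartOne m)) = Side.two := by
    intro a l
    rw [lastLetter_append, lastLetter_append, lastLetter_dartOne]
  have l3 : ∀ a l, lastLetter a (l ++ dartOne (m + 1)) = Side.two := by
    intro a l
    rw [lastLetter_append, lastLetter_dartOne]
  replace l1 := fun a => l1 a (wordPow (w23 (m + 1) ++ w13 (m + 1)) (k + 1))
  replace l2 := fun a => l2 a (wordPow (w13 (m + 1) ++ w23 (m + 1)) k)
  replace l3 := fun a => l3 a (wordPow (w23 (m + 1) ++ w13 (m + 1)) k)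
  have l1' := fun a => lastLetter_w23 a (m + 1)
  have l2' := fun a => lastLetter_w13 a (m + 1)
  rw [tileWord_eq]
  generalize wordPow (w23 (m + 1) ++ w13 (m + 1)) (k + 1) ++ (w23 (m + 1) ++ dartTwo m) = u₁ at *
  generalize wordPow (w13 (m + 1) ++ w23 (m + 1)) k ++ (w13 (m + 1) ++ dartOne m) = u₂ at *
  generalize wordPow (w23 (m + 1) ++ w13 (m + 1)) k ++ dartOne (m + 1) = u₃ at *
  generalize wordPow (w13 (m + 1) ++ w23 (m + 1)) (k + 1) ++ dartTwo (m + 1) = u₄ at *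
  have hrun : run α β (startOne c.y₁ c.p₁) (u₁ ++ (w23 (m + 2) ++ u₂) ++ (w13 (m + 2) ++ u₃) ++ u₄) =
      startOne c.y₁ (c.p₄' + sin c.y₁) := by
    simp only [run_append, hr1, hr1', run_turn, hr2, hr2', hr3, hr4, turn_add]
    exact turn_zero _
  refine ⟨?_, hrun⟩
  rw [hrun]
  simp only [follows_append, run_append, lastLetter_append, hr1, hr1', run_turn, hr2, hr2', hr3,
    l1, l2, l3, l1', l2', follows_turn, f1, f1', f2, f2', f3, f4]
  have e2 : c.p₂ - sin c.y₂ = c.p₁' := by rw [c.hp₂]; ring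
  have e3 : c.p₃ - sin c.y₃ = c.p₂' := by rw [c.hp₃]; ring
  have e4 : c.p₄ - sin c.y₄ = c.p₃' := by rw [c.hp₄]; ring
  simp only [e2, e3, e4, startSign, startOne, one_mul, neg_one_mul]
  constructor
  · rintro ⟨⟨⟨⟨⟨h1, h2⟩, ⟨h3, h4, h5⟩, h6, h7⟩, ⟨h8, h9, h10⟩, h11, h12, h13⟩, h14, h15, h16⟩, h17⟩
    exact ⟨h2, h4, h7, h9, h12, h13, h15, h16, h17⟩
  · rintro ⟨h1, h2, h3, h4, h5, h6, h7, h8, h9⟩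
    refine ⟨⟨⟨⟨⟨?_, h1⟩, ⟨?_, h2, ?_⟩, ?_, h3⟩, ⟨?_, h4, ?_⟩, ?_, h5, h6⟩, h6.1, h7, h8⟩, h9⟩
    · linarith [h8.1]
    · have := (h1 (k + 1) (by omega)).2.1
      rw [c.hp₁', c.hy₁', zigHeight]
      push_cast at this ⊢
      rw [show (k : ℝ) + 1 + 1 = k + 2 by ring]
      linarith
    · exact (h3 0 (by omega)).1.1
    · linarith [h2.1]
    · have := (h3 k (by omega)).2.1
      rw [c.hp₂', c.hy₂', zigHeight]
      push_cast at this ⊢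
      linarith
    · cases k with
      | zero =>
        have := h6.1
        rwa [c.hp₃', zigHeight] at this
      | succ k => exact (h5 0 (by omega)).1.1
    · linarith [h4.1]

theorem length_wordPow (w : Word) (k : ℕ) : (wordPow w k).length = k * w.length := by
  induction k with
  | zero => simp [wordPow]
  | succ k ih => rw [wordPow, List.length_append, ih]; ring

theorem length_dartOne (m : ℕ) : (dartOne m).length = 2 * m + 1 := by
  induction m with
  | zero => rfl
  | succ m ih => simp only [dartOne, List.length_cons, ih]; ring

theorem length_dartTwo (m : ℕ) : (dartTwo m).length = 2 * m + 1 := by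
  induction m with
  | zero => rfl
  | succ m ih => simp only [dartTwo, List.length_cons, ih]; ring

theorem even_length_tileWord (m k : ℕ) : Even (tileWord (m + 2) k).length := by
  rw [tileWord_eq]
  simp only [List.length_append, length_wordPow, length_dartOne, length_dartTwo, w23, w13,
    List.length_cons, List.length_nil]
  rw [Nat.even_iff]
  ring_nf
  omega

theorem tileWord_ne_nil (m k : ℕ) : tileWord (m + 2) k ≠ [] := by
  rw [tileWord_eq, w23_succ]
  simp

theorem letter_last_tileWord (m k : ℕ) :
    letter (tileWord (m + 2) k) ((tileWord (m + 2) k).length - 1) = Side.one := by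
  have hd : ∀ m, ∃ l, dartTwo m = l ++ [Side.one] := by
    intro m
    induction m with
    | zero => exact ⟨[], rfl⟩
    | succ m ih =>
      obtain ⟨l, hl⟩ := ih
      exact ⟨Side.one :: Side.three :: l, by rw [dartTwo, hl]; rfl⟩
  obtain ⟨l, hl⟩ := hd (m + 1)
  obtain ⟨l', hl'⟩ : ∃ l', tileWord (m + 2) k = l' ++ [Side.one] := by
    rw [tileWord_eq, hl, ← List.append_assoc, ← List.append_assoc]
    exact ⟨_, rfl⟩
  rw [letter_of_lt _ (by rw [hl']; simp)]
  simp [hl']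

/-- The orbit tile of `W_{nk}` consists of the points whose corridor is open. -/
theorem mem_orbitTile_iff {X : Plane} (hX : X ∈ obtuseParameters) :
    X ∈ orbitTile (tileWord (m + 2) k) ↔ ∃ c : Corridor m k (X 0) (X 1), c.Open := by
  have hs : 0 < sin (X 0 + X 1) := by
    obtain ⟨h0, h1, h2⟩ := hX
    exact sin_pos_of_pos_of_lt_pi (by linarith) (by linarith [pi_pos])
  constructor
  · rintro ⟨-, p, hp⟩
    obtain ⟨t, ho, hh, hf⟩ := exists_follows_of_path hX (tileWord_ne_nil m k)
      (even_length_tileWord m k) hp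
    obtain ⟨c, hy, hp⟩ := exists_corridor m k (X 0) (X 1) (t.φ + π) t.h
    have ht : t = startOne c.y₁ c.p₁ := by
      rw [hy, hp, startOne, add_sub_cancel_right, ← ho]
    rw [letter_last_tileWord, ht] at hf
    rw [ht] at hh
    exact ⟨c, (follows_tileWord hs.ne' c).1.mp ⟨hf, hh⟩⟩
  · rintro ⟨c, hc⟩
    obtain ⟨h1, h2⟩ := follows_tileWord hs.ne' c
    refine ⟨hX, exists_path_of_follows hX (tileWord_ne_nil m k) (t := startOne c.y₁ c.p₁)
      (Or.inl rfl) ?_ ?_⟩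
    · rw [h2, hc.closed]
    · rw [letter_last_tileWord]
      exact (h1.mpr hc).1

end

/-! ### Linearization of the heights -/

/-- A double step of a zigzag, as a multiple of the sine of its mean direction. -/
theorem zigHeight_succ (θ θ' y p : ℝ) (j : ℕ) : zigHeight θ θ' y p (j + 1) =
    zigHeight θ θ' y p j + 2 * cos (θ' / 2) * sin (y + j * (θ' - θ) - θ + θ' / 2) := by
  have key : ∀ a b : ℝ, sin (a - b) + sin (a + b) = 2 * cos b * sin a := by
    intro a b
    rw [sin_sub, sin_add]
    ring
  have := key (y + j * (θ' - θ) - θ + θ' / 2) (θ' / 2)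
  rw [show y + j * (θ' - θ) - θ + θ' / 2 - θ' / 2 = y + j * (θ' - θ) - θ by ring,
    show y + j * (θ' - θ) - θ + θ' / 2 + θ' / 2 = y + (j + 1) * (θ' - θ) by ring] at this
  rw [zigHeight, this]

theorem zigHeight_add (θ θ' y p d : ℝ) (j : ℕ) :
    zigHeight θ θ' y (p + d) j = zigHeight θ θ' y p j + d := by
  induction j with
  | zero => rfl
  | succ j ih => rw [zigHeight, ih, zigHeight]; ring

/-- A zigzag near the Veech point `x`, where the two turning angles are `2 x - M ε` and
`2 x - M ε'`, in linear approximation. The number `D` bounds the mean directions of the double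
steps. -/
theorem abs_zigHeight_sub_le {x M ε ε' w p D : ℝ} (hM : 0 ≤ M) {j : ℕ}
    (hD : ∀ i : ℕ, i < j → |w + i * (M * (ε - ε')) + M * ε - M * ε' / 2| ≤ D) :
    |zigHeight (2 * x - M * ε) (2 * x - M * ε') (x + w) p j -
      (p + cos x * (2 * j * w + j * (M * ε) + j ^ 2 * (M * (ε - ε'))))| ≤
      j * (M * |ε'| * D + D ^ 3) := by
  induction j with
  | zero => simp [zigHeight]
  | succ j ih =>
    have ih' := ih (fun i hi => hD i (by omega))
    have hj := hD j (by omega)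
    rw [zigHeight_succ]
    set ψ := w + j * (M * (ε - ε')) + M * ε - M * ε' / 2 with hψ
    have e1 : x + w + j * (2 * x - M * ε' - (2 * x - M * ε)) - (2 * x - M * ε) +
        (2 * x - M * ε') / 2 = ψ := by rw [hψ]; ring
    rw [e1]
    have hD0 : 0 ≤ D := (abs_nonneg _).trans hj
    have b1 : |2 * cos ((2 * x - M * ε') / 2) - 2 * cos x| ≤ M * |ε'| := by
      have := abs_cos_sub_cos_le ((2 * x - M * ε') / 2) x
      rw [show (2 * x - M * ε') / 2 - x = -(M * ε' / 2) by ring, abs_neg, abs_div, abs_mul,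
        abs_of_nonneg hM, abs_two] at this
      rw [← mul_sub, abs_mul, abs_two]
      linarith
    have b2 : |sin ψ| ≤ D := by
      have := abs_sin_sub_sin_le ψ 0
      simp only [sin_zero, sub_zero] at this
      exact this.trans hj
    have b3 : |sin ψ - ψ| ≤ D ^ 3 / 6 := by
      rw [abs_sub_comm]
      refine (abs_sub_sin_le ψ).trans ?_
      gcongr
    have b4 : |2 * cos ((2 * x - M * ε') / 2) * sin ψ - 2 * cos x * ψ| ≤ M * |ε'| * D + D ^ 3 := by
      have e : 2 * cos ((2 * x - M * ε') / 2) * sin ψ - 2 * cos x * ψ =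
        (2 * cos ((2 * x - M * ε') / 2) - 2 * cos x) * sin ψ + 2 * cos x * (sin ψ - ψ) := by ring
      rw [e]
      refine (abs_add_le _ _).trans ?_
      rw [abs_mul, abs_mul, abs_mul, abs_two]
      have h1 : |2 * cos ((2 * x - M * ε') / 2) - 2 * cos x| * |sin ψ| ≤ M * |ε'| * D := by gcongr
      have h2 : 2 * |cos x| * |sin ψ - ψ| ≤ 2 * 1 * (D ^ 3 / 6) := by
        gcongr
        exact abs_cos_le_one x
      have : 0 ≤ D ^ 3 := by positivity
      linarith
    have e2 : zigHeight (2 * x - M * ε) (2 * x - M * ε') (x + w) p j +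
        2 * cos ((2 * x - M * ε') / 2) * sin ψ -
        (p + cos x * (2 * ((j + 1 : ℕ) : ℝ) * w + ((j + 1 : ℕ) : ℝ) * (M * ε) +
          ((j + 1 : ℕ) : ℝ) ^ 2 * (M * (ε - ε')))) =
        (zigHeight (2 * x - M * ε) (2 * x - M * ε') (x + w) p j -
          (p + cos x * (2 * j * w + j * (M * ε) + j ^ 2 * (M * (ε - ε'))))) +
        (2 * cos ((2 * x - M * ε') / 2) * sin ψ - 2 * cos x * ψ) := by
      rw [hψ]
      push_cast
      ring
    rw [e2]
    refine (abs_add_le _ _).trans ?_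
    push_cast
    linarith

/-- The tangent of the sine, with quadratic error. -/
theorem abs_sin_add_sub_le {x v : ℝ} (hv : |v| ≤ 1) : |sin (x + v) - (sin x + cos x * v)| ≤ v ^ 2 := by
  have h1 : |cos v - 1| ≤ v ^ 2 / 2 := by
    rw [abs_sub_comm, abs_of_nonneg (by linarith [cos_le_one v])]
    linarith [one_sub_sq_div_two_le_cos (x := v)]
  have h2 : |sin v - v| ≤ v ^ 2 / 6 := by
    rw [abs_sub_comm]
    refine (abs_sub_sin_le v).trans ?_
    have : |v| ^ 3 ≤ v ^ 2 := by
      rw [← sq_abs v]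
      exact pow_le_pow_of_le_one (abs_nonneg v) hv (by norm_num)
    linarith
  have e : sin (x + v) - (sin x + cos x * v) = sin x * (cos v - 1) + cos x * (sin v - v) := by
    rw [sin_add]; ring
  rw [e]
  refine (abs_add_le _ _).trans ?_
  rw [abs_mul, abs_mul]
  have h3 : |sin x| * |cos v - 1| ≤ 1 * (v ^ 2 / 2) := by
    gcongr
    exact abs_sin_le_one x
  have h4 : |cos x| * |sin v - v| ≤ 1 * (v ^ 2 / 6) := by
    gcongr
    exact abs_cos_le_one x
  nlinarith [sq_nonneg v]

/-- A step up, followed by a zigzag, in linear approximation. -/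
theorem abs_quarter_sub_le {x M ε ε' w p K B E : ℝ} (hM : 0 ≤ M) (hK : 0 < K) {j : ℕ}
    (hj : (j : ℝ) ≤ 3 * K) (hBK : B ≤ K) (hw : |w| ≤ B / K) (hε' : |ε'| ≤ E) (hE : 1 / K ^ 2 ≤ E)
    (hD : ∀ i : ℕ, i < j → |w + i * (M * (ε - ε')) + M * ε - M * ε' / 2| ≤ B / K) :
    |zigHeight (2 * x - M * ε) (2 * x - M * ε') (x + w) (p + sin (x + w)) j - p -
      (sin x + cos x * (w + 2 * j * w + j * (M * ε) + j ^ 2 * (M * (ε - ε'))))| ≤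
      (B ^ 2 + 3 * (M * B + B ^ 3)) * E := by
  have hB : 0 ≤ B := by
    have := (abs_nonneg _).trans hw
    by_contra h
    exact absurd this (not_le.mpr (div_neg_of_neg_of_pos (not_le.mp h) hK))
  have h1 := abs_zigHeight_sub_le (x := x) (p := p + sin (x + w)) hM hD
  have h2 := abs_sin_add_sub_le (x := x) (v := w) (hw.trans ((div_le_one hK).mpr hBK))
  have h3 : w ^ 2 ≤ B ^ 2 * E := by
    rw [← sq_abs w]
    calc |w| ^ 2 ≤ (B / K) ^ 2 := by gcongr
      _ = B ^ 2 * (1 / K ^ 2) := by field_simp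
      _ ≤ B ^ 2 * E := by gcongr
  have h4 : j * (M * |ε'| * (B / K) + (B / K) ^ 3) ≤ 3 * (M * B + B ^ 3) * E := by
    calc j * (M * |ε'| * (B / K) + (B / K) ^ 3) ≤ 3 * K * (M * E * (B / K) + (B / K) ^ 3) := by
          gcongr
      _ = 3 * (M * B * E + B ^ 3 * (1 / K ^ 2)) := by field_simp
      _ ≤ 3 * (M * B * E + B ^ 3 * E) := by gcongr
      _ = 3 * (M * B + B ^ 3) * E := by ring
  have e : zigHeight (2 * x - M * ε) (2 * x - M * ε') (x + w) (p + sin (x + w)) j - p -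
      (sin x + cos x * (w + 2 * j * w + j * (M * ε) + j ^ 2 * (M * (ε - ε')))) =
      (zigHeight (2 * x - M * ε) (2 * x - M * ε') (x + w) (p + sin (x + w)) j -
      (p + sin (x + w) + cos x * (2 * j * w + j * (M * ε) + j ^ 2 * (M * (ε - ε'))))) +
      (sin (x + w) - (sin x + cos x * w)) := by ring
  rw [e]
  refine (abs_add_le _ _).trans ?_
  linarith

section

/-! ### Linearization of a corridor -/

variable {α β : ℝ}

/-- The angle parameters of a corridor in a triangle near the Veech point: the triangle has
angles `x + ε₁`, `x + ε₂` with `x = π / 2n`, `n = m + 2`, and the corridor starts at angle `x + w`.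
The bound `E` stands for the size of `ε₁` and `ε₂`; it is of order `1 / k` at first, and of order
`1 / k ^ 2` in the end. The difference of the angles is of order `1 / k ^ 2` from the start, since
it accumulates over the length of a zigzag. -/
structure Corridor.Near {m k : ℕ} {α β : ℝ} (c : Corridor m k α β) (w ε₁ ε₂ B E : ℝ) : Prop where
  k_pos : 0 < k
  hα : α = π / (2 * ((m : ℝ) + 2)) + ε₁
  hβ : β = π / (2 * ((m : ℝ) + 2)) + ε₂
  hy₁ : c.y₁ = π / (2 * ((m : ℝ) + 2)) + w
  hw : |w| ≤ B / k
  hε₁ : |ε₁| ≤ E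
  hε₂ : |ε₂| ≤ E
  hEB : E ≤ B / k
  hdiff : |2 * ((m : ℝ) + 1) * (ε₁ - ε₂)| ≤ B / (k : ℝ) ^ 2
  hE : 1 / (k : ℝ) ^ 2 ≤ E

/-- The turning angle of a zigzag is `2 x` at the Veech point. -/
theorem turnAngle_near (m : ℕ) (ε : ℝ) : turnAngle (m + 1) (π / (2 * ((m : ℝ) + 2)) + ε) =
    2 * (π / (2 * ((m : ℝ) + 2))) - 2 * ((m : ℝ) + 1) * ε := by
  rw [turnAngle]
  push_cast
  field_simp
  ring

/-- The turning angle at a corner vanishes at the Veech point. -/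
theorem turnAngle_corner_near (m : ℕ) (ε : ℝ) :
    turnAngle (m + 2) (π / (2 * ((m : ℝ) + 2)) + ε) = -(2 * ((m : ℝ) + 2) * ε) := by
  rw [turnAngle]
  push_cast
  field_simp
  ring

namespace Corridor.Near

variable {m k : ℕ} {c : Corridor m k α β} {w ε₁ ε₂ B E : ℝ}

theorem angles (h : c.Near w ε₁ ε₂ B E) :
    c.y₁' = π / (2 * ((m : ℝ) + 2)) + (w + (k + 2) * (2 * ((m : ℝ) + 1) * (ε₁ - ε₂))) ∧
    c.y₂ = π / (2 * ((m : ℝ) + 2)) + (w + (k + 2) * (2 * ((m : ℝ) + 1) * (ε₁ - ε₂)) -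
      2 * ((m : ℝ) + 2) * ε₁) ∧
    c.y₂' = π / (2 * ((m : ℝ) + 2)) + (w + 2 * ((m : ℝ) + 1) * (ε₁ - ε₂) -
      2 * ((m : ℝ) + 2) * ε₁) ∧
    c.y₃ = π / (2 * ((m : ℝ) + 2)) + (w + 2 * ((m : ℝ) + 1) * (ε₁ - ε₂) -
      2 * ((m : ℝ) + 2) * (ε₁ + ε₂)) ∧
    c.y₃' = π / (2 * ((m : ℝ) + 2)) + (w + (k + 1) * (2 * ((m : ℝ) + 1) * (ε₁ - ε₂)) -
      2 * ((m : ℝ) + 2) * (ε₁ + ε₂)) ∧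
    c.y₄ = π / (2 * ((m : ℝ) + 2)) + (w + (k + 1) * (2 * ((m : ℝ) + 1) * (ε₁ - ε₂)) -
      2 * ((m : ℝ) + 2) * ε₂) ∧
    c.y₄' = π / (2 * ((m : ℝ) + 2)) + (w - 2 * ((m : ℝ) + 2) * ε₂) := by
  have h₁ := c.hy₁'; have h₂ := c.hy₂; have h₃ := c.hy₂'; have h₄ := c.hy₃; have h₅ := c.hy₃'
  have h₆ := c.hy₄; have h₇ := c.hy₄'; have h₀ := h.hy₁
  have hα := h.hα; have hβ := h.hβ
  clear h
  subst hα hβ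
  simp only [turnAngle_near, turnAngle_corner_near] at h₁ h₂ h₃ h₄ h₅ h₆ h₇
  push_cast at h₁ h₂ h₃ h₄ h₅ h₆ h₇
  have g₁ : c.y₁' = π / (2 * ((m : ℝ) + 2)) + (w + (k + 2) * (2 * ((m : ℝ) + 1) * (ε₁ - ε₂))) := by
    rw [h₁, h₀]; ring
  have g₂ : c.y₂ = π / (2 * ((m : ℝ) + 2)) + (w + (k + 2) * (2 * ((m : ℝ) + 1) * (ε₁ - ε₂)) -
      2 * ((m : ℝ) + 2) * ε₁) := by rw [h₂, g₁]; ring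
  have g₃ : c.y₂' = π / (2 * ((m : ℝ) + 2)) + (w + 2 * ((m : ℝ) + 1) * (ε₁ - ε₂) -
      2 * ((m : ℝ) + 2) * ε₁) := by rw [h₃, g₂]; ring
  have g₄ : c.y₃ = π / (2 * ((m : ℝ) + 2)) + (w + 2 * ((m : ℝ) + 1) * (ε₁ - ε₂) -
      2 * ((m : ℝ) + 2) * (ε₁ + ε₂)) := by rw [h₄, g₃]; ring
  have g₅ : c.y₃' = π / (2 * ((m : ℝ) + 2)) + (w + (k + 1) * (2 * ((m : ℝ) + 1) * (ε₁ - ε₂)) -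
      2 * ((m : ℝ) + 2) * (ε₁ + ε₂)) := by rw [h₅, g₄]; ring
  have g₆ : c.y₄ = π / (2 * ((m : ℝ) + 2)) + (w + (k + 1) * (2 * ((m : ℝ) + 1) * (ε₁ - ε₂)) -
      2 * ((m : ℝ) + 2) * ε₂) := by rw [h₆, g₅]; ring
  exact ⟨g₁, g₂, g₃, g₄, g₅, g₆, by rw [h₇, g₆]; ring⟩

theorem B_nonneg (h : c.Near w ε₁ ε₂ B E) : 0 ≤ B := by
  have h1 := (abs_nonneg _).trans h.hw
  have h2 : (0 : ℝ) < k := by exact_mod_cast h.k_pos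
  by_contra h3
  exact absurd h1 (not_le.mpr (div_neg_of_neg_of_pos (not_le.mp h3) h2))

theorem E_nonneg (h : c.Near w ε₁ ε₂ B E) : 0 ≤ E := (abs_nonneg _).trans h.hε₁

/-- Up to an error of the order of `B / k`, all angles in the corridor are those at the
Veech point. -/
theorem abs_angle_le (h : c.Near w ε₁ ε₂ B E) {i a b d e : ℝ} (hi' : i ≤ k + 2)
    (ha : |a| ≤ 2 * (m + 2)) (hb : |b| ≤ 2 * (m + 2)) (hd : |d| ≤ 2 * (m + 2))
    (he : |e| ≤ 2 * (m + 2)) (j : ℝ) (hj : |j| ≤ i):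
    |w + j * (2 * ((m : ℝ) + 1) * (ε₁ - ε₂)) + a * ε₁ + b * ε₂ + d * ε₁ + e * ε₂| ≤
      (8 * (m + 2) + 4) * B / k := by
  have hk : (1 : ℝ) ≤ k := by exact_mod_cast h.k_pos
  have hB := h.B_nonneg
  have h1 : |j * (2 * ((m : ℝ) + 1) * (ε₁ - ε₂))| ≤ 3 * (B / k) := by
    rw [abs_mul]
    calc |j| * |2 * ((m : ℝ) + 1) * (ε₁ - ε₂)| ≤ (3 * k) * (B / (k : ℝ) ^ 2) := by
          gcongr
          · linarith
          · exact h.hdiff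
      _ = 3 * (B / k) := by field_simp
  have h2 : ∀ a : ℝ, |a| ≤ 2 * (m + 2) → |a * ε₁| ≤ 2 * (m + 2) * (B / k) := fun a ha => by
    rw [abs_mul]
    gcongr
    exact h.hε₁.trans h.hEB
  have h3 : ∀ a : ℝ, |a| ≤ 2 * (m + 2) → |a * ε₂| ≤ 2 * (m + 2) * (B / k) := fun a ha => by
    rw [abs_mul]
    gcongr
    exact h.hε₂.trans h.hEB
  have e : (8 * ((m : ℝ) + 2) + 4) * B / k = B / k + 3 * (B / k) + 2 * (m + 2) * (B / k) +
    2 * (m + 2) * (B / k) + 2 * (m + 2) * (B / k) + 2 * (m + 2) * (B / k) := by ring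
  rw [e]
  refine (abs_add_le _ _).trans (add_le_add ((abs_add_le _ _).trans (add_le_add
    ((abs_add_le _ _).trans (add_le_add ((abs_add_le _ _).trans (add_le_add
    ((abs_add_le _ _).trans (add_le_add h.hw h1)) ?_)) ?_)) ?_)) ?_)
  · exact h2 a ha
  · exact h3 b hb
  · exact h2 d hd
  · exact h3 _ he

/-- The constant in the errors of the linearization. -/
noncomputable def quarterConst (m : ℕ) (B : ℝ) : ℝ :=
  ((8 * (m + 2) + 4) * B) ^ 2 +
    3 * (2 * ((m : ℝ) + 1) * ((8 * (m + 2) + 4) * B) + ((8 * (m + 2) + 4) * B) ^ 3)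

/-- The heights gained in the four zigzags, in linear approximation. -/
theorem abs_heights_sub_le (h : c.Near w ε₁ ε₂ B E) (hk : (8 * (m + 2) + 4) * B ≤ k) :
    |c.p₁' - (c.p₁ - sin c.y₁) - (sin (π / (2 * ((m : ℝ) + 2))) + cos (π / (2 * ((m : ℝ) + 2))) *
      ((2 * k + 5) * w + (k + 2) * (2 * ((m : ℝ) + 1) * ε₁) +
        (k + 2) ^ 2 * (2 * ((m : ℝ) + 1) * (ε₁ - ε₂))))| ≤ quarterConst m B * E ∧
    |c.p₂' - c.p₁' - (sin (π / (2 * ((m : ℝ) + 2))) + cos (π / (2 * ((m : ℝ) + 2))) *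
      ((2 * k + 3) * (w + (k + 2) * (2 * ((m : ℝ) + 1) * (ε₁ - ε₂)) - 2 * ((m : ℝ) + 2) * ε₁) +
        (k + 1) * (2 * ((m : ℝ) + 1) * ε₂) -
        (k + 1) ^ 2 * (2 * ((m : ℝ) + 1) * (ε₁ - ε₂))))| ≤ quarterConst m B * E ∧
    |c.p₃' - c.p₂' - (sin (π / (2 * ((m : ℝ) + 2))) + cos (π / (2 * ((m : ℝ) + 2))) *
      ((2 * k + 1) * (w + 2 * ((m : ℝ) + 1) * (ε₁ - ε₂) - 2 * ((m : ℝ) + 2) * (ε₁ + ε₂)) +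
        k * (2 * ((m : ℝ) + 1) * ε₁) +
        k ^ 2 * (2 * ((m : ℝ) + 1) * (ε₁ - ε₂))))| ≤ quarterConst m B * E ∧
    |c.p₄' - c.p₃' - (sin (π / (2 * ((m : ℝ) + 2))) + cos (π / (2 * ((m : ℝ) + 2))) *
      ((2 * k + 3) * (w + (k + 1) * (2 * ((m : ℝ) + 1) * (ε₁ - ε₂)) - 2 * ((m : ℝ) + 2) * ε₂) +
        (k + 1) * (2 * ((m : ℝ) + 1) * ε₂) -
        (k + 1) ^ 2 * (2 * ((m : ℝ) + 1) * (ε₁ - ε₂))))| ≤ quarterConst m B * E := by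
  have hK : (1 : ℝ) ≤ k := by exact_mod_cast h.k_pos
  have hm : (0 : ℝ) ≤ m := Nat.cast_nonneg m
  obtain ⟨g₁, g₂, g₃, g₄, g₅, g₆, -⟩ := h.angles
  have hM : (0 : ℝ) ≤ 2 * ((m : ℝ) + 1) := by positivity
  have b1 : ∀ r : ℝ, |r| ≤ 1 → |r * (2 * ((m : ℝ) + 1))| ≤ 2 * ((m : ℝ) + 2) := fun r hr => by
    rw [abs_mul, abs_of_nonneg hM]
    nlinarith
  have b2 : ∀ r : ℝ, |r| ≤ 1 → |r * (2 * ((m : ℝ) + 2))| ≤ 2 * ((m : ℝ) + 2) := fun r hr => by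
    rw [abs_mul, abs_of_nonneg (a := 2 * ((m : ℝ) + 2)) (by positivity)]
    nlinarith
  have b3 : |(0 : ℝ)| ≤ 2 * ((m : ℝ) + 2) := by rw [abs_zero]; positivity
  have c1 : |(1 : ℝ)| ≤ 1 := by norm_num
  have c2 : |(-1 : ℝ)| ≤ 1 := by norm_num
  have c3 : |(-(1 / 2) : ℝ)| ≤ 1 := by rw [abs_neg, abs_of_pos] <;> norm_num
  have c4 : |(0 : ℝ)| ≤ 1 := by norm_num
  -- the bounds for the angles in each of the zigzags
  refine ⟨?_, ?_, ?_, ?_⟩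
  · have := abs_quarter_sub_le (x := π / (2 * ((m : ℝ) + 2))) (M := 2 * ((m : ℝ) + 1)) (ε := ε₁)
      (ε' := ε₂) (w := w) (p := c.p₁ - sin c.y₁) (K := k) (B := (8 * (m + 2) + 4) * B) (E := E)
      (j := k + 2) hM (by linarith) (by push_cast; linarith) hk
      (by
        have := h.abs_angle_le (i := 0) (by linarith) b3 b3 b3 b3 0 (by simp)
        simpa using this) h.hε₂ h.hE
      (fun i hi => by
        have hi' : (i : ℝ) ≤ k + 2 := by exact_mod_cast hi.le
        have := h.abs_angle_le (i := i) hi' (b1 1 c1) (b1 _ c3) b3 b3 i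
          (by simp)
        convert this using 2
        ring)
    rw [← h.hy₁, sub_add_cancel, ← turnAngle_near, ← turnAngle_near, ← h.hα, ← h.hβ, ← c.hp₁'] at this
    refine le_of_eq_of_le ?_ this
    push_cast
    congr 1
    ring
  · have := abs_quarter_sub_le (x := π / (2 * ((m : ℝ) + 2))) (M := 2 * ((m : ℝ) + 1)) (ε := ε₂)
      (ε' := ε₁) (w := w + (k + 2) * (2 * ((m : ℝ) + 1) * (ε₁ - ε₂)) - 2 * ((m : ℝ) + 2) * ε₁)
      (p := c.p₁') (K := k) (B := (8 * (m + 2) + 4) * B) (E := E)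
      (j := k + 1) hM (by linarith) (by push_cast; linarith) hk
      (by
        have := h.abs_angle_le (i := k + 2) le_rfl (b2 _ c2) b3 b3 b3 (k + 2)
          (by rw [abs_of_nonneg]; positivity)
        convert this using 2
        ring) h.hε₁ h.hE
      (fun i hi => by
        have hi' : (i : ℝ) ≤ k + 1 := by exact_mod_cast hi.le
        have := h.abs_angle_le (i := k + 2) le_rfl (b2 _ c2) (b1 1 c1) (b1 _ c3) b3
          (k + 2 - i) (by rw [abs_of_nonneg (by linarith)]; linarith [(Nat.cast_nonneg i : (0:ℝ) ≤ i)])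
        convert this using 2
        ring)
    rw [← g₂, ← c.hp₂, ← turnAngle_near, ← turnAngle_near, ← h.hα, ← h.hβ, ← c.hp₂'] at this
    refine le_of_eq_of_le ?_ this
    push_cast
    congr 1
    ring
  · have := abs_quarter_sub_le (x := π / (2 * ((m : ℝ) + 2))) (M := 2 * ((m : ℝ) + 1)) (ε := ε₁)
      (ε' := ε₂) (w := w + 2 * ((m : ℝ) + 1) * (ε₁ - ε₂) - 2 * ((m : ℝ) + 2) * (ε₁ + ε₂))
      (p := c.p₂') (K := k) (B := (8 * (m + 2) + 4) * B) (E := E)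
      (j := k) hM (by linarith) (by linarith) hk
      (by
        have := h.abs_angle_le (i := 1) (by linarith) (b2 _ c2) (b2 _ c2) b3 b3 1
          (by simp)
        convert this using 2
        ring) h.hε₂ h.hE
      (fun i hi => by
        have hi' : (i : ℝ) ≤ k := by exact_mod_cast hi.le
        have := h.abs_angle_le (i := k + 2) le_rfl (b2 _ c2) (b2 _ c2) (b1 1 c1)
          (b1 _ c3) (1 + i) (by rw [abs_of_nonneg (by positivity)]; linarith)
        convert this using 2
        ring)
    rw [← g₄, ← c.hp₃, ← turnAngle_near, ← turnAngle_near, ← h.hα, ← h.hβ, ← c.hp₃'] at this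
    refine le_of_eq_of_le ?_ this
    congr 1
    ring
  · have := abs_quarter_sub_le (x := π / (2 * ((m : ℝ) + 2))) (M := 2 * ((m : ℝ) + 1)) (ε := ε₂)
      (ε' := ε₁) (w := w + (k + 1) * (2 * ((m : ℝ) + 1) * (ε₁ - ε₂)) - 2 * ((m : ℝ) + 2) * ε₂)
      (p := c.p₃') (K := k) (B := (8 * (m + 2) + 4) * B) (E := E)
      (j := k + 1) hM (by linarith) (by push_cast; linarith) hk
      (by
        have := h.abs_angle_le (i := k + 2) le_rfl b3 (b2 _ c2) b3 b3 (k + 1)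
          (by rw [abs_of_nonneg] <;> linarith)
        convert this using 2
        ring) h.hε₁ h.hE
      (fun i hi => by
        have hi' : (i : ℝ) ≤ k + 1 := by exact_mod_cast hi.le
        have := h.abs_angle_le (i := k + 2) le_rfl b3 (b2 _ c2) (b1 _ c3) (b1 1 c1)
          (k + 1 - i) (by rw [abs_of_nonneg (by linarith)]; linarith [(Nat.cast_nonneg i : (0:ℝ) ≤ i)])
        convert this using 2
        ring)
    rw [← g₆, ← c.hp₄, ← turnAngle_near, ← turnAngle_near, ← h.hα, ← h.hβ, ← c.hp₄'] at this
    refine le_of_eq_of_le ?_ this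
    push_cast
    congr 1
    ring

end Corridor.Near

end

section

/-! ### The gaps of a corridor -/

variable {α β : ℝ}

/-- The positions relative to the line of the vertices that bound it most closely, in linear
approximation, with error `e`: the angle `start` at which the corridor starts, the differences in
height `upper` of the fourth and the second corner and `lower` of the third and the first corner,
the symmetry `balance` of the corners about a middle line, and the distances `left`, `right` from
these corners to the vertices which face them: the neighbours of the second and fourth corner in
their fans, and of the first and third corner. -/
structure Corridor.Gaps {m k : ℕ} {α β : ℝ} (c : Corridor m k α β) (w ε₁ ε₂ e : ℝ) : Prop where
  start : |2 * w + k * (2 * ((m : ℝ) + 1) * (ε₁ - ε₂)) + tan (π / (2 * ((m : ℝ) + 2))) / k| ≤ e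
  upper : |c.p₄' - c.p₂' - cos (π / (2 * ((m : ℝ) + 2))) * (tan (π / (2 * ((m : ℝ) + 2))) / k -
    2 * ((m : ℝ) + 2) * k * (ε₁ + ε₂) + 2 * k * (ε₁ - ε₂))| ≤ e
  lower : |c.p₃' - c.p₁' - cos (π / (2 * ((m : ℝ) + 2))) * (tan (π / (2 * ((m : ℝ) + 2))) / k -
    2 * ((m : ℝ) + 2) * k * (ε₁ + ε₂) - 2 * k * (ε₁ - ε₂))| ≤ e
  balance : |c.p₂' - c.p₁' + c.p₄' - c.p₃'| ≤ e
  left : |sideTwo β α * (sin (β - c.y₂') + sin (β - c.y₁)) -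
    1 / (2 * cos (π / (2 * ((m : ℝ) + 2)))) * (tan (π / (2 * ((m : ℝ) + 2))) / k +
      k * (2 * ((m : ℝ) + 1) * (ε₁ - ε₂)))| ≤ e
  right : |sideTwo α β * (sin (α - c.y₁') + sin (α - c.y₄)) -
    1 / (2 * cos (π / (2 * ((m : ℝ) + 2)))) * (tan (π / (2 * ((m : ℝ) + 2))) / k -
      k * (2 * ((m : ℝ) + 1) * (ε₁ - ε₂)))| ≤ e

theorem veech_angle_pos (m : ℕ) : 0 < π / (2 * ((m : ℝ) + 2)) := by positivity

theorem veech_angle_le (m : ℕ) : π / (2 * ((m : ℝ) + 2)) ≤ π / 4 := by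
  have hm : (0 : ℝ) ≤ m := Nat.cast_nonneg m
  gcongr
  linarith

theorem veech_cos_pos (m : ℕ) : 0 < cos (π / (2 * ((m : ℝ) + 2))) :=
  cos_pos_of_mem_Ioo ⟨by linarith [veech_angle_pos m, pi_pos],
    by linarith [veech_angle_le m, pi_pos]⟩

theorem veech_sin_pos (m : ℕ) : 0 < sin (π / (2 * ((m : ℝ) + 2))) :=
  sin_pos_of_pos_of_lt_pi (veech_angle_pos m) (by linarith [veech_angle_le m, pi_pos])

/-- The lengths of the short sides near the Veech point, where they are `1 / (2 cos x)`. -/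
theorem abs_sideTwo_sub_le {x ε₁ ε₂ E : ℝ} (hc : 0 < cos x) (hs : 0 < sin x) (h₁ : |ε₁| ≤ E)
    (h₂ : |ε₂| ≤ E) (hE : 2 * E ≤ sin x * cos x) :
    |sideTwo (x + ε₁) (x + ε₂) - 1 / (2 * cos x)| ≤ 2 / (sin x * cos x ^ 2) * E := by
  have a1 : |sin (x + ε₂) - sin x| ≤ E := by
    refine (abs_sin_sub_sin_le _ _).trans ?_
    simpa using h₂
  have a2 : |sin (x + ε₁ + (x + ε₂)) - sin (2 * x)| ≤ 2 * E := by
    refine (abs_sin_sub_sin_le _ _).trans ?_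
    rw [show x + ε₁ + (x + ε₂) - 2 * x = ε₁ + ε₂ by ring]
    exact (abs_add_le _ _).trans (by linarith)
  have a3 : sin x * cos x ≤ sin (x + ε₁ + (x + ε₂)) := by
    have := (abs_le.mp a2).1
    rw [sin_two_mul] at this
    linarith
  have hsc : 0 < sin x * cos x := by positivity
  have a4 : 0 < sin (x + ε₁ + (x + ε₂)) := hsc.trans_le a3
  have e : sideTwo (x + ε₁) (x + ε₂) - 1 / (2 * cos x) =
      (2 * cos x * (sin (x + ε₂) - sin x) - (sin (x + ε₁ + (x + ε₂)) - sin (2 * x))) /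
        (2 * cos x * sin (x + ε₁ + (x + ε₂))) := by
    rw [sideTwo, sin_two_mul]
    field_simp
    ring
  rw [e, abs_div, abs_of_pos (by positivity : 0 < 2 * cos x * sin (x + ε₁ + (x + ε₂)))]
  have hE0 : 0 ≤ E := (abs_nonneg _).trans h₁
  have a5 : |2 * cos x * (sin (x + ε₂) - sin x) - (sin (x + ε₁ + (x + ε₂)) - sin (2 * x))| ≤
      4 * E := by
    refine (abs_sub _ _).trans ?_
    rw [abs_mul, abs_of_pos (by positivity : 0 < 2 * cos x)]
    have : 2 * cos x * |sin (x + ε₂) - sin x| ≤ 2 * 1 * E := by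
      gcongr
      exact cos_le_one x
    linarith
  calc _ ≤ 4 * E / (2 * cos x * (sin x * cos x)) := by gcongr
    _ = 2 / (sin x * cos x ^ 2) * E := by field_simp; ring

/-- The contribution of two short sides, in linear approximation. -/
theorem abs_short_sides_sub_le {r u v τ a C₁ C₂ B K E : ℝ} (hr : |r - a| ≤ C₁ * E) (hK : 0 < K)
    (hBK : B ≤ K) (hu : |u| ≤ B / K) (hv : |v| ≤ B / K) (hτ : |u + v - τ| ≤ C₂ * E)
    (hE : 1 / K ^ 2 ≤ E) (hE0 : 0 ≤ C₁ * E) :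
    |r * (sin u + sin v) - a * τ| ≤ (2 * C₁ + |a| * (B ^ 2 + C₂)) * E := by
  have hone : B / K ≤ 1 := (div_le_one hK).mpr hBK
  have hB : 0 ≤ B / K := (abs_nonneg _).trans hu
  have h1 : ∀ u, |u| ≤ B / K → |sin u - u| ≤ B ^ 2 * E / 2 := fun u hu => by
    rw [abs_sub_comm]
    refine (abs_sub_sin_le u).trans ?_
    have : |u| ^ 3 ≤ (B / K) ^ 2 := by
      calc |u| ^ 3 ≤ (B / K) ^ 3 := by gcongr
        _ ≤ (B / K) ^ 2 := pow_le_pow_of_le_one hB hone (by norm_num)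
    have h2 : (B / K) ^ 2 ≤ B ^ 2 * E := by
      calc (B / K) ^ 2 = B ^ 2 * (1 / K ^ 2) := by field_simp
        _ ≤ B ^ 2 * E := by gcongr
    have : 0 ≤ (B / K) ^ 2 := by positivity
    linarith
  have h2 : |sin u + sin v| ≤ 2 := (abs_add_le _ _).trans
    (by linarith [abs_sin_le_one u, abs_sin_le_one v])
  have e : r * (sin u + sin v) - a * τ =
    (r - a) * (sin u + sin v) + a * ((sin u - u) + (sin v - v) + (u + v - τ)) := by ring
  rw [e]
  refine (abs_add_le _ _).trans ?_
  rw [abs_mul, abs_mul]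
  have h3 : |r - a| * |sin u + sin v| ≤ C₁ * E * 2 := by gcongr
  have h4 : |a| * |(sin u - u) + (sin v - v) + (u + v - τ)| ≤
      |a| * (B ^ 2 * E / 2 + B ^ 2 * E / 2 + C₂ * E) := by
    gcongr
    exact (abs_add_le _ _).trans (add_le_add ((abs_add_le _ _).trans
      (add_le_add (h1 u hu) (h1 v hv))) hτ)
  linarith

theorem abs_combine_le {a b ε₁ ε₂ E A : ℝ} (h₁ : |ε₁| ≤ E) (h₂ : |ε₂| ≤ E) (ha : |a| ≤ A)
    (hb : |b| ≤ A) : |a * ε₁ + b * ε₂| ≤ 2 * A * E := by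
  have hA : 0 ≤ A := (abs_nonneg _).trans ha
  refine (abs_add_le _ _).trans ?_
  rw [abs_mul, abs_mul]
  have : |a| * |ε₁| ≤ A * E := by gcongr
  have : |b| * |ε₂| ≤ A * E := by gcongr
  linarith

/-- The sum of the four gains in height. -/
theorem abs_defect_sub_le {m K w ε₁ ε₂ s c τ B E Q p₀ p₁' p₂' p₃' p₄' r₁ r₂ r₃ r₄ : ℝ} (hm : 0 ≤ m)
    (hK : 1 ≤ K) (hc : 0 < c) (hc1 : c ≤ 1) (hs : s = c * (τ * K)) (hB : 0 ≤ B) (hw : |w| ≤ B / K)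
    (hE : 1 / K ≤ K * E) (hQ : 0 ≤ Q) (hE0 : 0 ≤ E) (h₁ : |ε₁| ≤ E) (h₂ : |ε₂| ≤ E)
    (e₁ : p₁' - p₀ = s + c * ((2 * K + 5) * w + (K + 2) * (2 * (m + 1) * ε₁) +
      (K + 2) ^ 2 * (2 * (m + 1) * (ε₁ - ε₂))) + r₁)
    (e₂ : p₂' - p₁' = s + c * ((2 * K + 3) * (w + (K + 2) * (2 * (m + 1) * (ε₁ - ε₂)) -
      2 * (m + 2) * ε₁) + (K + 1) * (2 * (m + 1) * ε₂) -
      (K + 1) ^ 2 * (2 * (m + 1) * (ε₁ - ε₂))) + r₂)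
    (e₃ : p₃' - p₂' = s + c * ((2 * K + 1) * (w + 2 * (m + 1) * (ε₁ - ε₂) -
      2 * (m + 2) * (ε₁ + ε₂)) + K * (2 * (m + 1) * ε₁) +
      K ^ 2 * (2 * (m + 1) * (ε₁ - ε₂))) + r₃)
    (e₄ : p₄' - p₃' = s + c * ((2 * K + 3) * (w + (K + 1) * (2 * (m + 1) * (ε₁ - ε₂)) -
      2 * (m + 2) * ε₂) + (K + 1) * (2 * (m + 1) * ε₂) -
      (K + 1) ^ 2 * (2 * (m + 1) * (ε₁ - ε₂))) + r₄)
    (t₁ : |r₁| ≤ Q * E) (t₂ : |r₂| ≤ Q * E) (t₃ : |r₃| ≤ Q * E) (t₄ : |r₄| ≤ Q * E) :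
    |p₄' - p₀ - 4 * c * K * (2 * w + K * (2 * (m + 1) * (ε₁ - ε₂)) + τ)| ≤
      (4 * Q + 12 * B + 136 * (m + 2)) * (K * E) := by
  have b1 : |12 * w| ≤ 12 * B * (K * E) := by
    rw [abs_mul, abs_of_pos (by norm_num : (0 : ℝ) < 12)]
    have : B / K ≤ B * (K * E) := by
      rw [div_eq_mul_one_div]
      gcongr
    linarith
  have b2 : ∀ s : ℝ, |s| = 1 → |s * ((14 * K + 12) * (2 * (m + 1))) +
      -((4 * m + 12) * (K + 1))| ≤ 68 * (m + 2) * K := fun s hs => by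
    refine (abs_add_le _ _).trans ?_
    rw [abs_mul, hs, one_mul, abs_neg, abs_of_nonneg (by positivity), abs_of_nonneg (by positivity)]
    have h1 : (14 * K + 12) * (2 * (m + 1)) ≤ (26 * K) * (2 * (m + 2)) := by
      gcongr <;> linarith
    have h2 : (4 * m + 12) * (K + 1) ≤ (8 * (m + 2)) * (2 * K) := by
      gcongr <;> linarith
    linarith
  have b3 := abs_combine_le h₁ h₂ (b2 1 (by simp)) (b2 (-1) (by simp))
  obtain ⟨P, hP⟩ : ∃ P, P = (1 * ((14 * K + 12) * (2 * (m + 1))) +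
    -((4 * m + 12) * (K + 1))) * ε₁ +
    (-1 * ((14 * K + 12) * (2 * (m + 1))) + -((4 * m + 12) * (K + 1))) * ε₂ := ⟨_, rfl⟩
  rw [← hP] at b3
  have e : p₄' - p₀ - 4 * c * K * (2 * w + K * (2 * (m + 1) * (ε₁ - ε₂)) + τ) =
      (r₁ + r₂ + r₃ + r₄) + c * (12 * w + P) := by
    rw [hP]
    linear_combination e₁ + e₂ + e₃ + e₄ + 4 * hs
  rw [e]
  refine (abs_add_le _ _).trans ?_
  rw [abs_mul, abs_of_pos hc]
  have h1 := abs_add_le (r₁ + r₂ + r₃) r₄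
  have h1' := abs_add_three r₁ r₂ r₃
  have h2 := mul_le_mul hc1 ((abs_add_le _ _).trans (add_le_add b1 b3)) (abs_nonneg _)
    zero_le_one
  have h3 : Q * E ≤ Q * (K * E) := by
    gcongr
    exact le_mul_of_one_le_left hE0 hK
  linarith

/-- The gaps between the upper and the lower corners of a corridor, from the differences of the
four gains in height. -/
theorem abs_corner_gaps_le {m K w ε₁ ε₂ s c τ C E Q p₀ p₁' p₂' p₃' r₁ r₂ r₃ r₄ : ℝ} (hm : 0 ≤ m)
    (hc : 0 < c) (hc1 : c ≤ 1) (hC : 0 ≤ C * E)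
    (h₁ : |ε₁| ≤ E) (h₂ : |ε₂| ≤ E)
    (e₁ : p₁' - p₀ = s + c * ((2 * K + 5) * w + (K + 2) * (2 * (m + 1) * ε₁) +
      (K + 2) ^ 2 * (2 * (m + 1) * (ε₁ - ε₂))) + r₁)
    (e₂ : p₂' - p₁' = s + c * ((2 * K + 3) * (w + (K + 2) * (2 * (m + 1) * (ε₁ - ε₂)) -
      2 * (m + 2) * ε₁) + (K + 1) * (2 * (m + 1) * ε₂) -
      (K + 1) ^ 2 * (2 * (m + 1) * (ε₁ - ε₂))) + r₂)
    (e₃ : p₃' - p₂' = s + c * ((2 * K + 1) * (w + 2 * (m + 1) * (ε₁ - ε₂) -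
      2 * (m + 2) * (ε₁ + ε₂)) + K * (2 * (m + 1) * ε₁) +
      K ^ 2 * (2 * (m + 1) * (ε₁ - ε₂))) + r₃)
    (e₄ : p₀ - p₃' = s + c * ((2 * K + 3) * (w + (K + 1) * (2 * (m + 1) * (ε₁ - ε₂)) -
      2 * (m + 2) * ε₂) + (K + 1) * (2 * (m + 1) * ε₂) -
      (K + 1) ^ 2 * (2 * (m + 1) * (ε₁ - ε₂))) + r₄)
    (t₁ : |r₁| ≤ Q * E) (t₂ : |r₂| ≤ Q * E) (t₃ : |r₃| ≤ Q * E) (t₄ : |r₄| ≤ Q * E)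
    (start : |2 * w + K * (2 * (m + 1) * (ε₁ - ε₂)) + τ| ≤ C * E) :
    |p₀ - p₂' - c * (τ - 2 * (m + 2) * K * (ε₁ + ε₂) + 2 * K * (ε₁ - ε₂))| ≤
      (C + 2 * Q + 30 * (m + 2)) * E ∧
    |p₃' - p₁' - c * (τ - 2 * (m + 2) * K * (ε₁ + ε₂) - 2 * K * (ε₁ - ε₂))| ≤
      (C + 2 * Q + 30 * (m + 2)) * E ∧
    |p₂' - p₁' + p₀ - p₃'| ≤ (C + 2 * Q + 30 * (m + 2)) * E := by
  obtain ⟨a₀, ha₀⟩ : ∃ a₀, a₀ = 2 * w + K * (2 * (m + 1) * (ε₁ - ε₂)) + τ := ⟨_, rfl⟩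
  rw [← ha₀] at start
  have gap : ∀ r r' r'' r''' a b d : ℝ, |r| ≤ Q * E → |r'| ≤ Q * E → |r''| ≤ Q * E →
      |r'''| ≤ Q * E → |a| ≤ 15 * (m + 2) → |b| ≤ 15 * (m + 2) → |d| ≤ C * E →
      |-(1 / 2) * (r - r' + r'' - r''') - c * (d + (a * ε₁ + b * ε₂))| ≤
        (C + 2 * Q + 30 * (m + 2)) * E := by
    intro r r' r'' r''' a b d h3 h4 h5 h6 ha hb hd
    refine (abs_sub _ _).trans ?_
    rw [abs_mul, abs_mul, abs_of_pos hc, abs_neg, abs_of_pos (by norm_num : (0 : ℝ) < 1 / 2)]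
    have h7 := mul_le_mul hc1 ((abs_add_le _ _).trans (add_le_add hd (abs_combine_le h₁ h₂ ha hb)))
      (abs_nonneg _) zero_le_one
    have h8 := abs_sub (r - r' + r'') r'''
    have h9 := abs_add_le (r - r') r''
    have h10 := abs_sub r r'
    linarith
  have habs : ∀ a : ℝ, -(15 * (m + 2)) ≤ a → a ≤ 15 * (m + 2) → |a| ≤ 15 * (m + 2) :=
    fun a h h' => abs_le.mpr ⟨h, h'⟩
  refine ⟨?_, ?_, ?_⟩
  · refine le_of_eq_of_le (congrArg _ ?_) (gap r₁ r₃ r₂ r₄ (3 * (m + 1) + 2 * (m + 1) + (m + 2) - 3)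
      (-(3 * (m + 1)) + (m + 2) + 3) a₀ t₁ t₃ t₂ t₄ (habs _ ?_ ?_) (habs _ ?_ ?_) start)
    · rw [ha₀]
      linear_combination (1 / 2) * (-e₁ - e₂ + e₃ + e₄)
    all_goals linarith
  · refine le_of_eq_of_le (congrArg _ ?_) (gap r₁ r₃ r₄ r₂ (3 * (m + 1) + 2 * (m + 1) + (m + 2) + 3)
      (-(3 * (m + 1)) + (m + 2) - 3) a₀ t₁ t₃ t₄ t₂ (habs _ ?_ ?_) (habs _ ?_ ?_) start)
    · rw [ha₀]
      linear_combination (1 / 2) * (-e₁ + e₂ + e₃ - e₄)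
    all_goals linarith
  · refine le_of_eq_of_le (congrArg _ ?_) (gap r₁ r₂ r₃ r₄ (4 * (m + 2) / 2)
      (4 * (m + 2) / 2) 0 t₁ t₂ t₃ t₄ (habs _ ?_ ?_) (habs _ ?_ ?_) (by simpa using hC))
    · linear_combination (1 / 2) * (-e₁ + e₂ - e₃ + e₄)
    all_goals linarith

/-- The defect of closing of a corridor, in linear approximation. -/
theorem Corridor.Near.abs_defect_le {m k : ℕ} {B w ε₁ ε₂ E : ℝ} {c : Corridor m k α β}
    (h : c.Near w ε₁ ε₂ B E) (hk : (8 * (m + 2) + 4) * B ≤ k) :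
    |c.p₄' + sin c.y₁ - c.p₁ - 4 * cos (π / (2 * ((m : ℝ) + 2))) * k *
      (2 * w + k * (2 * ((m : ℝ) + 1) * (ε₁ - ε₂)) + tan (π / (2 * ((m : ℝ) + 2))) / k)| ≤
      (4 * Corridor.Near.quarterConst m B + 12 * B + 136 * (m + 2)) * (k * E) := by
  have hm : (0 : ℝ) ≤ m := Nat.cast_nonneg m
  have hk1 : (1 : ℝ) ≤ k := by exact_mod_cast h.k_pos
  have hB := h.B_nonneg
  have hQ0 : 0 ≤ Corridor.Near.quarterConst m B := by
    rw [Corridor.Near.quarterConst]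
    positivity
  obtain ⟨t₁, t₂, t₃, t₄⟩ := h.abs_heights_sub_le hk
  have hKE : 1 / (k : ℝ) ≤ k * E := by
    have := h.hE
    rw [div_le_iff₀ (by positivity)] at this ⊢
    linarith
  have hcos := veech_cos_pos m
  have := abs_defect_sub_le hm hk1 hcos (cos_le_one _)
    (s := sin (π / (2 * ((m : ℝ) + 2)))) (τ := tan (π / (2 * ((m : ℝ) + 2))) / k)
    (by rw [tan_eq_sin_div_cos]; field_simp) hB h.hw hKE hQ0 h.E_nonneg h.hε₁ h.hε₂
    (add_sub_cancel _ _).symm (add_sub_cancel _ _).symm (add_sub_cancel _ _).symm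
    (add_sub_cancel _ _).symm t₁ t₂ t₃ t₄
  refine le_of_eq_of_le (congrArg _ ?_) this
  ring

/-- The gaps of all closed corridors near the Veech point, with a uniform error. -/
theorem Corridor.Near.exists_gaps (m : ℕ) {B : ℝ} (hB : 0 ≤ B) :
    ∃ C : ℝ, 0 ≤ C ∧ ∃ k₀ : ℕ, ∀ {k : ℕ} {α β w ε₁ ε₂ E : ℝ} (c : Corridor m k α β), k₀ ≤ k →
      c.Near w ε₁ ε₂ B E → c.p₄' + sin c.y₁ = c.p₁ → c.Gaps w ε₁ ε₂ (C * E) := by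
  obtain ⟨x, hx⟩ : ∃ x, x = π / (2 * ((m : ℝ) + 2)) := ⟨_, rfl⟩
  have hcos : 0 < cos x := hx ▸ veech_cos_pos m
  have hsin : 0 < sin x := hx ▸ veech_sin_pos m
  have hm : (0 : ℝ) ≤ m := Nat.cast_nonneg m
  obtain ⟨Q, hQ⟩ : ∃ Q, Q = Corridor.Near.quarterConst m B := ⟨_, rfl⟩
  have hQ0 : 0 ≤ Q := by rw [hQ, Corridor.Near.quarterConst]; positivity
  -- the constants for the start, the differences of heights and the short sides
  obtain ⟨C₁, hC₁⟩ : ∃ C₁, C₁ = (4 * Q + 12 * B + 136 * (m + 2)) / (4 * cos x) := ⟨_, rfl⟩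
  have hC₁0 : 0 ≤ C₁ := by rw [hC₁]; positivity
  obtain ⟨C₂, hC₂⟩ : ∃ C₂, C₂ = 2 / (sin x * cos x ^ 2) := ⟨_, rfl⟩
  have hC₂0 : 0 ≤ C₂ := by rw [hC₂]; positivity
  obtain ⟨B', hB'⟩ : ∃ B', B' = (8 * ((m : ℝ) + 2) + 4) * B := ⟨_, rfl⟩
  have hB'0 : 0 ≤ B' := by rw [hB']; positivity
  obtain ⟨C₃, hC₃⟩ : ∃ C₃, C₃ = 2 * C₂ + 1 / (2 * cos x) * (B' ^ 2 + (30 * (m + 2) + C₁)) :=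
    ⟨_, rfl⟩
  have hC₃0 : 0 ≤ C₃ := by rw [hC₃]; positivity
  obtain ⟨k₀, hk₀⟩ := exists_nat_ge (max B' (2 * B / (sin x * cos x)))
  refine ⟨C₁ + 2 * Q + 30 * (m + 2) + C₃, by positivity, k₀, ?_⟩
  intro k α β w ε₁ ε₂ E c hk h hcl
  have hkk : max B' (2 * B / (sin x * cos x)) ≤ k := hk₀.trans (by exact_mod_cast hk)
  have hkB : B' ≤ k := (le_max_left _ _).trans hkk
  have hk1 : (1 : ℝ) ≤ k := by exact_mod_cast h.k_pos
  have hE2 : 2 * E ≤ sin x * cos x := by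
    have h1 : 2 * B / (sin x * cos x) ≤ k := (le_max_right _ _).trans hkk
    have h2 : 0 < sin x * cos x := by positivity
    rw [div_le_iff₀ h2] at h1
    have h3 := h.hEB
    rw [le_div_iff₀ (by linarith)] at h3
    have : k * (2 * E) ≤ k * (sin x * cos x) := by linarith
    exact le_of_mul_le_mul_left this (by linarith)
  have hE0 := h.E_nonneg
  obtain ⟨t₁, t₂, t₃, t₄⟩ := h.abs_heights_sub_le (hB' ▸ hkB)
  obtain ⟨g₁, g₂, g₃, g₄, g₅, g₆, g₇⟩ := h.angles
  have g₀ := h.hy₁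
  rw [← hx] at t₁ t₂ t₃ t₄ g₀ g₁ g₃ g₆
  rw [← hQ] at t₁ t₂ t₃ t₄
  have htan : sin x = cos x * tan x := by rw [tan_eq_sin_div_cos]; field_simp
  have hcos1 : cos x ≤ 1 := cos_le_one x
  have hKE : 1 / (k : ℝ) ≤ k * E := by
    have := h.hE
    rw [div_le_iff₀ (by positivity)] at this ⊢
    linarith
  obtain ⟨r₁, e₁, t₁⟩ : ∃ r, c.p₁' - (c.p₁ - sin c.y₁) = _ + r ∧ |r| ≤ Q * E :=
    ⟨_, (add_sub_cancel _ _).symm, t₁⟩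
  obtain ⟨r₂, e₂, t₂⟩ : ∃ r, c.p₂' - c.p₁' = _ + r ∧ |r| ≤ Q * E :=
    ⟨_, (add_sub_cancel _ _).symm, t₂⟩
  obtain ⟨r₃, e₃, t₃⟩ : ∃ r, c.p₃' - c.p₂' = _ + r ∧ |r| ≤ Q * E :=
    ⟨_, (add_sub_cancel _ _).symm, t₃⟩
  obtain ⟨r₄, e₄, t₄⟩ : ∃ r, c.p₄' - c.p₃' = _ + r ∧ |r| ≤ Q * E :=
    ⟨_, (add_sub_cancel _ _).symm, t₄⟩
  obtain ⟨τ, hτ⟩ : ∃ τ, τ = tan x / k := ⟨_, rfl⟩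
  have hτk : sin x = cos x * (τ * k) := by rw [htan, hτ]; field_simp
  rw [h.hy₁, ← hx] at hcl
  have start : |2 * w + k * (2 * ((m : ℝ) + 1) * (ε₁ - ε₂)) + τ| ≤ C₁ * E := by
    have := abs_defect_sub_le hm hk1 hcos hcos1 hτk hB h.hw hKE hQ0 hE0 h.hε₁ h.hε₂
      (p₀ := c.p₄') (by rw [← e₁, ← hcl, g₀]; ring) e₂ e₃ e₄ t₁ t₂ t₃ t₄
    rw [sub_self, zero_sub, abs_neg, abs_mul, abs_of_pos (by positivity : 0 < 4 * cos x * (k : ℝ))]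
      at this
    rw [hC₁, div_mul_eq_mul_div, le_div_iff₀ (by positivity)]
    refine le_of_mul_le_mul_left (a := (k : ℝ)) ?_ (by linarith)
    linarith
  obtain ⟨gap₁, gap₂, gap₃⟩ := abs_corner_gaps_le hm hcos hcos1 (by positivity) h.hε₁ h.hε₂
    (p₀ := c.p₄') (by rw [← e₁, ← hcl, g₀]; ring) e₂ e₃ e₄ t₁ t₂ t₃ t₄ start
  have hC₃E : 0 ≤ C₃ * E := by positivity
  have hCE : (C₁ + 2 * Q + 30 * (m + 2)) * E ≤ (C₁ + 2 * Q + 30 * (m + 2) + C₃) * E := by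
    linarith
  have hCE' : C₃ * E ≤ (C₁ + 2 * Q + 30 * (m + 2) + C₃) * E := by
    have : 0 ≤ (C₁ + 2 * Q + 30 * (m + 2)) * E := by positivity
    linarith
  have hCE'' : C₁ * E ≤ (C₁ + 2 * Q + 30 * (m + 2) + C₃) * E := by
    have : 0 ≤ (2 * Q + 30 * (m + 2) + C₃) * E := by positivity
    linarith
  have hα := h.hα
  have hβ := h.hβ
  rw [← hx] at hα hβ
  have hC₃' : C₃ = 2 * C₂ + |1 / (2 * cos x)| * (B' ^ 2 + (30 * (m + 2) + C₁)) := by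
    rw [abs_of_pos (by positivity), hC₃]
  have near : ∀ a b : ℝ, |a| ≤ 15 * ((m : ℝ) + 2) → |b| ≤ 15 * ((m : ℝ) + 2) →
      |(a * ε₁ + b * ε₂) - (2 * w + k * (2 * ((m : ℝ) + 1) * (ε₁ - ε₂)) + τ)| ≤
        (30 * (m + 2) + C₁) * E := fun a b ha hb => by
    refine (abs_sub _ _).trans ?_
    linarith [abs_combine_le h.hε₁ h.hε₂ ha hb]
  have habs : ∀ a : ℝ, -(15 * ((m : ℝ) + 2)) ≤ a → a ≤ 15 * ((m : ℝ) + 2) →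
    |a| ≤ 15 * ((m : ℝ) + 2) := fun a h h' => abs_le.mpr ⟨h, h'⟩
  have hm1 : |(2 * ((m : ℝ) + 1))| ≤ 2 * (m + 2) := by rw [abs_of_nonneg] <;> linarith
  have hm2 : |(2 * ((m : ℝ) + 2))| ≤ 2 * (m + 2) := by rw [abs_of_nonneg]; linarith
  have hm3 : |(-1 : ℝ)| ≤ 2 * ((m : ℝ) + 2) := by rw [abs_neg, abs_one]; linarith
  have hm4 : |(0 : ℝ)| ≤ 2 * ((m : ℝ) + 2) := by rw [abs_zero]; linarith
  have hm5 : |-(2 * ((m : ℝ) + 2))| ≤ 2 * (m + 2) := by rwa [abs_neg]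
  refine ⟨hx ▸ hτ ▸ start.trans hCE'', hx ▸ hτ ▸ gap₁.trans hCE, hx ▸ hτ ▸ gap₂.trans hCE,
    gap₃.trans hCE, ?_, ?_⟩
  · rw [← hx, ← hτ]
    refine le_trans ?_ hCE'
    rw [hC₃']
    refine abs_short_sides_sub_le (K := k) (hC₂ ▸ ?_) (by linarith) hkB ?_ ?_ ?_ h.hE (by positivity)
    · rw [hα, hβ]
      exact abs_sideTwo_sub_le hcos hsin h.hε₂ h.hε₁ hE2
    · have := h.abs_angle_le (i := 1) (by linarith) hm5 hm3 hm4 hm4 1 (by simp)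
      rw [hB', g₃, ← abs_neg]
      refine le_of_eq_of_le (congrArg _ ?_) this
      linear_combination -hβ
    · have := h.abs_angle_le (i := 0) (by linarith) hm4 hm3 hm4 hm4 0 (by simp)
      rw [hB', g₀, ← abs_neg]
      refine le_of_eq_of_le (congrArg _ ?_) this
      linear_combination -hβ
    · refine le_of_eq_of_le (congrArg _ ?_) (near (-(2 * (m + 1)) + 2 * (m + 2))
        (2 + 2 * (m + 1)) (habs _ ?_ ?_) (habs _ ?_ ?_))
      · rw [g₃, g₀]
        linear_combination 2 * hβ
      all_goals linarith
  · rw [← hx, ← hτ]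
    refine le_trans ?_ hCE'
    rw [hC₃']
    refine abs_short_sides_sub_le (K := k) (hC₂ ▸ ?_) (by linarith) hkB ?_ ?_ ?_ h.hE (by positivity)
    · rw [hα, hβ]
      exact abs_sideTwo_sub_le hcos hsin h.hε₁ h.hε₂ hE2
    · have := h.abs_angle_le (i := k + 2) le_rfl hm3 hm4 hm4 hm4 (k + 2)
        (by rw [abs_of_nonneg]; linarith)
      rw [hB', g₁, ← abs_neg]
      refine le_of_eq_of_le (congrArg _ ?_) this
      linear_combination -hα
    · have := h.abs_angle_le (i := k + 2) le_rfl hm3 hm5 hm4 hm4 (k + 1)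
        (by rw [abs_of_nonneg] <;> linarith)
      rw [hB', g₆, ← abs_neg]
      refine le_of_eq_of_le (congrArg _ ?_) this
      linear_combination -hα
    · refine le_of_eq_of_le (congrArg _ ?_) (near (2 - 3 * (2 * (m + 1)))
        (3 * (2 * (m + 1)) + 2 * (m + 2)) (habs _ ?_ ?_) (habs _ ?_ ?_))
      · rw [g₁, g₆]
        linear_combination 2 * hα
      all_goals linarith

end

section

/-! ### Localization of open corridors -/

variable {α β : ℝ}

/-- Vectors which turn in steps of less than `π` and remain in the upper half plane do not turn
around. -/
theorem add_mul_lt_pi {y δ : ℝ} (hδ : δ < π) (hπ : y < π) {N : ℕ}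
    (h : ∀ l : ℕ, l ≤ N → 0 < l → 0 < sin (y + l * δ)) : y + N * δ < π := by
  induction N with
  | zero => simpa using hπ
  | succ N ih =>
    have h1 := ih fun l hl => h l (by omega)
    have h2 := h (N + 1) le_rfl (by omega)
    by_contra h3
    push Not at h3
    push_cast at h2 h3
    have h4 : 0 ≤ sin (y + (N + 1) * δ - π) := sin_nonneg_of_nonneg_of_le_pi (by linarith)
      (by linarith)
    rw [sin_sub_pi] at h4
    linarith

/-- As seen from the centre of a fan, all inner vertices are in the direction of the line. -/
theorem Fan.sin_pos {r g y : ℝ} {m : ℕ} (h : Fan α r g y m) (hr : 0 < r) {l : ℕ} (h0 : 0 < l)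
    (hl : l < 2 * m) : 0 < sin (y + l * α) := by
  obtain ⟨h1, h2, h3⟩ := h
  obtain ⟨i, rfl | rfl⟩ := Nat.even_or_odd' l
  · have := h3 i (by omega) (by omega)
    push_cast
    linarith
  · have := h2 i (by omega)
    push_cast
    exact pos_of_mul_pos_right (h1.trans this) hr.le

/-- The upper vertices of a zigzag have heights between `0` and `1`, since the steps down
have length `1` and end below the line. -/
theorem ZigFans.height_mem {m : ℕ} {r s y p : ℝ} {K : ℕ} (h : ZigFans m α r β s y p K) {j : ℕ}
    (hj : j < K) : 0 < zigHeight (turnAngle m α) (turnAngle m β) y p j ∧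
      zigHeight (turnAngle m α) (turnAngle m β) y p j < 1 ∧
      sin (y + j * (turnAngle m β - turnAngle m α) - turnAngle m α) < 0 := by
  obtain ⟨⟨h1, -⟩, ⟨h2, -⟩⟩ := h j hj
  have := neg_one_le_sin (y + j * (turnAngle m β - turnAngle m α) - turnAngle m α)
  exact ⟨h1, by linarith, by linarith⟩

theorem ZigFans.sin_pos {m : ℕ} {r s y p : ℝ} {K : ℕ} (h : ZigFans m α r β s y p K) {j : ℕ}
    (hj : j + 1 < K) : 0 < sin (y + (j + 1) * (turnAngle m β - turnAngle m α)) := by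
  obtain ⟨-, ⟨h2, -⟩⟩ := h j (by omega)
  obtain ⟨⟨h1, -⟩, -⟩ := h (j + 1) hj
  rw [zigHeight] at h1
  linarith

/-- The angles of the long sides in a zigzag alternate between the upper and the lower half
plane. -/
theorem ZigFans.angle_mem {m : ℕ} {r s y p : ℝ} {K : ℕ}
    (h : ZigFans (m + 1) α r β s y p (K + 1)) (hr : 0 < r) (hs : 0 < s) (hα : 0 < α) (hα' : α < π)
    (hβ : 0 < β) (hβ' : β < π) {a : ℕ}
    (hy : 0 < y + a * (turnAngle (m + 1) β - turnAngle (m + 1) α))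
    (hy' : y + a * (turnAngle (m + 1) β - turnAngle (m + 1) α) < π) {j : ℕ} (haj : a ≤ j)
    (hj : j ≤ K) : (0 < y + j * (turnAngle (m + 1) β - turnAngle (m + 1) α) ∧
      y + j * (turnAngle (m + 1) β - turnAngle (m + 1) α) < turnAngle (m + 1) α ∧
      turnAngle (m + 1) α - (y + j * (turnAngle (m + 1) β - turnAngle (m + 1) α)) < π) ∧
      0 < y + (j + 1) * (turnAngle (m + 1) β - turnAngle (m + 1) α) + β ∧
      y + (j + 1) * (turnAngle (m + 1) β - turnAngle (m + 1) α) + β < π := by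
  have step : ∀ j : ℕ, j ≤ K → 0 < y + j * (turnAngle (m + 1) β - turnAngle (m + 1) α) →
      y + j * (turnAngle (m + 1) β - turnAngle (m + 1) α) < π →
      y + j * (turnAngle (m + 1) β - turnAngle (m + 1) α) < turnAngle (m + 1) α ∧
      turnAngle (m + 1) α - (y + j * (turnAngle (m + 1) β - turnAngle (m + 1) α)) < π ∧
      0 < y + (j + 1) * (turnAngle (m + 1) β - turnAngle (m + 1) α) + β ∧
      y + (j + 1) * (turnAngle (m + 1) β - turnAngle (m + 1) α) + β < π := by
    intro j hj h1 h2
    obtain ⟨f1, f2⟩ := h j (by omega)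
    have h3 := (h.height_mem (Nat.lt_succ_of_le hj)).2.2
    obtain ⟨Y, hY⟩ : ∃ Y, Y = y + j * (turnAngle (m + 1) β - turnAngle (m + 1) α) := ⟨_, rfl⟩
    rw [← hY] at h1 h2 h3 f1 f2
    have h4 : Y + (2 * (m + 1) : ℕ) * α < π := by
      refine add_mul_lt_pi hα' h2 fun l hl hl' => ?_
      rcases hl.lt_or_eq with hl | rfl
      · exact f1.sin_pos hr hl' hl
      · rw [show Y + (2 * (m + 1) : ℕ) * α = Y - turnAngle (m + 1) α + π by
          rw [turnAngle]; push_cast; ring, sin_add_pi]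
        linarith
    have h5 : Y < turnAngle (m + 1) α := by
      rw [turnAngle]
      push_cast at h4 ⊢
      linarith
    have h6 : turnAngle (m + 1) α < π := by
      rw [turnAngle]
      have : 0 < 2 * ((m + 1 : ℕ) : ℝ) * α := by positivity
      linarith
    have h7 : turnAngle (m + 1) α - Y + (2 * m + 1 : ℕ) * β < π :=
      add_mul_lt_pi hβ' (by linarith) fun l hl hl' =>
        f2.sin_pos hs hl' (by omega)
    have h8 : y + (j + 1) * (turnAngle (m + 1) β - turnAngle (m + 1) α) + β =
        π - (turnAngle (m + 1) α - Y + (2 * m + 1 : ℕ) * β) := by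
      rw [hY]
      simp only [turnAngle]
      push_cast
      ring
    rw [h8, ← hY]
    have : 0 ≤ ((2 * m + 1 : ℕ) : ℝ) * β := by positivity
    exact ⟨h5, by linarith, by linarith, by linarith⟩
  have mem : 0 < y + j * (turnAngle (m + 1) β - turnAngle (m + 1) α) ∧
      y + j * (turnAngle (m + 1) β - turnAngle (m + 1) α) < π := by
    induction j, haj using Nat.le_induction with
    | base => exact ⟨hy, hy'⟩
    | succ j haj ih =>
      obtain ⟨h1, h2⟩ := ih (by omega)
      obtain ⟨-, -, h3, h4⟩ := step j (by omega) h1 h2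
      have h5 := h.sin_pos (j := j) (by omega)
      push_cast
      refine ⟨?_, by linarith⟩
      by_contra h6
      exact absurd h5 (not_lt.mpr (sin_nonpos_of_nonpos_of_neg_pi_le (not_lt.mp h6) (by linarith)))
  obtain ⟨h1, h2⟩ := mem
  obtain ⟨h3, h4, h5, h6⟩ := step j hj h1 h2
  exact ⟨⟨h1, h3, h4⟩, h5, h6⟩

/-- The angles at a corner of a corridor. -/
theorem Fan.corner_mem {m : ℕ} {r p y : ℝ} (h : Fan α r (-p) (-y) (m + 2)) (hr : 0 < r)
    (hα : 0 < α) (hβ : 0 < β) (hαβ : α + β < π) (hy : 0 < y + β) (hy' : y + β < π) :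
    y < α ∧ (0 < sin (y + turnAngle (m + 2) α) →
      0 < y + turnAngle (m + 2) α ∧ y + turnAngle (m + 2) α < π) := by
  have h1 := h.sin_pos hr (l := 1) one_pos (by omega)
  have h2 : y < α := by
    by_contra h3
    have : sin (-y + (1 : ℕ) * α) ≤ 0 :=
      sin_nonpos_of_nonpos_of_neg_pi_le (by push_cast; linarith) (by push_cast; linarith)
    linarith
  refine ⟨h2, fun h3 => ?_⟩
  have h4 : α - y + (2 * m + 3 : ℕ) * α < π := by
    refine add_mul_lt_pi (by linarith) (by linarith) fun l hl hl' => ?_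
    rcases hl.lt_or_eq with hl | rfl
    · have := h.sin_pos hr (l := l + 1) (by omega) (by omega)
      push_cast at this
      rwa [show -y + (l + 1) * α = α - y + l * α by ring] at this
    · rw [show α - y + (2 * m + 3 : ℕ) * α = π - (y + turnAngle (m + 2) α) by
        rw [turnAngle]; push_cast; ring, sin_pi_sub]
      exact h3
  have h5 : y + turnAngle (m + 2) α = π - (α - y + (2 * m + 3 : ℕ) * α) := by
    rw [turnAngle]; push_cast; ring
  have : 0 ≤ ((2 * m + 3 : ℕ) : ℝ) * α := by positivity
  rw [h5]
  exact ⟨by linarith, by linarith⟩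

/-- If the sines of an arithmetic progression have bounded sums over its first and over its last
third, the progression is close to `0`: the mean over each of these thirds is of order `1 / L`. -/
theorem abs_progression_le {ψ η C : ℝ} {L : ℕ} (hL : 0 < L)
    (hψ : ∀ i : ℕ, i < 3 * L → |ψ + i * η| ≤ π / 2)
    (h₁ : |∑ i ∈ Finset.range L, sin (ψ + i * η)| ≤ C)
    (h₂ : |∑ i ∈ Finset.range L, sin (ψ + (2 * L + i : ℕ) * η)| ≤ C) :
    |η| ≤ π * C / L ^ 2 ∧ |ψ| ≤ 2 * π * C / L := by
  wlog hη : 0 ≤ η generalizing ψ η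
  · have := this (ψ := -ψ) (η := -η) (fun i hi => by
      rw [mul_neg, ← neg_add, abs_neg]
      exact hψ i hi) (by
      simp only [mul_neg, ← neg_add, sin_neg, Finset.sum_neg_distrib, abs_neg]
      exact h₁) (by
      simp only [mul_neg, ← neg_add, sin_neg, Finset.sum_neg_distrib, abs_neg]
      exact h₂) (by linarith)
    simpa only [abs_neg] using this
  have hL' : (0 : ℝ) < L := by exact_mod_cast hL
  have hC : 0 ≤ C := (abs_nonneg _).trans h₁
  have key : ∀ v : ℝ, |v| ≤ π / 2 → L * sin v ≤ C → v ≤ π * C / (2 * L) := by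
    intro v hv h
    rcases le_total v 0 with h0 | h0
    · exact h0.trans (by positivity)
    · have := mul_le_sin h0 (abs_le.mp hv).2
      rw [le_div_iff₀ (by positivity)]
      have h3 : L * (2 / π * v) ≤ C := (mul_le_mul_of_nonneg_left this hL'.le).trans h
      calc v * (2 * L) = π * (L * (2 / π * v)) := by field_simp
        _ ≤ π * C := by gcongr
  have mono : ∀ {i j : ℕ}, i ≤ j → j < 3 * L → sin (ψ + i * η) ≤ sin (ψ + j * η) := by
    intro i j hij hj
    refine sin_le_sin_of_le_of_le_pi_div_two ?_ (abs_le.mp (hψ j hj)).2 ?_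
    · linarith [(abs_le.mp (hψ i (by omega))).1]
    · gcongr
  have a1 : ψ + (2 * L : ℕ) * η ≤ π * C / (2 * L) := by
    refine key _ (hψ _ (by omega)) (le_trans ?_ ((le_abs_self _).trans h₂))
    have := Finset.card_nsmul_le_sum (Finset.range L)
      (fun i => sin (ψ + (2 * L + i : ℕ) * η)) (sin (ψ + (2 * L : ℕ) * η))
      (fun i hi => mono (by omega) (by have := Finset.mem_range.mp hi; omega))
    simpa using this
  have a2 : -(ψ + L * η) ≤ π * C / (2 * L) := by
    refine key _ (by rw [abs_neg]; exact hψ _ (by omega)) ?_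
    rw [sin_neg, mul_neg]
    refine le_trans ?_ ((neg_le_abs _).trans h₁)
    have := Finset.sum_le_card_nsmul (Finset.range L)
      (fun i => sin (ψ + i * η)) (sin (ψ + L * η))
      (fun i hi => mono (by have := Finset.mem_range.mp hi; omega) (by omega))
    simp at this
    linarith
  push_cast at a1
  have e1 : π * C / (2 * L) + π * C / (2 * L) = π * C / L := by field_simp; ring
  have a3 : L * η ≤ π * C / L := by linarith
  have a4 : 0 ≤ π * C / (2 * L) := by positivity
  have a5 : 0 ≤ L * η := by positivity
  have e2 : 2 * π * C / L = π * C / L + π * C / L := by ring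
  refine ⟨?_, ?_⟩
  · rw [abs_of_nonneg hη, le_div_iff₀ (by positivity)]
    rw [le_div_iff₀ hL'] at a3
    linarith
  · rw [abs_le]
    constructor <;> linarith

end

section

variable {α β : ℝ}

/-- The height gained between two upper vertices, as a sum of sines. -/
theorem zigHeight_add_index (θ θ' y p : ℝ) (a L : ℕ) : zigHeight θ θ' y p (a + L) =
    zigHeight θ θ' y p a + 2 * cos (θ' / 2) *
      ∑ i ∈ Finset.range L, sin (y + (a + i : ℕ) * (θ' - θ) - θ + θ' / 2) := by
  induction L with
  | zero => simp
  | succ L ih =>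
    rw [← add_assoc, zigHeight_succ, ih, Finset.sum_range_succ]
    ring

/-- In a long zigzag the steps are almost parallel to the line in the mean. -/
theorem ZigFans.abs_progression_le {m : ℕ} {r s y p : ℝ} {K : ℕ}
    (h : ZigFans (m + 1) α r β s y p (K + 1)) (hr : 0 < r) (hs : 0 < s) (hα : 0 < α) (hα' : α < π)
    (hβ : 0 < β) (hβ' : β < π) {a L : ℕ} (hL : 0 < L) (haL : a + 3 * L ≤ K)
    (hcos : 1 / 8 ≤ cos (turnAngle (m + 1) β / 2))
    (hy : 0 < y + a * (turnAngle (m + 1) β - turnAngle (m + 1) α))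
    (hy' : y + a * (turnAngle (m + 1) β - turnAngle (m + 1) α) < π) :
    |turnAngle (m + 1) β - turnAngle (m + 1) α| ≤ π * 4 / L ^ 2 ∧
    |y + a * (turnAngle (m + 1) β - turnAngle (m + 1) α) - turnAngle (m + 1) α +
      turnAngle (m + 1) β / 2| ≤ 2 * π * 4 / L := by
  have mem := fun j haj hjK => h.angle_mem hr hs hα hα' hβ hβ' hy hy' (j := j) haj hjK
  have height := fun j (hj : j < K + 1) => h.height_mem hj
  generalize turnAngle (m + 1) β = θ' at *
  generalize turnAngle (m + 1) α = θ at *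
  have sums : ∀ b : ℕ, a ≤ b → b + L ≤ K →
      |∑ i ∈ Finset.range L, sin (y + (b + i : ℕ) * (θ' - θ) - θ + θ' / 2)| ≤ 4 := by
    intro b hab hb
    have h1 := zigHeight_add_index θ θ' y p b L
    obtain ⟨h2, h3, -⟩ := height (b + L) (by omega)
    obtain ⟨h4, h5, -⟩ := height b (by omega)
    have h6 : 2 * cos (θ' / 2) *
        |∑ i ∈ Finset.range L, sin (y + (b + i : ℕ) * (θ' - θ) - θ + θ' / 2)| ≤ 1 := by
      rw [← abs_of_nonneg (by linarith : 0 ≤ 2 * cos (θ' / 2)), ← abs_mul, abs_le]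
      constructor <;> linarith
    nlinarith [abs_nonneg (∑ i ∈ Finset.range L, sin (y + (b + i : ℕ) * (θ' - θ) - θ + θ' / 2))]
  refine TriangularBilliards.abs_progression_le hL (fun i hi => ?_) ?_ ?_
  · obtain ⟨⟨h1, h2, h3⟩, -, h7⟩ := mem (a + i) (by omega) (by omega)
    obtain ⟨⟨h4, h5, h6⟩, -⟩ := mem (a + i + 1) (by omega) (by omega)
    push_cast at h1 h2 h3 h4 h5 h6 h7
    rw [abs_le]
    constructor <;> linarith
  · have := sums a le_rfl (by omega)
    refine le_of_eq_of_le (congrArg _ (Finset.sum_congr rfl fun i _ => congrArg _ ?_)) this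
    push_cast
    ring
  · have := sums (a + 2 * L) (by omega) (by omega)
    refine le_of_eq_of_le (congrArg _ (Finset.sum_congr rfl fun i _ => congrArg _ ?_)) this
    push_cast
    ring

/-- All angles of an open corridor may be shifted by full turns. -/
theorem Corridor.Open.exists_lift {m k : ℕ} {c : Corridor m k α β} (hc : c.Open)
    (h : sin (α + β) ≠ 0) (z : ℤ) :
    ∃ c' : Corridor m k α β, c'.y₁ = c.y₁ + z * (2 * π) ∧ c'.Open := by
  obtain ⟨c', h1, h2⟩ := exists_corridor m k α β (c.y₁ + z * (2 * π)) c.p₁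
  have h3 := (follows_tileWord h c).1.mpr hc
  have h4 : startOne c'.y₁ c'.p₁ = turn z (startOne c.y₁ c.p₁) := by
    rw [h1, h2, startOne, startOne, turn]
    congr 1
    ring
  refine ⟨c', h1, (follows_tileWord h c').1.mp ?_⟩
  rw [h4, follows_turn, run_turn, h2]
  exact h3

theorem exists_add_int_mem {y : ℝ} (hy : 0 < sin y) :
    ∃ z : ℤ, 0 < y + z * (2 * π) ∧ y + z * (2 * π) < π := by
  obtain ⟨z, ⟨h1, h2⟩, -⟩ := existsUnique_add_zsmul_mem_Ioc two_pi_pos y (-π)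
  rw [zsmul_eq_mul] at h1 h2
  have h3 : 0 < sin (y + z * (2 * π)) := by rwa [sin_add_int_mul_two_pi]
  refine ⟨z, ?_, ?_⟩
  · by_contra h4
    exact absurd h3 (not_lt.mpr (sin_nonpos_of_nonpos_of_neg_pi_le (not_lt.mp h4) h1.le))
  · rcases lt_or_eq_of_le (by linarith : y + z * (2 * π) ≤ π) with h4 | h4
    · exact h4
    · rw [h4, sin_pi] at h3
      exact absurd h3 (lt_irrefl 0)

theorem cos_turnAngle_div_two (m : ℕ) (β : ℝ) :
    cos (turnAngle (m + 1) β / 2) = sin (((m : ℝ) + 1) * β) := by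
  rw [← cos_pi_div_two_sub, turnAngle]
  congr 1
  push_cast
  ring

/-- The deviations from the Veech point, from the mean directions of the first two zigzags. The
numerical constants are generous; only their existence matters. -/
theorem Corridor.near_of_abs_le {m k : ℕ} (c : Corridor m k α β) (hk : 16 ≤ k)
    (l1 : |2 * (m + 1) * (α - β)| ≤ 100 * π / k ^ 2)
    (m1 : |c.y₁ + (1 : ℕ) * (turnAngle (m + 1) β - turnAngle (m + 1) α) - turnAngle (m + 1) α +
      turnAngle (m + 1) β / 2| ≤ 40 * π / k)
    (m2 : |c.y₂ + (0 : ℕ) * (turnAngle (m + 1) α - turnAngle (m + 1) β) - turnAngle (m + 1) β +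
      turnAngle (m + 1) α / 2| ≤ 40 * π / k) :
    c.Near (c.y₁ - π / (2 * ((m : ℝ) + 2))) (α - π / (2 * ((m : ℝ) + 2)))
      (β - π / (2 * ((m : ℝ) + 2))) (1000 * π) (1000 * π / k) := by
  have hπ := pi_pos
  have hm : (0 : ℝ) ≤ m := Nat.cast_nonneg m
  have hk' : (16 : ℝ) ≤ k := by exact_mod_cast hk
  have hy₁' := c.hy₁'
  push_cast at hy₁'
  have hy₂ := c.hy₂
  obtain ⟨η, hη⟩ : ∃ η, η = turnAngle (m + 1) β - turnAngle (m + 1) α := ⟨_, rfl⟩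
  have hη' : η = 2 * (m + 1) * (α - β) := by
    rw [hη, turnAngle, turnAngle]
    push_cast
    ring
  rw [← hη'] at l1
  have hkinv : 100 * π / (k : ℝ) ^ 2 ≤ 100 * π / k := by
    gcongr
    nlinarith
  have kη : |(k : ℝ) * η| ≤ 100 * π / k := by
    rw [abs_mul, Nat.abs_cast]
    calc k * |η| ≤ k * (100 * π / k ^ 2) := by gcongr
      _ = 100 * π / k := by field_simp
  -- with the unit `U = π / k`, the two mean directions differ by `2 n (α - x)`, up to `O(U)`
  obtain ⟨x, hx⟩ : ∃ x, x = π / (2 * ((m : ℝ) + 2)) := ⟨_, rfl⟩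
  have hx' : π = 2 * (m + 2) * x := by rw [hx]; field_simp
  obtain ⟨U, hU⟩ : ∃ U, U = π / (k : ℝ) := ⟨_, rfl⟩
  have hU0 : 0 ≤ U := by rw [hU]; positivity
  have eU : ∀ r : ℝ, r * π / k = r * U := fun r => by rw [hU]; ring
  rw [eU] at m1 m2 kη hkinv
  have l1' := l1.trans hkinv
  have n1 : |2 * (m + 2) * (α - x)| ≤ 480 * U := by
    have : 2 * (m + 2) * (α - x) = (c.y₁ + (1 : ℕ) *
        (turnAngle (m + 1) β - turnAngle (m + 1) α) - turnAngle (m + 1) α +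
        turnAngle (m + 1) β / 2) - (c.y₂ + (0 : ℕ) *
        (turnAngle (m + 1) α - turnAngle (m + 1) β) - turnAngle (m + 1) β +
        turnAngle (m + 1) α / 2) + k * η - (1 / 2) * η := by
      have : turnAngle (m + 2) α = π - 2 * (m + 2) * α := by rw [turnAngle]; push_cast; ring
      rw [hy₂, hy₁', hη, this]
      push_cast
      linear_combination hx'
    rw [this]
    rw [abs_le] at m1 m2 kη l1' ⊢
    constructor <;> linarith
  have n2 : |α - x| ≤ 240 * U := by
    rw [abs_mul, abs_of_nonneg (by positivity)] at n1
    have := abs_nonneg (α - x)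
    nlinarith
  have n3 : |2 * (m + 1) * (α - x)| ≤ 480 * U := by
    rw [abs_mul, abs_of_nonneg (by positivity)] at n1 ⊢
    refine le_trans ?_ n1
    gcongr
    norm_num
  have n4 : |α - β| ≤ 100 * U := by
    rw [hη', abs_mul, abs_of_nonneg (by positivity)] at l1'
    have := abs_nonneg (α - β)
    nlinarith
  have n5 : |β - x| ≤ 340 * U := by
    rw [abs_le] at n4 n2 ⊢
    constructor <;> linarith
  rw [← hx]
  refine ⟨by omega, ?_, ?_, ?_, ?_, ?_, ?_, le_rfl, ?_, ?_⟩
  · rw [hx]; ring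
  · rw [hx]; ring
  · rw [hx]; ring
  · rw [eU]
    have : c.y₁ - x = (c.y₁ + (1 : ℕ) *
        (turnAngle (m + 1) β - turnAngle (m + 1) α) - turnAngle (m + 1) α +
        turnAngle (m + 1) β / 2) - (3 / 2) * η - (1 / 2) * (2 * (m + 1) * (α - x)) := by
      have h1 : turnAngle (m + 1) α = π - 2 * (m + 1) * α := by rw [turnAngle]; push_cast; ring
      rw [← hη]
      rw [← sub_eq_iff_eq_add.mpr hη, h1, hη']
      push_cast
      linear_combination (1 / 2) * hx'
    rw [this]
    rw [abs_le] at m1 l1' n3 ⊢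
    constructor <;> linarith
  · rw [eU]; linarith
  · rw [eU]; linarith
  · rw [show α - x - (β - x) = α - β by ring, ← hη']
    refine l1.trans ?_
    gcongr
    norm_num
  · rw [div_le_div_iff₀ (by positivity) (by positivity)]
    have : (k : ℝ) ≤ k ^ 2 := by nlinarith
    have := pi_gt_three
    nlinarith

/-- An open corridor starts, up to full turns, near the angle `π / 2n`, and its triangle is close
to the Veech point. -/
theorem Corridor.Open.exists_near {m k : ℕ} {c : Corridor m k α β} (hc : c.Open) (hα : 0 < α)
    (hβ : 0 < β) (hαβ : α + β < π / 2) (hk : 16 ≤ k) : ∃ (c' : Corridor m k α β) (w ε₁ ε₂ : ℝ),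
      c'.Open ∧ c'.Near w ε₁ ε₂ (1000 * π) (1000 * π / k) := by
  have hπ := pi_pos
  have hm : (0 : ℝ) ≤ m := Nat.cast_nonneg m
  have hk' : (16 : ℝ) ≤ k := by exact_mod_cast hk
  have hs : 0 < sin (α + β) := sin_pos_of_pos_of_lt_pi (by linarith) (by linarith)
  have hrα : 0 < sideTwo α β := div_pos (sin_pos_of_pos_of_lt_pi hβ (by linarith)) hs
  have hrβ : 0 < sideTwo β α := by
    rw [sideTwo, add_comm]
    exact div_pos (sin_pos_of_pos_of_lt_pi hα (by linarith)) hs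
  -- the lift of the angles for which the second step up has its angle in `(0, π)`
  have h1 := hc.fans₁.sin_pos (j := 0) (by omega)
  obtain ⟨z, hz⟩ := exists_add_int_mem h1
  obtain ⟨c', hy, hc'⟩ := hc.exists_lift hs.ne' z
  clear h1 hc
  have hz1 : 0 < c'.y₁ + (1 : ℕ) * (turnAngle (m + 1) β - turnAngle (m + 1) α) := by
    push_cast at hz ⊢
    rw [hy]
    linarith [hz.1]
  have hz2 : c'.y₁ + (1 : ℕ) * (turnAngle (m + 1) β - turnAngle (m + 1) α) < π := by
    push_cast at hz ⊢
    rw [hy]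
    linarith [hz.2]
  clear hz hy
  -- the angles stay in the proper half planes through the first two zigzags and corners
  have a1 := hc'.fans₁.angle_mem hrα hrβ hα (by linarith) hβ (by linarith) hz1 hz2
    (j := k + 1) (by omega) le_rfl
  have hy₁' := c'.hy₁'
  push_cast at hy₁'
  have b1 : 0 < c'.y₁' + β ∧ c'.y₁' + β < π := by
    have := a1.2
    push_cast at this
    rw [hy₁']
    constructor <;> linarith
  obtain ⟨d1, d2⟩ := hc'.corner₁.corner_mem hrα hα hβ (by linarith) b1.1 b1.2
  have b2 : 0 < sin (c'.y₁' + turnAngle (m + 2) α) := by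
    have e1 := hc'.corner₁.1
    have e2 := (hc'.fans₂ 0 (by omega)).1.1
    have e3 := c'.hp₂
    rw [zigHeight] at e2
    rw [← c'.hy₂]
    linarith
  obtain ⟨f1, f2⟩ := d2 b2
  rw [← c'.hy₂] at f1 f2
  have f1' : 0 < c'.y₂ + (0 : ℕ) * (turnAngle (m + 1) α - turnAngle (m + 1) β) := by simpa
  have f2' : c'.y₂ + (0 : ℕ) * (turnAngle (m + 1) α - turnAngle (m + 1) β) < π := by simpa
  have a2 := hc'.fans₂.angle_mem hrβ hrα hβ (by linarith) hα (by linarith) f1' f2'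
    (j := k) (by omega) le_rfl
  have hy₂' := c'.hy₂'
  push_cast at hy₂'
  obtain ⟨g1, -⟩ := hc'.corner₂.corner_mem hrβ hβ hα (by linarith)
    (by rw [hy₂']; exact a2.2.1) (by rw [hy₂']; exact a2.2.2)
  -- the angles of the triangle are bounded below, so that the steps of the zigzags are not small
  have hy₂ := c'.hy₂
  have hθα : 0 < turnAngle (m + 1) α := by linarith [a1.1.1, a1.1.2.1]
  have hθβ : 0 < turnAngle (m + 1) β := by linarith [a2.1.1, a2.1.2.1]
  obtain ⟨η, hη⟩ : ∃ η, η = turnAngle (m + 1) β - turnAngle (m + 1) α := ⟨_, rfl⟩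
  have hη' : η = 2 * (m + 1) * (α - β) := by
    rw [hη, turnAngle, turnAngle]
    push_cast
    ring
  have i1 : π < 2 * (m + 2) * α + β := by
    have : turnAngle (m + 2) α = π - 2 * (m + 2) * α := by rw [turnAngle]; push_cast; ring
    rw [hy₂', hy₂, hy₁', this] at g1
    push_cast at hz1
    linarith
  have i2 : |(k + 1) * η| ≤ 2 * π := by
    rw [← hη] at hy₁' hz1 hz2
    push_cast at hz1 hz2
    rw [abs_le]
    constructor <;> linarith
  have hβ2 : 2 * (m + 1) * β < π := by
    rw [turnAngle] at hθβ
    push_cast at hθβ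
    linarith
  have hα2 : 2 * (m + 1) * α < π := by
    rw [turnAngle] at hθα
    push_cast at hθα
    linarith
  have i3 : π / 4 ≤ (m + 2) * α := by
    have : 2 * β ≤ 2 * (m + 1) * β := by nlinarith
    linarith
  have i3' : π / 8 ≤ (m + 1) * α := by nlinarith
  have i4 : π / 16 ≤ (m + 1) * β := by
    have h1 : (m + 1) * (α - β) ≤ π / 16 := by
      have h2 : (k + 1) * (2 * (m + 1) * (α - β)) ≤ 2 * π := by
        rw [← hη']
        exact (le_abs_self _).trans i2
      rcases le_total ((m + 1) * (α - β)) 0 with h3 | h3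
      · linarith
      · have h4 : 17 * ((m + 1) * (α - β)) ≤ (k + 1) * ((m + 1) * (α - β)) := by
          gcongr
          linarith
        linarith
    linarith
  have cosβ : 1 / 8 ≤ cos (turnAngle (m + 1) β / 2) := by
    rw [cos_turnAngle_div_two]
    refine le_trans ?_ (mul_le_sin (by positivity) (by linarith))
    rw [div_mul_eq_mul_div, le_div_iff₀ hπ]
    linarith
  have cosα : 1 / 8 ≤ cos (turnAngle (m + 1) α / 2) := by
    rw [cos_turnAngle_div_two]
    refine le_trans ?_ (mul_le_sin (by positivity) (by linarith))
    rw [div_mul_eq_mul_div, le_div_iff₀ hπ]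
    linarith
  -- the heights are bounded along zigzags of length `k`, which forces small mean directions
  obtain ⟨L, hL⟩ : ∃ L, L = k / 3 := ⟨_, rfl⟩
  have hL1 : 3 * L ≤ k := by omega
  have hL2 : k ≤ 5 * L := by omega
  have hL2' : (k : ℝ) / 5 ≤ L := by
    rw [div_le_iff₀ (by norm_num)]
    exact_mod_cast hL2.trans (by omega)
  obtain ⟨j1, j2⟩ := hc'.fans₁.abs_progression_le hrα hrβ hα (by linarith) hβ (by linarith)
    (by omega : 0 < L) (by omega) cosβ hz1 hz2
  obtain ⟨-, j3⟩ := hc'.fans₂.abs_progression_le hrβ hrα hβ (by linarith) hα (by linarith)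
    (by omega : 0 < L) (by omega) cosα f1' f2'
  have l1 : |2 * (m + 1) * (α - β)| ≤ 100 * π / k ^ 2 := by
    rw [← hη', hη]
    refine j1.trans ?_
    calc π * 4 / L ^ 2 ≤ π * 4 / ((k : ℝ) / 5) ^ 2 := by gcongr
      _ = 100 * π / k ^ 2 := by field_simp; ring
  have l2 : 2 * π * 4 / L ≤ 40 * π / k := by
    calc 2 * π * 4 / L ≤ 2 * π * 4 / ((k : ℝ) / 5) := by gcongr
      _ = 40 * π / k := by field_simp; ring
  exact ⟨c', _, _, _, hc', c'.near_of_abs_le hk l1 (j2.trans l2) (j3.trans l2)⟩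

end

section

/-! ### The inequalities of the quadrilateral -/

/-- The difference in height of the fourth and the second corner of a corridor, in the limit and in
units of `sin (π / 2n) / k`, at the rescaled parameter point `(u, v)`, `n = m + 2`. This is an affine
function which vanishes on a side of the quadrilateral. The difference in height of the third and
the first corner is the same function at `(v, u)`. -/
noncomputable def cornerSlack (m : ℕ) (u v : ℝ) : ℝ :=
  1 - ((m : ℝ) + 2) / ((m : ℝ) + 1) * (u + v) + (u - v) / ((m : ℝ) + 1)

/-- The difference in height of the two vertices which face these corners, namely their neighbours
in the fans around the second and the fourth corner, in the limit and in the same units. -/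
noncomputable def sideSlack (m : ℕ) (u v : ℝ) : ℝ :=
  1 / (2 * cos (π / (2 * ((m : ℝ) + 2))) ^ 2) * (1 + (u - v)) - cornerSlack m u v

/-- The factor `2 (n - 1) cot (π / 2n)` of the rescaling. -/
noncomputable def scale (m : ℕ) : ℝ := 2 * ((m : ℝ) + 1) / tan (π / (2 * ((m : ℝ) + 2)))

theorem veech_tan_pos (m : ℕ) : 0 < tan (π / (2 * ((m : ℝ) + 2))) :=
  tan_pos_of_pos_of_lt_pi_div_two (veech_angle_pos m)
    (by linarith [veech_angle_le m, pi_pos])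

theorem scale_pos (m : ℕ) : 0 < scale m := by
  have := veech_tan_pos m
  rw [scale]
  positivity

/-- The affine function `cornerSlack` in terms of the deviations `ε₁`, `ε₂` from the Veech
point, as it appears in `Corridor.Gaps`. -/
theorem cornerSlack_scale (m : ℕ) {K : ℝ} (hK : 0 < K) (ε₁ ε₂ : ℝ) :
    sin (π / (2 * ((m : ℝ) + 2))) / K * cornerSlack m (scale m * K ^ 2 * ε₁) (scale m * K ^ 2 * ε₂) =
      cos (π / (2 * ((m : ℝ) + 2))) * (tan (π / (2 * ((m : ℝ) + 2))) / K -
        2 * ((m : ℝ) + 2) * K * (ε₁ + ε₂) + 2 * K * (ε₁ - ε₂)) := by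
  have h1 := veech_cos_pos m
  have h2 := veech_sin_pos m
  have h3 : (m : ℝ) + 1 ≠ 0 := by positivity
  rw [cornerSlack, scale, tan_eq_sin_div_cos]
  generalize cos (π / (2 * ((m : ℝ) + 2))) = c at *
  generalize sin (π / (2 * ((m : ℝ) + 2))) = s at *
  field_simp

theorem sideSlack_scale (m : ℕ) {K : ℝ} (hK : 0 < K) (ε₁ ε₂ : ℝ) :
    sin (π / (2 * ((m : ℝ) + 2))) / K * sideSlack m (scale m * K ^ 2 * ε₁) (scale m * K ^ 2 * ε₂) =
      1 / (2 * cos (π / (2 * ((m : ℝ) + 2)))) * (tan (π / (2 * ((m : ℝ) + 2))) / K +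
        K * (2 * ((m : ℝ) + 1) * (ε₁ - ε₂))) -
      cos (π / (2 * ((m : ℝ) + 2))) * (tan (π / (2 * ((m : ℝ) + 2))) / K -
        2 * ((m : ℝ) + 2) * K * (ε₁ + ε₂) + 2 * K * (ε₁ - ε₂)) := by
  rw [sideSlack, mul_sub, cornerSlack_scale m hK, sub_left_inj]
  have h1 := veech_cos_pos m
  have h2 := veech_sin_pos m
  rw [scale, tan_eq_sin_div_cos]
  generalize cos (π / (2 * ((m : ℝ) + 2))) = c at *
  generalize sin (π / (2 * ((m : ℝ) + 2))) = s at *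
  field_simp

variable {α β : ℝ}

/-- The vertices that bound an open corridor most closely are on their sides of the line. -/
theorem Corridor.Open.gaps_pos {m k : ℕ} {c : Corridor m k α β} (hc : c.Open) :
    0 < c.p₄' - c.p₂' ∧ 0 < c.p₃' - c.p₁' ∧
    c.p₄' - c.p₂' < sideTwo β α * (sin (β - c.y₂') + sin (β - c.y₁)) ∧
    c.p₃' - c.p₁' < sideTwo α β * (sin (α - c.y₁') + sin (α - c.y₄)) := by
  have a1 := hc.corner₁.2.1 0 (by omega)
  have a2 := hc.corner₂.2.1 0 (by omega)
  have a3 := hc.corner₃.2.1 (m + 1) (by omega)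
  have a4 := hc.corner₄.2.1 (m + 1) (by omega)
  have e1 := hc.corner₁.1
  have e2 := hc.corner₂.1
  have e3 := hc.corner₃.1
  have e4 := hc.corner₄.1
  have h4 : c.y₄' = c.y₁ + turnAngle (m + 2) β := by rw [c.y₁_eq]; ring
  have h3 : c.y₃' = c.y₄ + turnAngle (m + 2) α := by rw [c.hy₄]; ring
  rw [show -c.y₁' + (2 * (0 : ℕ) + 1) * α = α - c.y₁' by push_cast; ring] at a1
  rw [show -c.y₂' + (2 * (0 : ℕ) + 1) * β = β - c.y₂' by push_cast; ring] at a2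
  rw [show c.y₃' + (2 * (m + 1 : ℕ) + 1) * α = π - (α - c.y₄) by
    rw [h3, turnAngle]; push_cast; ring, sin_pi_sub] at a3
  rw [show c.y₄' + (2 * (m + 1 : ℕ) + 1) * β = π - (β - c.y₁) by
    rw [h4, turnAngle]; push_cast; ring, sin_pi_sub] at a4
  exact ⟨by linarith, by linarith, by linarith, by linarith⟩

/-- An error `e` in the gaps becomes an error of order `k e` in the slacks. -/
theorem Corridor.Open.slacks_ge {m k : ℕ} {c : Corridor m k α β} (hc : c.Open) (hk : 0 < k)
    {w ε₁ ε₂ e : ℝ} (hg : c.Gaps w ε₁ ε₂ e) :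
    -(2 * e * k / sin (π / (2 * ((m : ℝ) + 2)))) ≤
      cornerSlack m (scale m * k ^ 2 * ε₁) (scale m * k ^ 2 * ε₂) ∧
    -(2 * e * k / sin (π / (2 * ((m : ℝ) + 2)))) ≤
      cornerSlack m (scale m * k ^ 2 * ε₂) (scale m * k ^ 2 * ε₁) ∧
    -(2 * e * k / sin (π / (2 * ((m : ℝ) + 2)))) ≤
      sideSlack m (scale m * k ^ 2 * ε₁) (scale m * k ^ 2 * ε₂) ∧
    -(2 * e * k / sin (π / (2 * ((m : ℝ) + 2)))) ≤
      sideSlack m (scale m * k ^ 2 * ε₂) (scale m * k ^ 2 * ε₁) := by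
  have hK : (0 : ℝ) < k := by exact_mod_cast hk
  obtain ⟨h1, h2, h3, h4⟩ := hc.gaps_pos
  have hs := veech_sin_pos m
  have key : ∀ q : ℝ, -(2 * e) ≤ sin (π / (2 * ((m : ℝ) + 2))) / k * q →
      -(2 * e * k / sin (π / (2 * ((m : ℝ) + 2)))) ≤ q := by
    intro q hq
    have : sin (π / (2 * ((m : ℝ) + 2))) / k * -(2 * e * k / sin (π / (2 * ((m : ℝ) + 2)))) ≤
        sin (π / (2 * ((m : ℝ) + 2))) / k * q := by
      refine le_of_eq_of_le ?_ hq
      field_simp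
    exact le_of_mul_le_mul_left this (by positivity)
  have g1 := abs_le.mp hg.upper
  have g2 := abs_le.mp hg.lower
  have g3 := abs_le.mp hg.left
  have g4 := abs_le.mp hg.right
  have he : 0 ≤ e := (abs_nonneg _).trans hg.upper
  refine ⟨key _ ?_, key _ ?_, key _ ?_, key _ ?_⟩
  · rw [cornerSlack_scale m hK]
    linarith
  · rw [cornerSlack_scale m hK]
    linarith
  · rw [sideSlack_scale m hK]
    linarith
  · rw [sideSlack_scale m hK]
    linarith

/-- The region of slacks bounded from below is bounded: a corner slack and the side
slack at the same point bound the difference `u - v`, and then the sum is bounded from both sides. -/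
theorem exists_abs_le_of_slacks_ge (m : ℕ) {C : ℝ} (hC : 0 ≤ C) : ∃ R : ℝ, 0 ≤ R ∧ ∀ u v : ℝ,
    -C ≤ cornerSlack m u v → -C ≤ cornerSlack m v u → -C ≤ sideSlack m u v → -C ≤ sideSlack m v u →
      |u| ≤ R ∧ |v| ≤ R := by
  have hm : (0 : ℝ) ≤ m := Nat.cast_nonneg m
  obtain ⟨κ, hκ⟩ : ∃ κ, κ = 1 / (2 * cos (π / (2 * ((m : ℝ) + 2))) ^ 2) := ⟨_, rfl⟩
  have hκ0 : 1 / 2 ≤ κ := by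
    rw [hκ]
    have h1 := veech_cos_pos m
    have h2 : cos (π / (2 * ((m : ℝ) + 2))) ^ 2 ≤ 1 := cos_sq_le_one _
    gcongr
    linarith
  refine ⟨4 * C + 1 + (1 + C + κ * (2 + 4 * C)), by positivity, fun u v h1 h2 h3 h4 => ?_⟩
  rw [sideSlack, ← hκ] at h3 h4
  have e1 : cornerSlack m u v = 1 - ((m : ℝ) + 2) / ((m : ℝ) + 1) * (u + v) + (u - v) / ((m : ℝ) + 1) :=
    rfl
  have e2 : cornerSlack m v u = 1 - ((m : ℝ) + 2) / ((m : ℝ) + 1) * (u + v) - (u - v) / ((m : ℝ) + 1) := by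
    rw [cornerSlack]
    ring
  obtain ⟨T, hT⟩ : ∃ T, T = ((m : ℝ) + 2) / ((m : ℝ) + 1) * (u + v) := ⟨_, rfl⟩
  obtain ⟨F, hF⟩ : ∃ F, F = (u - v) / ((m : ℝ) + 1) := ⟨_, rfl⟩
  rw [← hT, ← hF] at e1 e2
  -- the difference of the coordinates is bounded
  have d1 : -(1 + 4 * C) ≤ u - v := by
    have : -(2 * C) ≤ κ * (1 + (u - v)) := by linarith
    by_contra h
    push Not at h
    nlinarith
  have d2 : u - v ≤ 1 + 4 * C := by
    have : -(2 * C) ≤ κ * (1 + (v - u)) := by linarith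
    by_contra h
    push Not at h
    nlinarith
  -- the sum of the coordinates, up to a factor, is bounded
  have s1 : T ≤ 1 + C := by linarith
  have s2 : -(1 + C + κ * (2 + 4 * C)) ≤ T := by
    have h5 : κ * (1 + (u - v)) + κ * (1 + (v - u)) = 2 * κ := by ring
    have : 0 ≤ κ * C := by positivity
    linarith
  have e3 : |T| ≤ 1 + C + κ * (2 + 4 * C) := by
    rw [abs_le]
    have : 0 ≤ κ * (2 + 4 * C) := by positivity
    constructor <;> linarith
  have e4 : |u + v| ≤ 1 + C + κ * (2 + 4 * C) := by
    refine le_trans ?_ e3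
    rw [hT, abs_mul, abs_of_pos (by positivity : 0 < ((m : ℝ) + 2) / ((m : ℝ) + 1))]
    refine le_mul_of_one_le_left (abs_nonneg _) ?_
    rw [le_div_iff₀ (by positivity)]
    linarith
  have e5 := abs_le.mp e4
  rw [abs_le, abs_le]
  refine ⟨⟨?_, ?_⟩, ?_, ?_⟩ <;> linarith

/-- For large `k`, a triangle with an open corridor satisfies the inequalities of the quadrilateral
up to an error of order `1 / k`. -/
theorem exists_slacks_ge (m : ℕ) : ∃ C : ℝ, 0 ≤ C ∧ ∃ k₀ : ℕ, ∀ {k : ℕ} {α β : ℝ}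
    {c : Corridor m k α β}, k₀ ≤ k → c.Open → 0 < α → 0 < β → α + β < π / 2 →
      ∃ u v : ℝ, u = scale m * k ^ 2 * (α - π / (2 * ((m : ℝ) + 2))) ∧
        v = scale m * k ^ 2 * (β - π / (2 * ((m : ℝ) + 2))) ∧
        -(C / k) ≤ cornerSlack m u v ∧ -(C / k) ≤ cornerSlack m v u ∧
        -(C / k) ≤ sideSlack m u v ∧ -(C / k) ≤ sideSlack m v u := by
  have hπ := pi_pos
  have hs := veech_sin_pos m
  have hsc := scale_pos m
  obtain ⟨C₁, hC₁, k₁, h₁⟩ := Corridor.Near.exists_gaps m (B := 1000 * π) (by positivity)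
  obtain ⟨R, hR, h₂⟩ := exists_abs_le_of_slacks_ge m
    (C := 2 * (C₁ * (1000 * π)) / sin (π / (2 * ((m : ℝ) + 2)))) (by positivity)
  obtain ⟨A, hA⟩ : ∃ A, A = R / scale m + 1 := ⟨_, rfl⟩
  have hA1 : 1 ≤ A := by
    rw [hA]
    have : 0 ≤ R / scale m := by positivity
    linarith
  obtain ⟨k₂, hk₂⟩ := exists_nat_ge A
  refine ⟨2 * (C₁ * A) / sin (π / (2 * ((m : ℝ) + 2))), by positivity,
    max (max k₁ k₂) 16, fun {k α β c} hk hc hα hβ hαβ => ?_⟩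
  have hk16 : 16 ≤ k := (le_max_right _ _).trans hk
  have hkk₁ : k₁ ≤ k := ((le_max_left _ _).trans (le_max_left _ _)).trans hk
  have hkk₂ : k₂ ≤ k := ((le_max_right _ _).trans (le_max_left _ _)).trans hk
  have hK : (0 : ℝ) < k := by exact_mod_cast (by omega : 0 < k)
  have hAk : A ≤ k := hk₂.trans (by exact_mod_cast hkk₂)
  obtain ⟨c', w, ε₁, ε₂, hc', hn⟩ := hc.exists_near hα hβ hαβ hk16
  have e1 : α - π / (2 * ((m : ℝ) + 2)) = ε₁ := by linarith [hn.hα]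
  have e2 : β - π / (2 * ((m : ℝ) + 2)) = ε₂ := by linarith [hn.hβ]
  rw [e1, e2]
  refine ⟨_, _, rfl, rfl, ?_⟩
  -- the rescaled parameters are bounded, which improves the error
  obtain ⟨b1, b2, b3, b4⟩ := hc'.slacks_ge (by omega) (h₁ c' hkk₁ hn hc'.closed)
  have e3 : 2 * (C₁ * (1000 * π / k)) * k = 2 * (C₁ * (1000 * π)) := by field_simp
  rw [e3] at b1 b2 b3 b4
  obtain ⟨r1, r2⟩ := h₂ _ _ b1 b2 b3 b4
  have small : ∀ ε, |scale m * k ^ 2 * ε| ≤ R → |ε| ≤ A / k ^ 2 := by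
    intro ε h
    rw [abs_mul, abs_of_pos (by positivity), mul_comm, ← le_div_iff₀ (by positivity)] at h
    refine h.trans ?_
    rw [hA, ← div_div]
    gcongr
    linarith
  have hn' : c'.Near w ε₁ ε₂ (1000 * π) (A / k ^ 2) := by
    refine ⟨hn.k_pos, hn.hα, hn.hβ, hn.hy₁, hn.hw, small _ r1, small _ r2, ?_, hn.hdiff, ?_⟩
    · rw [div_le_div_iff₀ (by positivity) (by positivity)]
      have := pi_gt_three
      nlinarith [mul_le_mul_of_nonneg_right hAk hK.le, sq_nonneg (k : ℝ)]
    · gcongr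
  have e4 : 2 * (C₁ * (A / k ^ 2)) * k / sin (π / (2 * ((m : ℝ) + 2))) =
      2 * (C₁ * A) / sin (π / (2 * ((m : ℝ) + 2))) / k := by field_simp
  rw [← e4]
  exact hc'.slacks_ge (by omega) (h₁ c' hkk₁ hn' hc'.closed)

end

section

/-! ### A criterion for open corridors -/

variable {α β : ℝ}

theorem sin_le_sin_of_add_le_pi {a b : ℝ} (h : a ≤ b) (h0 : 0 ≤ a + b) (hπ : a + b ≤ π)
    (hb : b - a ≤ 2 * π) : sin a ≤ sin b := by
  have h1 : 0 ≤ sin ((b - a) / 2) := sin_nonneg_of_nonneg_of_le_pi (by linarith) (by linarith)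
  have h2 : 0 ≤ cos ((b + a) / 2) := cos_nonneg_of_mem_Icc ⟨by linarith, by linarith⟩
  have h3 := sin_sub_sin b a
  have h4 : 0 ≤ 2 * sin ((b - a) / 2) * cos ((b + a) / 2) := by positivity
  linarith

/-- By concavity of the sine, a line passes a fan if it passes its first and its last inner
vertex. -/
theorem fan_of_extremes {r g y : ℝ} {m : ℕ} (hg : 0 < g) (hα : 0 ≤ α) (hr : 0 < r) (hr1 : r ≤ 1)
    (h1 : g < r * sin (y + α)) (h2 : g < r * sin (y + (2 * m + 1) * α)) (h0 : 0 ≤ y + α)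
    (hπ : y + (2 * m + 1) * α ≤ π) : Fan α r g y (m + 1) := by
  have key : ∀ a : ℝ, 1 ≤ a → a ≤ 2 * m + 1 → g < r * sin (y + a * α) := by
    intro a ha ha'
    have i1 : y + α ≤ y + a * α := by nlinarith
    have i2 : y + a * α ≤ y + (2 * m + 1) * α := by gcongr
    have := strictConcaveOn_sin_Icc.concaveOn.min_le_of_mem_Icc (x := y + α)
      (y := y + (2 * m + 1) * α) (z := y + a * α) ⟨h0, by linarith⟩ ⟨by linarith, hπ⟩ ⟨i1, i2⟩
    rcases min_le_iff.mp this with h | h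
    · exact h1.trans_le (by gcongr)
    · exact h2.trans_le (by gcongr)
  refine ⟨hg, fun l hl => key _ ?_ ?_, fun l hl hl0 => ?_⟩
  · have : (0 : ℝ) ≤ l := Nat.cast_nonneg l
    linarith
  · have : (l : ℝ) ≤ m := by exact_mod_cast Nat.lt_succ_iff.mp hl
    linarith
  · have h3 : (1 : ℝ) ≤ l := by exact_mod_cast hl0
    have h4 : (l : ℝ) ≤ m := by exact_mod_cast Nat.lt_succ_iff.mp hl
    have h5 := key (2 * l) (by linarith) (by linarith)
    have h6 : 0 < sin (y + 2 * l * α) := pos_of_mul_pos_right (hg.trans h5) hr.le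
    nlinarith

/-- The angle `y` of a long side is a little smaller than half of the turning angle, by an amount
that is large in comparison with the deviation of the triangle from the Veech point. By the `step`
inequalities the loss of height in a double step exceeds the change of the angle, by the `rate`
inequalities it exceeds the height of the short side at the end of the step. -/
structure Tilted (m : ℕ) (α β y : ℝ) : Prop where
  nonneg : 0 ≤ y
  le_one : y ≤ α
  le_two : y ≤ β
  turn_one : 2 * y ≤ turnAngle (m + 1) α
  turn_two : 2 * y ≤ turnAngle (m + 1) β
  rate_one : sideTwo α β * sin (α - y) ≤
    2 * cos (turnAngle (m + 1) β / 2) * sin (turnAngle (m + 1) β / 2 - y)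
  rate_two : sideTwo β α * sin (β - y) ≤
    2 * cos (turnAngle (m + 1) α / 2) * sin (turnAngle (m + 1) α / 2 - y)
  step_one : |turnAngle (m + 1) β - turnAngle (m + 1) α| ≤
    2 * cos (turnAngle (m + 1) β / 2) * sin (turnAngle (m + 1) β / 2 - y)
  step_two : |turnAngle (m + 1) β - turnAngle (m + 1) α| ≤
    2 * cos (turnAngle (m + 1) α / 2) * sin (turnAngle (m + 1) α / 2 - y)

theorem Tilted.symm {m : ℕ} {y : ℝ} (h : Tilted m α β y) : Tilted m β α y :=
  ⟨h.nonneg, h.le_two, h.le_one, h.turn_two, h.turn_one, h.rate_two, h.rate_one,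
    by rw [abs_sub_comm]; exact h.step_two, by rw [abs_sub_comm]; exact h.step_one⟩

/-- The shape of a triangle near the Veech point. -/
structure ShortSides (α β : ℝ) : Prop where
  one_pos : 0 < α
  two_pos : 0 < β
  sum_lt : α + β < π / 2
  side_one : 0 < sideTwo α β
  side_two : 0 < sideTwo β α
  side_one_le : sideTwo α β ≤ 1
  side_two_le : sideTwo β α ≤ 1

theorem ShortSides.symm (h : ShortSides α β) : ShortSides β α :=
  ⟨h.two_pos, h.one_pos, by linarith [h.sum_lt], h.side_two, h.side_one, h.side_two_le,
    h.side_one_le⟩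

theorem ShortSides.sin_ne (h : ShortSides α β) : sin (α + β) ≠ 0 :=
  (sin_pos_of_pos_of_lt_pi (by linarith [h.one_pos, h.two_pos])
    (by linarith [h.sum_lt, pi_pos])).ne'

theorem ShortSides.identity (h : ShortSides α β) (y : ℝ) :
    sideTwo α β * sin (y + α) = sin y + sideTwo β α * sin (β - y) := by
  have := side_identity h.sin_ne y
  rw [← neg_sub β y, sin_neg] at this
  linarith

/-- In a zigzag of tilted long sides the heights decrease, and the line passes all fans if it
passes the first and the last vertex. -/
theorem zigFans_of_tilted {m : ℕ} {y p : ℝ} {K : ℕ} (h : ShortSides α β)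
    (hy : ∀ j : ℕ, j ≤ K → Tilted m α β (y + j * (turnAngle (m + 1) β - turnAngle (m + 1) α)))
    (hstart : p < sideTwo α β * sin (y + α))
    (hend : 0 < zigHeight (turnAngle (m + 1) α) (turnAngle (m + 1) β) y p K +
      sideTwo α β * sin (α - (y + K * (turnAngle (m + 1) β - turnAngle (m + 1) α)))) :
    ZigFans (m + 1) α (sideTwo α β) β (sideTwo β α) y p K := by
  have hα := h.one_pos
  have hβ := h.two_pos
  have hr := h.side_one
  have hs := h.side_two
  have hsum := h.sum_lt
  have succ : ∀ j : ℕ, zigHeight (turnAngle (m + 1) α) (turnAngle (m + 1) β) y p j =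
      zigHeight (turnAngle (m + 1) α) (turnAngle (m + 1) β) y p (j + 1) +
      2 * cos (turnAngle (m + 1) β / 2) * sin (turnAngle (m + 1) β / 2 -
        (y + (j + 1 : ℕ) * (turnAngle (m + 1) β - turnAngle (m + 1) α))) := by
    intro j
    rw [zigHeight_succ, show turnAngle (m + 1) β / 2 -
      (y + (j + 1 : ℕ) * (turnAngle (m + 1) β - turnAngle (m + 1) α)) =
      -(y + j * (turnAngle (m + 1) β - turnAngle (m + 1) α) - turnAngle (m + 1) α +
        turnAngle (m + 1) β / 2) by push_cast; ring, sin_neg]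
    ring
  have hlast : ∀ j : ℕ, j < K →
      0 < zigHeight (turnAngle (m + 1) α) (turnAngle (m + 1) β) y p j := by
    intro j hj
    obtain ⟨d, rfl⟩ := Nat.exists_eq_add_of_lt hj
    clear hj
    induction d generalizing j with
    | zero =>
      rw [succ j]
      have := (hy (j + 1) le_rfl).rate_one
      rw [add_zero] at hend
      linarith
    | succ d ih =>
      have e : j + (d + 1) + 1 = (j + 1) + d + 1 := by ring
      have h1 := ih (j + 1) (by rwa [← e]) (by rwa [← e])
      have h2 := (abs_nonneg _).trans (hy (j + 1) (by omega)).step_one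
      rw [succ j]
      linarith
  have hfirst : ∀ j : ℕ, j ≤ K → zigHeight (turnAngle (m + 1) α) (turnAngle (m + 1) β) y p j <
      sideTwo α β * sin (y + j * (turnAngle (m + 1) β - turnAngle (m + 1) α) + α) := by
    intro j hj
    induction j with
    | zero => simpa [zigHeight] using hstart
    | succ j ih =>
      have h1 := ih (by omega)
      have h2 := (hy (j + 1) hj).step_one
      rw [succ j] at h1
      have h3 := abs_le.mp (abs_sin_sub_sin_le
        (y + j * (turnAngle (m + 1) β - turnAngle (m + 1) α) + α)
        (y + (j + 1 : ℕ) * (turnAngle (m + 1) β - turnAngle (m + 1) α) + α))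
      rw [show y + j * (turnAngle (m + 1) β - turnAngle (m + 1) α) + α -
        (y + (j + 1 : ℕ) * (turnAngle (m + 1) β - turnAngle (m + 1) α) + α) =
        -(turnAngle (m + 1) β - turnAngle (m + 1) α) by push_cast; ring, abs_neg] at h3
      have h4 := h.side_one_le
      have h5 : sideTwo α β * (sin (y + j * (turnAngle (m + 1) β - turnAngle (m + 1) α) + α) -
          sin (y + (j + 1 : ℕ) * (turnAngle (m + 1) β - turnAngle (m + 1) α) + α)) ≤
          1 * |turnAngle (m + 1) β - turnAngle (m + 1) α| :=
        (mul_le_mul_of_nonneg_left h3.2 hr.le).trans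
          (mul_le_mul_of_nonneg_right h4 (abs_nonneg _))
      linarith
  intro j hj
  have t := hy j hj.le
  have t' := hy (j + 1) hj
  have f1 := hfirst j hj.le
  have f2 := hlast j hj
  have f3 : 0 < zigHeight (turnAngle (m + 1) α) (turnAngle (m + 1) β) y p (j + 1) +
      sideTwo α β * sin (α - (y + (j + 1 : ℕ) *
        (turnAngle (m + 1) β - turnAngle (m + 1) α))) := by
    rcases Nat.lt_or_ge (j + 1) K with h1 | h1
    · have h2 := hlast (j + 1) h1
      have h3 : 0 ≤ sin (α - (y + (j + 1 : ℕ) * (turnAngle (m + 1) β - turnAngle (m + 1) α))) :=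
        sin_nonneg_of_nonneg_of_le_pi (by linarith [t'.le_one])
          (by linarith [t'.nonneg, pi_pos])
      have : 0 ≤ sideTwo α β * sin (α - (y + (j + 1 : ℕ) *
        (turnAngle (m + 1) β - turnAngle (m + 1) α))) := by positivity
      linarith
    · obtain rfl : j + 1 = K := by omega
      exact hend
  have z1 := succ j
  rw [show (y + (j + 1 : ℕ) * (turnAngle (m + 1) β - turnAngle (m + 1) α)) =
    y + j * (turnAngle (m + 1) β - turnAngle (m + 1) α) +
      (turnAngle (m + 1) β - turnAngle (m + 1) α) by push_cast; ring] at f3 z1 t'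
  generalize zigHeight (turnAngle (m + 1) α) (turnAngle (m + 1) β) y p (j + 1) = H' at *
  generalize zigHeight (turnAngle (m + 1) α) (turnAngle (m + 1) β) y p j = H at *
  generalize y + j * (turnAngle (m + 1) β - turnAngle (m + 1) α) = Y at *
  have tn := t.nonneg
  have tn' := t'.nonneg
  have ta := t.turn_one
  have ta' := t'.turn_two
  have tr := t.rate_two
  have tl := t.le_two
  have hm : (0 : ℝ) ≤ m := Nat.cast_nonneg m
  have eθ : (2 * (m : ℝ) + 1) * α = π - turnAngle (m + 1) α - α := by
    rw [turnAngle]; push_cast; ring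
  have eθ' : (2 * (m : ℝ) + 1) * β = π - turnAngle (m + 1) β - β := by
    rw [turnAngle]; push_cast; ring
  clear hy hstart hend succ hlast hfirst
  generalize turnAngle (m + 1) α = θ at *
  generalize turnAngle (m + 1) β = θ' at *
  have lθ : θ + 2 * α ≤ π := by
    have : 0 ≤ m * α := by positivity
    linarith
  have lθ' : θ' + 2 * β ≤ π := by
    have : 0 ≤ m * β := by positivity
    linarith
  have hπ := pi_pos
  -- the last vertex of the upper fan
  have g1 : sin (Y + α) ≤ sin (θ + α - Y) :=
    sin_le_sin_of_add_le_pi (by linarith) (by linarith) (by linarith) (by linarith)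
  have e1 : Y + (2 * m + 1) * α = π - (θ + α - Y) := by rw [eθ]; ring
  -- the centre of the lower fan
  have g2 : H + sin (Y - θ) < 0 := by
    have h1 := h.identity Y
    have h2 : sin (θ - Y) - sin Y = 2 * cos (θ / 2) * sin (θ / 2 - Y) := by
      rw [sin_sub_sin, show (θ - Y - Y) / 2 = θ / 2 - Y by ring,
        show (θ - Y + Y) / 2 = θ / 2 by ring]
      ring
    have h3 : sin (Y - θ) = -sin (θ - Y) := by rw [← sin_neg, neg_sub]
    linarith
  -- the vertices of the lower fan
  have g3 : sin (Y + (θ' - θ) + β) ≤ sin (θ - Y + β) :=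
    sin_le_sin_of_add_le_pi (by linarith) (by linarith) (by linarith) (by linarith)
  have e3 : θ - Y + (2 * m + 1) * β = π - (Y + (θ' - θ) + β) := by rw [eθ']; ring
  have g4 : -(H + sin (Y - θ)) < sideTwo β α * sin (Y + (θ' - θ) + β) := by
    have h1 := h.symm.identity (Y + (θ' - θ))
    have h2 : sin (Y + (θ' - θ)) + sin (Y - θ) =
        -(2 * cos (θ' / 2) * sin (θ' / 2 - (Y + (θ' - θ)))) := by
      have h3 := sin_sub_sin (Y + (θ' - θ)) (θ - Y)
      rw [show (Y + (θ' - θ) - (θ - Y)) / 2 = -(θ' / 2 - (Y + (θ' - θ))) by ring,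
        show (Y + (θ' - θ) + (θ - Y)) / 2 = θ' / 2 by ring, sin_neg] at h3
      have h4 : sin (Y - θ) = -sin (θ - Y) := by rw [← sin_neg, neg_sub]
      linarith
    linarith
  refine ⟨fan_of_extremes f2 hα.le hr h.side_one_le f1 ?_ (by linarith) (by rw [e1]; linarith),
    fan_of_extremes (by linarith) hβ.le hs h.side_two_le ?_ ?_ (by linarith)
      (by rw [e3]; linarith)⟩
  · rw [e1, sin_pi_sub]
    exact f1.trans_le (by gcongr)
  · exact g4.trans_le (by gcongr)
  · rw [e3, sin_pi_sub]
    exact g4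

/-- At a corner only the first inner vertex of the fan matters. -/
theorem fan_of_corner {m : ℕ} {y y' g : ℝ} (h : ShortSides α β) (hy : 0 ≤ y) (hy' : 0 ≤ y')
    (hα : y ≤ α) (e : y' = y + turnAngle (m + 2) α) (hg : 0 < g)
    (hgr : g < sideTwo α β * sin (α - y)) : Fan α (sideTwo α β) g (-y) (m + 2) := by
  have hπ := pi_pos
  have hα0 := h.one_pos
  have hr := h.side_one
  have hm : (0 : ℝ) ≤ m * α := by positivity
  have e1 : -y + (2 * (m + 1 : ℕ) + 1) * α = π - (y' + α) := by
    rw [e, turnAngle]; push_cast; ring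
  have e2 : y' - y = π - 2 * (m * α + 2 * α) := by rw [e, turnAngle]; push_cast; ring
  refine fan_of_extremes hg hα0.le hr h.side_one_le ?_ ?_ (by linarith) (by rw [e1]; linarith)
  · rwa [neg_add_eq_sub]
  · rw [e1, sin_pi_sub]
    refine hgr.trans_le ?_
    gcongr
    exact sin_le_sin_of_add_le_pi (by linarith) (by linarith) (by linarith)
      (by linarith [h.sum_lt, h.two_pos])

/-- The fan at a corner, traversed in the other direction. -/
theorem fan_of_corner' {m : ℕ} {y y' g : ℝ} (h : ShortSides α β) (hy : 0 ≤ y) (hy' : 0 ≤ y')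
    (hα : y ≤ α) (e : y' = y + turnAngle (m + 2) α) (hg : 0 < g)
    (hgr : g < sideTwo α β * sin (α - y)) : Fan α (sideTwo α β) g y' (m + 2) := by
  have hπ := pi_pos
  have hα0 := h.one_pos
  have hr := h.side_one
  have hm : (0 : ℝ) ≤ m * α := by positivity
  have e1 : y' + (2 * (m + 1 : ℕ) + 1) * α = π - (α - y) := by
    rw [e, turnAngle]; push_cast; ring
  have e2 : y' - y = π - 2 * (m * α + 2 * α) := by rw [e, turnAngle]; push_cast; ring
  refine fan_of_extremes hg hα0.le hr h.side_one_le ?_ ?_ (by linarith) (by rw [e1]; linarith)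
  · refine hgr.trans_le ?_
    gcongr
    exact sin_le_sin_of_add_le_pi (by linarith) (by linarith) (by linarith)
      (by linarith [h.sum_lt, h.two_pos])
  · rwa [e1, sin_pi_sub]

/-- A corridor of tilted long sides is open if its eight extreme vertices are on their sides of
the line. -/
theorem Corridor.open_of_tilted {m k : ℕ} {c : Corridor m k α β} (h : ShortSides α β)
    (t₁ : ∀ j : ℕ, j ≤ k + 2 →
      Tilted m α β (c.y₁ + j * (turnAngle (m + 1) β - turnAngle (m + 1) α)))
    (t₂ : ∀ j : ℕ, j ≤ k + 1 →
      Tilted m β α (c.y₂ + j * (turnAngle (m + 1) α - turnAngle (m + 1) β)))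
    (t₃ : ∀ j : ℕ, j ≤ k →
      Tilted m α β (c.y₃ + j * (turnAngle (m + 1) β - turnAngle (m + 1) α)))
    (t₄ : ∀ j : ℕ, j ≤ k + 1 →
      Tilted m β α (c.y₄ + j * (turnAngle (m + 1) α - turnAngle (m + 1) β)))
    (closed : c.p₄' + sin c.y₁ = c.p₁) (h₁ : c.p₁' < 0) (h₂ : c.p₂' < 0) (h₃ : 0 < c.p₃')
    (h₄ : 0 < c.p₄') (l₁ : 0 < c.p₁' + sideTwo α β * sin (α - c.y₁'))
    (l₂ : 0 < c.p₂' + sideTwo β α * sin (β - c.y₂'))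
    (r₃ : c.p₃' < sideTwo α β * sin (α - c.y₄)) (r₄ : c.p₄' < sideTwo β α * sin (β - c.y₁)) :
    c.Open := by
  have hπ := pi_pos
  have T₁ := t₁ 0 (by omega)
  have T₁' := t₁ (k + 2) le_rfl
  have T₂ := t₂ 0 (by omega)
  have T₂' := t₂ (k + 1) le_rfl
  have T₃ := t₃ 0 (by omega)
  have T₃' := t₃ k le_rfl
  have T₄ := t₄ 0 (by omega)
  have T₄' := t₄ (k + 1) le_rfl
  rw [Nat.cast_zero, zero_mul, add_zero] at T₁ T₂ T₃ T₄
  rw [← c.hy₁'] at T₁'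
  rw [← c.hy₂'] at T₂'
  rw [← c.hy₃'] at T₃'
  rw [← c.hy₄'] at T₄'
  have pos : ∀ {y}, Tilted m α β y → 0 ≤ sideTwo α β * sin (α - y) := fun {y} t =>
    mul_nonneg h.side_one.le (sin_nonneg_of_nonneg_of_le_pi (by linarith [t.le_one])
      (by linarith [t.nonneg, h.sum_lt, h.two_pos]))
  have pos' : ∀ {y}, Tilted m α β y → 0 ≤ sideTwo β α * sin (β - y) := fun {y} t =>
    mul_nonneg h.side_two.le (sin_nonneg_of_nonneg_of_le_pi (by linarith [t.le_two])
      (by linarith [t.nonneg, h.sum_lt, h.one_pos]))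
  refine ⟨?_, ?_, ?_, ?_, ?_, ?_, ?_, ?_, closed⟩
  · refine zigFans_of_tilted h t₁ ?_ ?_
    · rw [h.identity]
      linarith
    · rw [← c.hp₁', ← c.hy₁']
      exact l₁
  · exact fan_of_corner h T₁'.nonneg T₂.nonneg T₁'.le_one c.hy₂ (by linarith) (by linarith)
  · refine zigFans_of_tilted h.symm t₂ ?_ ?_
    · rw [h.symm.identity, c.hp₂]
      linarith [pos T₂.symm]
    · rw [← c.hp₂', ← c.hy₂']
      exact l₂
  · exact fan_of_corner h.symm T₂'.nonneg T₃.nonneg T₂'.le_one c.hy₃ (by linarith) (by linarith)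
  · refine zigFans_of_tilted h t₃ ?_ ?_
    · rw [h.identity, c.hp₃]
      linarith [pos' T₃]
    · rw [← c.hp₃', ← c.hy₃']
      linarith [pos T₃']
  · exact fan_of_corner' h T₄.nonneg T₃'.nonneg T₄.le_two (by rw [c.hy₄]; ring) h₃ r₃
  · refine zigFans_of_tilted h.symm t₄ ?_ ?_
    · rw [h.symm.identity, c.hp₄]
      linarith
    · rw [← c.hp₄', ← c.hy₄']
      linarith [pos' T₄'.symm]
  · exact fan_of_corner' h.symm T₁.nonneg T₄'.nonneg T₁.le_two (by rw [c.y₁_eq]; ring) h₄ r₄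

end

section

/-! ### Existence of open corridors -/

variable {α β : ℝ}

theorem veech_cos_ge (m : ℕ) : 7 / 10 ≤ cos (π / (2 * ((m : ℝ) + 2))) := by
  have h1 : cos (π / 4) ≤ cos (π / (2 * ((m : ℝ) + 2))) :=
    cos_le_cos_of_nonneg_of_le_pi (veech_angle_pos m).le (by linarith [pi_pos]) (veech_angle_le m)
  rw [cos_pi_div_four] at h1
  have h2 : (7 / 5 : ℝ) ≤ √2 := by
    rw [le_sqrt' (by norm_num)]
    norm_num
  linarith

/-- The two rate inequalities of `Tilted`, for one end of the long side. -/
theorem rates_of_near {M x d ε ε' E r : ℝ} (hM : 0 ≤ M) (hx : 7 / 10 ≤ cos x)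
    (hε : |ε| ≤ E) (hε' : |ε'| ≤ E) (hd : 20 * (M + 1) * E ≤ d) (hd0 : 0 < d) (hd1 : d ≤ 1 / 4)
    (hr : 0 ≤ r) (hr1 : r ≤ 1) :
    r * sin (d + ε) ≤ 2 * cos (x - M * ε') * sin (d - M * ε') ∧
    2 * (M * (2 * E)) ≤ 2 * cos (x - M * ε') * sin (d - M * ε') := by
  have hE : 0 ≤ E := (abs_nonneg _).trans hε
  obtain ⟨a1, a2⟩ := abs_le.mp hε
  have hMε : |M * ε'| ≤ M * E := by
    rw [abs_mul, abs_of_nonneg hM]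
    gcongr
  obtain ⟨a3, a4⟩ := abs_le.mp hMε
  have hME : 0 ≤ M * E := by positivity
  have c1 : 13 / 10 ≤ 2 * cos (x - M * ε') := by
    have h1 := abs_cos_sub_cos_le (x - M * ε') x
    rw [show x - M * ε' - x = -(M * ε') by ring, abs_neg] at h1
    have := (abs_le.mp h1).1
    linarith
  have d1 : 0 < d - M * ε' := by linarith
  have d2 : d - M * ε' ≤ 1 / 2 := by linarith
  have s1 : 12 / 13 * (d - M * ε') ≤ sin (d - M * ε') := by
    have h1 := sin_gt_sub_cube d1
    have h2 : (d - M * ε') ^ 3 ≤ (1 / 2) ^ 2 * (d - M * ε') := by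
      rw [pow_succ]
      gcongr
    linarith
  have p1 : 6 / 5 * (d - M * ε') ≤ 2 * cos (x - M * ε') * sin (d - M * ε') := by
    calc 6 / 5 * (d - M * ε') = 13 / 10 * (12 / 13 * (d - M * ε')) := by ring
      _ ≤ _ := by gcongr
  have s2 : r * sin (d + ε) ≤ d + ε := by
    have h1 : 0 ≤ d + ε := by linarith
    have h2 := sin_le h1
    have h3 : r * sin (d + ε) ≤ r * (d + ε) := by gcongr
    have h4 : r * (d + ε) ≤ 1 * (d + ε) := by gcongr
    linarith
  constructor <;> linarith

/-- A long side is tilted if it deviates by `d` from the Veech angle and `d` is large in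
comparison with the deviation `E` of the triangle. -/
theorem tilted_of_near {m : ℕ} {d ε₁ ε₂ E : ℝ} (h₁ : |ε₁| ≤ E) (h₂ : |ε₂| ≤ E)
    (hd : 20 * ((m : ℝ) + 2) * E ≤ d) (hd0 : 0 < d) (hd1 : d ≤ 1 / 4)
    (hdx : d ≤ π / (2 * ((m : ℝ) + 2)))
    (h : ShortSides (π / (2 * ((m : ℝ) + 2)) + ε₁) (π / (2 * ((m : ℝ) + 2)) + ε₂)) :
    Tilted m (π / (2 * ((m : ℝ) + 2)) + ε₁) (π / (2 * ((m : ℝ) + 2)) + ε₂)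
      (π / (2 * ((m : ℝ) + 2)) - d) := by
  have hc := veech_cos_ge m
  have e := turnAngle_near m
  have ha := h.side_one
  have hb := h.side_two
  have ha1 := h.side_one_le
  have hb1 := h.side_two_le
  have hm : (0 : ℝ) ≤ m := Nat.cast_nonneg m
  have hE : 0 ≤ E := (abs_nonneg _).trans h₁
  have hmE : 0 ≤ m * E := by positivity
  have hd' : 20 * (((m : ℝ) + 1) + 1) * E ≤ d := by linarith
  obtain ⟨r1, r2⟩ := rates_of_near (M := (m : ℝ) + 1) (by positivity) hc h₁ h₂ hd' hd0 hd1 ha.le ha1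
  obtain ⟨r3, r4⟩ := rates_of_near (M := (m : ℝ) + 1) (by positivity) hc h₂ h₁ hd' hd0 hd1 hb.le hb1
  obtain ⟨a1, a2⟩ := abs_le.mp h₁
  obtain ⟨a3, a4⟩ := abs_le.mp h₂
  have bound : ∀ ε, |ε| ≤ E → ((m : ℝ) + 1) * ε ≤ d := fun ε hε => by
    have : ((m : ℝ) + 1) * ε ≤ (m + 1) * E := by
      gcongr
      exact (le_abs_self _).trans hε
    linarith
  have b1 := bound _ h₁
  have b2 := bound _ h₂
  have hη : |2 * (π / (2 * ((m : ℝ) + 2))) - 2 * (m + 1) * ε₂ -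
      (2 * (π / (2 * ((m : ℝ) + 2))) - 2 * (m + 1) * ε₁)| ≤ 2 * ((m + 1) * (2 * E)) := by
    rw [show 2 * (π / (2 * ((m : ℝ) + 2))) - 2 * (m + 1) * ε₂ -
      (2 * (π / (2 * ((m : ℝ) + 2))) - 2 * (m + 1) * ε₁) = (2 * (m + 1)) * (ε₁ - ε₂) by ring,
      abs_mul, abs_of_nonneg (by positivity : (0 : ℝ) ≤ 2 * (m + 1)), mul_assoc]
    gcongr
    exact (abs_sub _ _).trans (by linarith)
  refine ⟨by linarith, by linarith, by linarith, ?_, ?_, ?_, ?_, ?_, ?_⟩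
  all_goals simp only [e]
  · linarith
  · linarith
  · refine le_of_eq_of_le ?_ (r1.trans_eq ?_)
    · ring_nf
    · ring_nf
  · refine le_of_eq_of_le ?_ (r3.trans_eq ?_)
    · ring_nf
    · ring_nf
  · refine hη.trans (r2.trans_eq ?_)
    ring_nf
  · refine hη.trans (r4.trans_eq ?_)
    ring_nf

/-- For `n ≥ 3` the Veech triangle is obtuse, with short sides of length less than `1`.
This fails for `n = 2`, where its angle sum `α + β` is `π / 2`. -/
theorem shortSides_of_near {m : ℕ} (hm : 1 ≤ m) : ∃ E₀ : ℝ, 0 < E₀ ∧ ∀ ε₁ ε₂ : ℝ, |ε₁| ≤ E₀ →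
    |ε₂| ≤ E₀ →
    ShortSides (π / (2 * ((m : ℝ) + 2)) + ε₁) (π / (2 * ((m : ℝ) + 2)) + ε₂) := by
  obtain ⟨x, hx⟩ : ∃ x, x = π / (2 * ((m : ℝ) + 2)) := ⟨_, rfl⟩
  have hcos : 0 < cos x := hx ▸ veech_cos_pos m
  have hcos' : 7 / 10 ≤ cos x := hx ▸ veech_cos_ge m
  have hsin : 0 < sin x := hx ▸ veech_sin_pos m
  have hx0 : 0 < x := hx ▸ veech_angle_pos m
  have hx1 : x ≤ π / 6 := by
    have : (1 : ℝ) ≤ m := by exact_mod_cast hm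
    rw [hx]
    have := pi_pos
    gcongr
    linarith
  obtain ⟨E₀, hE₀, h1, h2, h3⟩ : ∃ E₀ : ℝ, 0 < E₀ ∧ E₀ ≤ x / 4 ∧ E₀ ≤ sin x * cos x / 2 ∧
      2 / (sin x * cos x ^ 2) * E₀ ≤ 1 / 5 := by
    refine ⟨min (x / 4) (min (sin x * cos x / 2) (sin x * cos x ^ 2 / 10)), by positivity,
      min_le_left _ _, (min_le_right _ _).trans (min_le_left _ _), ?_⟩
    have : min (x / 4) (min (sin x * cos x / 2) (sin x * cos x ^ 2 / 10)) ≤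
      sin x * cos x ^ 2 / 10 := (min_le_right _ _).trans (min_le_right _ _)
    calc _ ≤ 2 / (sin x * cos x ^ 2) * (sin x * cos x ^ 2 / 10) := by gcongr
      _ = 1 / 5 := by field_simp; norm_num
  have side : ∀ ε₁ ε₂ : ℝ, |ε₁| ≤ E₀ → |ε₂| ≤ E₀ →
      0 < sideTwo (x + ε₁) (x + ε₂) ∧ sideTwo (x + ε₁) (x + ε₂) ≤ 1 := by
    intro ε₁ ε₂ h₁ h₂
    have := abs_le.mp ((abs_sideTwo_sub_le hcos hsin h₁ h₂ (by linarith)).trans h3)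
    have i1 : 1 / (2 * cos x) ≤ 5 / 7 := by
      rw [div_le_div_iff₀ (by positivity) (by norm_num)]
      linarith
    have i2 : 1 / 2 ≤ 1 / (2 * cos x) := by
      rw [div_le_div_iff₀ (by norm_num) (by positivity)]
      linarith [cos_le_one x]
    constructor <;> linarith
  refine ⟨E₀, hE₀, fun ε₁ ε₂ h₁ h₂ => ?_⟩
  rw [← hx]
  have a1 := abs_le.mp h₁
  have a2 := abs_le.mp h₂
  obtain ⟨b1, b2⟩ := side _ _ h₁ h₂
  obtain ⟨b3, b4⟩ := side _ _ h₂ h₁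
  exact ⟨by linarith, by linarith, by linarith, b1, b3, b2, b4⟩

theorem continuous_zigHeight {f g : ℝ → ℝ} (hf : Continuous f) (hg : Continuous g)
    (θ θ' : ℝ) (j : ℕ) : Continuous fun y => zigHeight θ θ' (f y) (g y) j := by
  induction j with
  | zero => exact hg
  | succ j ih =>
    simp only [TriangularBilliards.zigHeight]
    fun_prop

/-- The corridors with a given first height depend continuously on the first angle. -/
theorem exists_continuous_corridor (m k : ℕ) (α β : ℝ) : ∃ c : ℝ → Corridor m k α β,
    (∀ y, (c y).y₁ = y ∧ (c y).p₁ = 0) ∧ Continuous fun y => (c y).p₄' := by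
  choose c hy hp using fun y => exists_corridor m k α β y 0
  refine ⟨c, fun y => ⟨hy y, hp y⟩, ?_⟩
  have y1 : Continuous fun y => (c y).y₁' := by simp only [(c _).hy₁', hy]; fun_prop
  have p1 : Continuous fun y => (c y).p₁' := by
    simp only [(c _).hp₁', hy, hp]
    exact continuous_zigHeight continuous_id continuous_const _ _ _
  have y2 : Continuous fun y => (c y).y₂ := by simp only [(c _).hy₂]; fun_prop
  have p2 : Continuous fun y => (c y).p₂ := by simp only [(c _).hp₂]; fun_prop
  have y2' : Continuous fun y => (c y).y₂' := by simp only [(c _).hy₂']; fun_prop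
  have p2' : Continuous fun y => (c y).p₂' := by
    simp only [(c _).hp₂']
    exact continuous_zigHeight y2 p2 _ _ _
  have y3 : Continuous fun y => (c y).y₃ := by simp only [(c _).hy₃]; fun_prop
  have p3 : Continuous fun y => (c y).p₃ := by simp only [(c _).hp₃]; fun_prop
  have y3' : Continuous fun y => (c y).y₃' := by simp only [(c _).hy₃']; fun_prop
  have p3' : Continuous fun y => (c y).p₃' := by
    simp only [(c _).hp₃']
    exact continuous_zigHeight y3 p3 _ _ _
  have y4 : Continuous fun y => (c y).y₄ := by simp only [(c _).hy₄]; fun_prop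
  have p4 : Continuous fun y => (c y).p₄ := by simp only [(c _).hp₄]; fun_prop
  simp only [(c _).hp₄']
  exact continuous_zigHeight y4 p4 _ _ _

/-- All heights of a corridor may be shifted by the same amount. -/
theorem Corridor.exists_translate {m k : ℕ} (c : Corridor m k α β) (d : ℝ) :
    ∃ c' : Corridor m k α β, (c'.y₁ = c.y₁ ∧ c'.y₁' = c.y₁' ∧ c'.y₂ = c.y₂ ∧ c'.y₂' = c.y₂' ∧
      c'.y₃ = c.y₃ ∧ c'.y₃' = c.y₃' ∧ c'.y₄ = c.y₄ ∧ c'.y₄' = c.y₄') ∧ c'.p₁ = c.p₁ + d ∧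
      c'.p₁' = c.p₁' + d ∧ c'.p₂' = c.p₂' + d ∧ c'.p₃' = c.p₃' + d ∧ c'.p₄' = c.p₄' + d := by
  refine ⟨⟨c.y₁, c.y₁', c.y₂, c.y₂', c.y₃, c.y₃', c.y₄, c.y₄', c.p₁ + d, c.p₁' + d, c.p₂ + d,
    c.p₂' + d, c.p₃ + d, c.p₃' + d, c.p₄ + d, c.p₄' + d, c.hy₁', ?_, c.hy₂, ?_, c.hy₂', ?_, c.hy₃,
    ?_, c.hy₃', ?_, c.hy₄, ?_, c.hy₄', ?_⟩, ⟨rfl, rfl, rfl, rfl, rfl, rfl, rfl, rfl⟩, rfl, rfl, rfl,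
    rfl, rfl⟩
  · rw [zigHeight_add, ← c.hp₁']
  · rw [c.hp₂]; ring
  · rw [zigHeight_add, ← c.hp₂']
  · rw [c.hp₃]; ring
  · rw [zigHeight_add, ← c.hp₃']
  · rw [c.hp₄]; ring
  · rw [zigHeight_add, ← c.hp₄']

/-- Near the Veech point there are closed corridors, by the intermediate value theorem: the
defect of closing is almost linear in the first angle. -/
theorem exists_closed_corridor (m : ℕ) {A : ℝ} (hA : 1 ≤ A) : ∃ B : ℝ, A ≤ B ∧ ∃ k₀ : ℕ,
    ∀ {k : ℕ} {ε₁ ε₂ : ℝ}, k₀ ≤ k → |ε₁| ≤ A / k ^ 2 → |ε₂| ≤ A / k ^ 2 →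
      ∃ (c : Corridor m k (π / (2 * ((m : ℝ) + 2)) + ε₁) (π / (2 * ((m : ℝ) + 2)) + ε₂)) (w : ℝ),
        c.Near w ε₁ ε₂ B (A / k ^ 2) ∧ c.p₄' + sin c.y₁ = c.p₁ := by
  have hm : (0 : ℝ) ≤ m := Nat.cast_nonneg m
  have hcos := veech_cos_pos m
  have htan := veech_tan_pos m
  obtain ⟨P, hP⟩ : ∃ P, P = 4 * ((m : ℝ) + 1) * A + tan (π / (2 * ((m : ℝ) + 2))) := ⟨_, rfl⟩
  have hP0 : 0 ≤ P := by rw [hP]; positivity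
  obtain ⟨B, hB⟩ : ∃ B, B = P + A := ⟨_, rfl⟩
  have hB0 : 0 < B := by linarith
  have hQ0 : 0 ≤ Corridor.Near.quarterConst m B := by
    rw [Corridor.Near.quarterConst]
    positivity
  obtain ⟨C, hC⟩ : ∃ C, C = 4 * Corridor.Near.quarterConst m B + 12 * B + 136 * (m + 2) :=
    ⟨_, rfl⟩
  have hC0 : 0 ≤ C := by rw [hC]; positivity
  obtain ⟨k₀, hk₀⟩ := exists_nat_ge
    (max ((8 * ((m : ℝ) + 2) + 4) * B) (C * A / (4 * cos (π / (2 * ((m : ℝ) + 2))) * B)))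
  refine ⟨B, by linarith, k₀ + 1, fun {k ε₁ ε₂} hk h₁ h₂ => ?_⟩
  have hkk : max ((8 * ((m : ℝ) + 2) + 4) * B) (C * A / (4 * cos (π / (2 * ((m : ℝ) + 2))) * B)) ≤ k :=
    hk₀.trans (by exact_mod_cast (by omega))
  have hk1 : (1 : ℝ) ≤ k := by exact_mod_cast (by omega)
  have hη : |2 * ((m : ℝ) + 1) * (ε₁ - ε₂)| ≤ 4 * ((m : ℝ) + 1) * A / k ^ 2 := by
    rw [abs_mul, abs_of_nonneg (by positivity)]
    calc 2 * ((m : ℝ) + 1) * |ε₁ - ε₂| ≤ 2 * ((m : ℝ) + 1) * (A / k ^ 2 + A / k ^ 2) := by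
          gcongr
          exact (abs_sub _ _).trans (add_le_add h₁ h₂)
      _ = 4 * ((m : ℝ) + 1) * A / k ^ 2 := by ring
  obtain ⟨c, hc, hcont⟩ := exists_continuous_corridor m k (π / (2 * ((m : ℝ) + 2)) + ε₁)
    (π / (2 * ((m : ℝ) + 2)) + ε₂)
  have near : ∀ w, |w| ≤ B / k →
      (c (π / (2 * ((m : ℝ) + 2)) + w)).Near w ε₁ ε₂ B (A / k ^ 2) := by
    intro w hw
    refine ⟨by omega, rfl, rfl, (hc _).1, hw, h₁, h₂, ?_, hη.trans ?_, ?_⟩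
    · gcongr
      · linarith
      · nlinarith
    · gcongr
      linarith
    · gcongr
  -- at the ends of the interval the defect of closing has opposite signs
  have sign : ∀ s : ℝ, |s| = 1 → 0 ≤ s * ((c (π / (2 * ((m : ℝ) + 2)) + s * (B / k))).p₄' +
      sin (π / (2 * ((m : ℝ) + 2)) + s * (B / k))) := by
    intro s hs
    have h1 := (near (s * (B / k)) (by rw [abs_mul, hs, one_mul, abs_of_nonneg (by positivity)]))
      |>.abs_defect_le ((le_max_left _ _).trans hkk)
    rw [(hc _).1, (hc _).2, sub_zero, ← hC] at h1
    obtain ⟨F, hF⟩ : ∃ F, F = (c (π / (2 * ((m : ℝ) + 2)) + s * (B / k))).p₄' +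
      sin (π / (2 * ((m : ℝ) + 2)) + s * (B / k)) := ⟨_, rfl⟩
    rw [← hF] at h1 ⊢
    have e1 : 4 * cos (π / (2 * ((m : ℝ) + 2))) * k * (2 * (s * (B / k)) +
        k * (2 * ((m : ℝ) + 1) * (ε₁ - ε₂)) + tan (π / (2 * ((m : ℝ) + 2))) / k) =
        4 * cos (π / (2 * ((m : ℝ) + 2))) * (2 * s * B +
          (k ^ 2 * (2 * ((m : ℝ) + 1) * (ε₁ - ε₂)) + tan (π / (2 * ((m : ℝ) + 2))))) := by
      field_simp
      ring
    have e2 : |k ^ 2 * (2 * ((m : ℝ) + 1) * (ε₁ - ε₂)) + tan (π / (2 * ((m : ℝ) + 2)))| ≤ P := by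
      refine (abs_add_le _ _).trans ?_
      rw [abs_mul, abs_of_pos htan, abs_of_nonneg (by positivity : (0 : ℝ) ≤ k ^ 2), hP]
      refine add_le_add_left ?_ _
      calc (k : ℝ) ^ 2 * |2 * ((m : ℝ) + 1) * (ε₁ - ε₂)| ≤
          k ^ 2 * (4 * ((m : ℝ) + 1) * A / k ^ 2) := by gcongr
        _ = 4 * ((m : ℝ) + 1) * A := by field_simp
    have e3 : C * (k * (A / k ^ 2)) ≤ 4 * cos (π / (2 * ((m : ℝ) + 2))) * B := by
      have := (le_max_right _ _).trans hkk
      rw [div_le_iff₀ (by positivity)] at this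
      rw [show C * (k * (A / k ^ 2)) = C * A / k by field_simp, div_le_iff₀ (by linarith)]
      linarith
    rw [e1] at h1
    obtain ⟨Z, hZ⟩ : ∃ Z, Z = k ^ 2 * (2 * ((m : ℝ) + 1) * (ε₁ - ε₂)) +
      tan (π / (2 * ((m : ℝ) + 2))) := ⟨_, rfl⟩
    rw [← hZ] at h1 e2
    have h2 := abs_le.mp (h1.trans e3)
    have h3 := abs_le.mp (e2.trans (by linarith : P ≤ B))
    have h4 : 0 ≤ cos (π / (2 * ((m : ℝ) + 2))) * (B - Z) := mul_nonneg hcos.le (by linarith)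
    have h5 : 0 ≤ cos (π / (2 * ((m : ℝ) + 2))) * (B + Z) := mul_nonneg hcos.le (by linarith)
    rcases eq_or_eq_neg_of_abs_eq hs with rfl | rfl
    · linarith
    · linarith
  have hpos := sign 1 (by simp)
  have hneg := sign (-1) (by simp)
  rw [one_mul, one_mul] at hpos
  rw [neg_one_mul, neg_one_mul] at hneg
  have hF : Continuous fun w => (c (π / (2 * ((m : ℝ) + 2)) + w)).p₄' +
      sin (π / (2 * ((m : ℝ) + 2)) + w) := by
    have := hcont.comp (continuous_const.add continuous_id : Continuous fun w : ℝ =>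
      π / (2 * ((m : ℝ) + 2)) + w)
    exact this.add (by fun_prop)
  obtain ⟨w, hw, hw0⟩ := intermediate_value_Icc
    (neg_le_self (by positivity : 0 ≤ B / k)) hF.continuousOn ⟨by linarith, hpos⟩
  refine ⟨c (π / (2 * ((m : ℝ) + 2)) + w), w, near w (abs_le.mpr hw), ?_⟩
  rw [(hc _).1, (hc _).2]
  exact hw0

end

section

open Real Filter

variable {α β : ℝ}

/-- All long sides of a corridor are tilted by an amount of order `1 / k`: their angles
deviate from the Veech angle by at most the value at the two ends of the corridor, up to `O(E)`. -/
theorem Corridor.Gaps.dev_le {m k : ℕ} {c : Corridor m k α β} {w ε₁ ε₂ C E δ : ℝ}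
    (hg : c.Gaps w ε₁ ε₂ (C * E)) (hk : 0 < k) (hC : 0 ≤ C) (h₁ : |ε₁| ≤ E) (h₂ : |ε₂| ≤ E)
    (hD₁ : 2 * δ ≤ 1 + scale m * k ^ 2 * (ε₁ - ε₂))
    (hD₂ : 2 * δ ≤ 1 - scale m * k ^ 2 * (ε₁ - ε₂)) {j a b : ℝ} (hj : 0 ≤ j) (hj' : j ≤ k + 2)
    (ha : |a| ≤ 2 * (m + 2)) (hb : |b| ≤ 2 * (m + 2)) :
    w + j * (2 * ((m : ℝ) + 1) * (ε₁ - ε₂)) + (a * ε₁ + b * ε₂) ≤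
      -(tan (π / (2 * ((m : ℝ) + 2))) * δ / k) + (C + 20 * (m + 2)) * E := by
  have hT := veech_tan_pos m
  have hK : (0 : ℝ) < k := by exact_mod_cast hk
  have hm : (0 : ℝ) ≤ m := Nat.cast_nonneg m
  have hE : 0 ≤ E := (abs_nonneg _).trans h₁
  have hs := hg.start
  rw [scale] at hD₁ hD₂
  obtain ⟨T, hT'⟩ : ∃ T, T = tan (π / (2 * ((m : ℝ) + 2))) := ⟨_, rfl⟩
  rw [← hT'] at hT hD₁ hD₂ hs ⊢
  obtain ⟨η, hη⟩ : ∃ η, η = 2 * ((m : ℝ) + 1) * (ε₁ - ε₂) := ⟨_, rfl⟩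
  have e1 : 2 * ((m : ℝ) + 1) / T * k ^ 2 * (ε₁ - ε₂) = k ^ 2 * η / T := by
    rw [hη]
    field_simp
  rw [e1] at hD₁ hD₂
  rw [← hη] at hs ⊢
  have i1 : 2 * (T * δ / k) ≤ T / k + k * η := by
    calc 2 * (T * δ / k) = T / k * (2 * δ) := by ring
      _ ≤ T / k * (1 + k ^ 2 * η / T) := by gcongr
      _ = T / k + k * η := by field_simp
  have i2 : 2 * (T * δ / k) ≤ T / k - k * η := by
    calc 2 * (T * δ / k) = T / k * (2 * δ) := by ring
      _ ≤ T / k * (1 - k ^ 2 * η / T) := by gcongr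
      _ = T / k - k * η := by field_simp
  have i3 : η ≤ 4 * (m + 2) * E := by
    have h3 : ε₁ - ε₂ ≤ 2 * E := by linarith [le_abs_self ε₁, neg_abs_le ε₂]
    rw [hη]
    calc 2 * ((m : ℝ) + 1) * (ε₁ - ε₂) ≤ 2 * ((m : ℝ) + 1) * (2 * E) := by gcongr
      _ ≤ 2 * ((m : ℝ) + 2) * (2 * E) := by gcongr; linarith
      _ = 4 * (m + 2) * E := by ring
  have i4 := (le_abs_self _).trans (abs_combine_le h₁ h₂ ha hb)
  have i5 := (abs_le.mp hs).2
  have hCE : 0 ≤ C * E := by positivity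
  have hmE : 0 ≤ (m + 2) * E := by positivity
  rcases le_total 0 η with h | h
  · have h3 : j * η ≤ (k + 2) * η := by gcongr
    linarith
  · have h3 : j * η ≤ 0 := mul_nonpos_of_nonneg_of_nonpos hj h
    linarith

theorem Corridor.Near.tilted {m k : ℕ} {w ε₁ ε₂ B C E δ : ℝ}
    {c : Corridor m k (π / (2 * ((m : ℝ) + 2)) + ε₁) (π / (2 * ((m : ℝ) + 2)) + ε₂)}
    (h : c.Near w ε₁ ε₂ B E) (hg : c.Gaps w ε₁ ε₂ (C * E)) (hC : 0 ≤ C)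
    (hs : ShortSides (π / (2 * ((m : ℝ) + 2)) + ε₁) (π / (2 * ((m : ℝ) + 2)) + ε₂))
    (hD₁ : 2 * δ ≤ 1 + scale m * k ^ 2 * (ε₁ - ε₂))
    (hD₂ : 2 * δ ≤ 1 - scale m * k ^ 2 * (ε₁ - ε₂))
    (hB : (8 * (m + 2) + 4) * B / k ≤ 1 / 4)
    (hBx : (8 * (m + 2) + 4) * B / k ≤ π / (2 * ((m : ℝ) + 2)))
    (hE : (C + 40 * (m + 2)) * E < tan (π / (2 * ((m : ℝ) + 2))) * δ / k) {j a b : ℝ} (hj : 0 ≤ j)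
    (hj' : j ≤ k + 2) (ha : |a| ≤ 2 * (m + 2)) (hb : |b| ≤ 2 * (m + 2)) :
    Tilted m (π / (2 * ((m : ℝ) + 2)) + ε₁) (π / (2 * ((m : ℝ) + 2)) + ε₂)
      (π / (2 * ((m : ℝ) + 2)) + (w + j * (2 * ((m : ℝ) + 1) * (ε₁ - ε₂)) + (a * ε₁ + b * ε₂))) := by
  have hE0 := h.E_nonneg
  have hm : (0 : ℝ) ≤ m := Nat.cast_nonneg m
  have h1 := hg.dev_le h.k_pos hC h.hε₁ h.hε₂ hD₁ hD₂ hj hj' ha hb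
  have b3 : |(0 : ℝ)| ≤ 2 * ((m : ℝ) + 2) := by rw [abs_zero]; positivity
  have h2 := h.abs_angle_le hj' ha hb b3 b3 j (abs_of_nonneg hj).le
  rw [zero_mul, zero_mul, add_zero, add_zero, add_assoc] at h2
  have h3 := abs_le.mp h2
  have h4 : 0 ≤ (m + 2) * E := by positivity
  have h5 : 0 ≤ C * E := by positivity
  have := tilted_of_near (d := -(w + j * (2 * ((m : ℝ) + 1) * (ε₁ - ε₂)) + (a * ε₁ + b * ε₂)))
    h.hε₁ h.hε₂ (by linarith) ?_ (by linarith) (by linarith) hs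
  · rwa [sub_neg_eq_add] at this
  · have : 0 ≤ (C + 20 * (m + 2)) * E := by positivity
    rcases hE0.lt_or_eq with h6 | h6
    · have : 0 < (m + 2) * E := by positivity
      linarith
    · rw [← h6] at hE h1
      linarith

/-- If all four slacks are positive, a closed corridor can be shifted so that the line has all
vertices on the proper sides. -/
theorem Corridor.Near.exists_open {m k : ℕ} {w ε₁ ε₂ B C E δ : ℝ}
    {c : Corridor m k (π / (2 * ((m : ℝ) + 2)) + ε₁) (π / (2 * ((m : ℝ) + 2)) + ε₂)}
    (h : c.Near w ε₁ ε₂ B E) (hc : c.p₄' + sin c.y₁ = c.p₁)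
    (hg : c.Gaps w ε₁ ε₂ (C * E)) (hC : 0 ≤ C)
    (hs : ShortSides (π / (2 * ((m : ℝ) + 2)) + ε₁) (π / (2 * ((m : ℝ) + 2)) + ε₂))
    (hD₁ : 2 * δ ≤ 1 + scale m * k ^ 2 * (ε₁ - ε₂))
    (hD₂ : 2 * δ ≤ 1 - scale m * k ^ 2 * (ε₁ - ε₂))
    (s₁ : δ ≤ cornerSlack m (scale m * k ^ 2 * ε₁) (scale m * k ^ 2 * ε₂))
    (s₂ : δ ≤ cornerSlack m (scale m * k ^ 2 * ε₂) (scale m * k ^ 2 * ε₁))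
    (s₃ : δ ≤ sideSlack m (scale m * k ^ 2 * ε₁) (scale m * k ^ 2 * ε₂))
    (s₄ : δ ≤ sideSlack m (scale m * k ^ 2 * ε₂) (scale m * k ^ 2 * ε₁))
    (hB : (8 * (m + 2) + 4) * B / k ≤ 1 / 4)
    (hBx : (8 * (m + 2) + 4) * B / k ≤ π / (2 * ((m : ℝ) + 2)))
    (hE : (C + 40 * (m + 2)) * E < tan (π / (2 * ((m : ℝ) + 2))) * δ / k)
    (hE' : (3 * C + 8 * (m + 2)) * E < sin (π / (2 * ((m : ℝ) + 2))) * δ / k) :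
    ∃ c' : Corridor m k (π / (2 * ((m : ℝ) + 2)) + ε₁) (π / (2 * ((m : ℝ) + 2)) + ε₂),
      c'.Open := by
  have hK : (0 : ℝ) < k := by exact_mod_cast h.k_pos
  have hm : (0 : ℝ) ≤ m := Nat.cast_nonneg m
  have hsin := veech_sin_pos m
  have tilt := fun {j a b : ℝ} hj hj' ha hb => h.tilted hg hC hs hD₁ hD₂ hB hBx hE (j := j)
    (a := a) (b := b) hj hj' ha hb
  obtain ⟨g₁, g₂, g₃, g₄, g₅, g₆, -⟩ := h.angles
  have g₀ := h.hy₁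
  have b0 : |(0 : ℝ)| ≤ 2 * ((m : ℝ) + 2) := by rw [abs_zero]; positivity
  have bn : |-(2 * ((m : ℝ) + 2))| ≤ 2 * ((m : ℝ) + 2) := by
    rw [abs_neg, abs_of_nonneg]
    positivity
  have mul_ge : ∀ q, δ ≤ q → sin (π / (2 * ((m : ℝ) + 2))) * δ / k ≤
      sin (π / (2 * ((m : ℝ) + 2))) / k * q := fun q hq => by
    rw [mul_div_right_comm]
    gcongr
  have q₁ := mul_ge _ s₁
  have q₂ := mul_ge _ s₂
  have q₃ := mul_ge _ s₃
  have q₄ := mul_ge _ s₄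
  rw [cornerSlack_scale m hK] at q₁ q₂
  rw [sideSlack_scale m hK] at q₃ q₄
  have u₁ := (abs_le.mp hg.upper).1
  have u₁' := (abs_le.mp hg.upper).2
  have u₂ := (abs_le.mp hg.lower).1
  have u₂' := (abs_le.mp hg.lower).2
  have u₃ := (abs_le.mp hg.left).1
  have u₄ := (abs_le.mp hg.right).1
  obtain ⟨u₅, u₆⟩ := abs_le.mp hg.balance
  have hE0 := h.E_nonneg
  have hCE : 0 ≤ C * E := by positivity
  have hmE : 0 ≤ (m + 2) * E := by positivity
  -- opposite vertices see almost the same angle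
  have close : ∀ {r a y y' : ℝ}, 0 ≤ r → r ≤ 1 → |y' - y| ≤ 8 * (m + 2) * E →
      |r * (sin (a - y) - sin (a - y'))| ≤ 8 * (m + 2) * E := by
    intro r a y y' hr hr1 hyy
    rw [abs_mul, abs_of_nonneg hr]
    have h1 := abs_sin_sub_sin_le (a - y) (a - y')
    rw [show a - y - (a - y') = y' - y by ring] at h1
    calc r * |sin (a - y) - sin (a - y')| ≤ 1 * |sin (a - y) - sin (a - y')| := by gcongr
      _ ≤ 8 * (m + 2) * E := by linarith
  have comb : ∀ a b : ℝ, |a| ≤ 4 * (m + 2) → |b| ≤ 4 * (m + 2) →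
      |a * ε₁ + b * ε₂| ≤ 8 * (m + 2) * E := fun a b ha hb =>
    (abs_combine_le h.hε₁ h.hε₂ ha hb).trans_eq (by ring)
  have v₁ := abs_le.mp (close (a := π / (2 * ((m : ℝ) + 2)) + ε₂) (y := c.y₂') (y' := c.y₁)
    hs.side_two.le hs.side_two_le (by
      rw [g₀, g₃]
      refine le_of_eq_of_le (congrArg _ ?_) (comb (-(2 * (m + 1)) + 2 * (m + 2)) (2 * (m + 1)) ?_ ?_)
      · ring
      · rw [abs_le]; constructor <;> linarith
      · rw [abs_le]; constructor <;> linarith))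
  have v₂ := abs_le.mp (close (a := π / (2 * ((m : ℝ) + 2)) + ε₁) (y := c.y₁') (y' := c.y₄)
    hs.side_one.le hs.side_one_le (by
      rw [g₁, g₆]
      refine le_of_eq_of_le (congrArg _ ?_) (comb (-(2 * (m + 1))) (2 * (m + 1) - 2 * (m + 2)) ?_ ?_)
      · ring
      · rw [abs_le]; constructor <;> linarith
      · rw [abs_le]; constructor <;> linarith))
  -- the shift that makes the second and the fourth corner symmetric about the line
  obtain ⟨c', ⟨z₁, z₁', z₂, z₂', z₃, z₃', z₄, z₄'⟩, w₀, w₁, w₂, w₃, w₄⟩ :=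
    c.exists_translate (-(c.p₄' + c.p₂') / 2)
  clear hD₁ hD₂ s₁ s₂ s₃ s₄ hB hBx hE
  refine ⟨c', Corridor.open_of_tilted hs ?_ ?_ ?_ ?_ ?_ ?_ ?_ ?_ ?_ ?_ ?_ ?_ ?_⟩
  · intro j hj
    have hj' : (j : ℝ) ≤ k + 2 := by exact_mod_cast hj
    rw [z₁, g₀, turnAngle_near, turnAngle_near]
    convert tilt (j := j) (a := 0) (b := 0) (by positivity) hj' b0 b0 using 1
    ring
  · intro j hj
    have hj' : (j : ℝ) ≤ k + 1 := by exact_mod_cast hj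
    have hj0 : (0 : ℝ) ≤ j := Nat.cast_nonneg j
    rw [z₂, g₂, turnAngle_near, turnAngle_near]
    convert (tilt (j := k + 2 - j) (a := -(2 * (m + 2))) (b := 0) (by linarith) (by linarith) bn
      b0).symm using 1
    ring
  · intro j hj
    have hj' : (j : ℝ) ≤ k := by exact_mod_cast hj
    have hj0 : (0 : ℝ) ≤ j := Nat.cast_nonneg j
    rw [z₃, g₄, turnAngle_near, turnAngle_near]
    convert tilt (j := j + 1) (a := -(2 * (m + 2))) (b := -(2 * (m + 2))) (by linarith)
      (by linarith) bn bn using 1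
    ring
  · intro j hj
    have hj' : (j : ℝ) ≤ k + 1 := by exact_mod_cast hj
    have hj0 : (0 : ℝ) ≤ j := Nat.cast_nonneg j
    rw [z₄, g₆, turnAngle_near, turnAngle_near]
    convert (tilt (j := k + 1 - j) (a := 0) (b := -(2 * (m + 2))) (by linarith) (by linarith) b0
      bn).symm using 1
    ring
  · rw [w₄, z₁, w₀, ← hc]
    ring
  · rw [w₁]; linarith
  · rw [w₂]; linarith
  · rw [w₃]; linarith
  · rw [w₄]; linarith
  · rw [w₁, z₁']; linarith
  · rw [w₂, z₂']; linarith
  · rw [w₃, z₄]; linarith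
  · rw [w₄, z₁]; linarith

theorem eventually_div_le (a : ℝ) {b : ℝ} (hb : 0 < b) : ∀ᶠ k : ℕ in atTop, a / k ≤ b :=
  (tendsto_const_div_atTop_nhds_zero_nat a).eventually_le_const hb

/-- For large `k`, all triangles that satisfy the inequalities of the quadrilateral with some room
have open corridors. -/
theorem eventually_exists_open {m : ℕ} (hm : 1 ≤ m) {δ : ℝ} (hδ : 0 < δ) : ∀ᶠ k : ℕ in atTop,
    ∀ u v α β : ℝ, u = scale m * k ^ 2 * (α - π / (2 * ((m : ℝ) + 2))) →
      v = scale m * k ^ 2 * (β - π / (2 * ((m : ℝ) + 2))) →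
      δ ≤ cornerSlack m u v → δ ≤ cornerSlack m v u → δ ≤ sideSlack m u v → δ ≤ sideSlack m v u →
      (0 < α ∧ 0 < β ∧ α + β < π / 2) ∧ ∃ c : Corridor m k α β, c.Open := by
  have hsc := scale_pos m
  have hT := veech_tan_pos m
  have hsin := veech_sin_pos m
  have hx := veech_angle_pos m
  obtain ⟨R, hR, hR'⟩ := exists_abs_le_of_slacks_ge m le_rfl
  obtain ⟨A, hA⟩ : ∃ A, A = R / scale m + 1 := ⟨_, rfl⟩
  have hA1 : 1 ≤ A := by
    rw [hA]
    have : 0 ≤ R / scale m := by positivity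
    linarith
  obtain ⟨B, hAB, k₁, hcl⟩ := exists_closed_corridor m hA1
  obtain ⟨C, hC, k₂, hgap⟩ := Corridor.Near.exists_gaps m (B := B) (by linarith)
  obtain ⟨E₀, hE₀, hshort⟩ := shortSides_of_near hm
  filter_upwards [eventually_ge_atTop (max (max k₁ k₂) 1), eventually_div_le A hE₀,
    eventually_div_le ((8 * (m + 2) + 4) * B) (by norm_num : (0 : ℝ) < 1 / 4),
    eventually_div_le ((8 * (m + 2) + 4) * B) hx,
    eventually_div_le ((C + 40 * (m + 2)) * A)
      (by positivity : 0 < tan (π / (2 * ((m : ℝ) + 2))) * δ / 4),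
    eventually_div_le ((3 * C + 8 * (m + 2)) * A)
      (by positivity : 0 < sin (π / (2 * ((m : ℝ) + 2))) * δ / 4)] with k hk f₁ f₂ f₃ f₄ f₅
  intro u v α β hu hv s₁ s₂ s₃ s₄
  have hk₁ : k₁ ≤ k := ((le_max_left _ _).trans (le_max_left _ _)).trans hk
  have hk₂ : k₂ ≤ k := ((le_max_right _ _).trans (le_max_left _ _)).trans hk
  have hk1 : 1 ≤ k := (le_max_right _ _).trans hk
  have hK1 : (1 : ℝ) ≤ k := by exact_mod_cast hk1
  have hK : (0 : ℝ) < k := by linarith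
  obtain ⟨r₁, r₂⟩ := hR' u v (by linarith) (by linarith) (by linarith) (by linarith)
  obtain ⟨ε₁, hε₁⟩ : ∃ ε₁, ε₁ = α - π / (2 * ((m : ℝ) + 2)) := ⟨_, rfl⟩
  obtain ⟨ε₂, hε₂⟩ : ∃ ε₂, ε₂ = β - π / (2 * ((m : ℝ) + 2)) := ⟨_, rfl⟩
  obtain rfl : α = π / (2 * ((m : ℝ) + 2)) + ε₁ := by rw [hε₁]; ring
  obtain rfl : β = π / (2 * ((m : ℝ) + 2)) + ε₂ := by rw [hε₂]; ring
  rw [← hε₁] at hu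
  rw [← hε₂] at hv
  have small : ∀ ε, |scale m * k ^ 2 * ε| ≤ R → |ε| ≤ A / k ^ 2 := by
    intro ε h
    rw [abs_mul, abs_of_pos (by positivity), mul_comm, ← le_div_iff₀ (by positivity)] at h
    refine h.trans ?_
    rw [hA, ← div_div]
    gcongr
    linarith
  have n₁ := small ε₁ (hu ▸ r₁)
  have n₂ := small ε₂ (hv ▸ r₂)
  have hAk : A / k ^ 2 ≤ E₀ := by
    refine le_trans ?_ f₁
    gcongr
    nlinarith
  have hs := hshort ε₁ ε₂ (n₁.trans hAk) (n₂.trans hAk)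
  refine ⟨⟨hs.one_pos, hs.two_pos, hs.sum_lt⟩, ?_⟩
  obtain ⟨c, w, hn, hc⟩ := hcl hk₁ n₁ n₂
  have hκ : 1 / (2 * cos (π / (2 * ((m : ℝ) + 2))) ^ 2) ≤ 25 / 24 := by
    rw [div_le_div_iff₀ (by have := veech_cos_pos m; positivity) (by norm_num)]
    nlinarith [veech_cos_ge m]
  have hκ0 : 0 < 1 / (2 * cos (π / (2 * ((m : ℝ) + 2))) ^ 2) := by
    have := veech_cos_pos m
    positivity
  have diff : ∀ D : ℝ, 2 * δ ≤ 1 / (2 * cos (π / (2 * ((m : ℝ) + 2))) ^ 2) * D → 2 * (δ / 2) ≤ D := by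
    intro D hD
    by_contra hD'
    push Not at hD'
    rcases le_total D 0 with h | h
    · linarith [mul_nonpos_of_nonneg_of_nonpos hκ0.le h]
    · nlinarith
  have e₁ : scale m * k ^ 2 * (ε₁ - ε₂) = u - v := by rw [hu, hv]; ring
  have lt : ∀ a b : ℝ, 0 < b → a * A / k ≤ b * δ / 4 → a * (A / k ^ 2) < b * (δ / 2) / k := by
    intro a b hb hab
    calc a * (A / k ^ 2) = a * A / k / k := by field_simp
      _ ≤ b * δ / 4 / k := by gcongr
      _ < b * (δ / 2) / k := by
        gcongr
        linarith [mul_pos hb hδ]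
  have d₁ : 2 * (δ / 2) ≤ 1 + (u - v) := diff _ (by rw [sideSlack] at s₃; linarith)
  have d₂ : 2 * (δ / 2) ≤ 1 - (u - v) := diff _ (by
    rw [sideSlack] at s₄
    rw [← neg_sub v u, sub_neg_eq_add]
    linarith)
  rw [← e₁] at d₁ d₂
  subst hu hv
  exact hn.exists_open hc (hgap c hk₂ hn hc) hC hs d₁ d₂ (by linarith) (by linarith) (by linarith)
    (by linarith) f₂ f₃ (lt _ _ hT f₄) (lt _ _ hsin f₅)

end

open Real Filter

/-! ### The quadrilateral -/

/-- All four slacks at a point of the rescaled parameter plane are at least `δ`. -/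
def SlacksGe (m : ℕ) (δ : ℝ) (Y : Plane) : Prop :=
  δ ≤ cornerSlack m (Y 0) (Y 1) ∧ δ ≤ cornerSlack m (Y 1) (Y 0) ∧
    δ ≤ sideSlack m (Y 0) (Y 1) ∧ δ ≤ sideSlack m (Y 1) (Y 0)

theorem cornerSlack_combine (m : ℕ) (s t u v u' v' : ℝ) (h : s + t = 1) :
    cornerSlack m (s * u + t * u') (s * v + t * v') =
      s * cornerSlack m u v + t * cornerSlack m u' v' := by
  simp only [cornerSlack]
  linear_combination -h

theorem sideSlack_combine (m : ℕ) (s t u v u' v' : ℝ) (h : s + t = 1) :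
    sideSlack m (s * u + t * u') (s * v + t * v') =
      s * sideSlack m u v + t * sideSlack m u' v' := by
  simp only [sideSlack, cornerSlack_combine m s t u v u' v' h]
  linear_combination -(1 / (2 * cos (π / (2 * ((m : ℝ) + 2))) ^ 2)) * h

theorem SlacksGe.combine {m : ℕ} {a b s t : ℝ} {Y Z : Plane} (hY : SlacksGe m a Y)
    (hZ : SlacksGe m b Z) (hs : 0 ≤ s) (ht : 0 ≤ t) (h : s + t = 1) :
    SlacksGe m (s * a + t * b) (s • Y + t • Z) := by
  obtain ⟨y1, y2, y3, y4⟩ := hY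
  obtain ⟨z1, z2, z3, z4⟩ := hZ
  simp only [SlacksGe, PiLp.add_apply, PiLp.smul_apply, smul_eq_mul, cornerSlack_combine m s t _ _ _ _ h,
    sideSlack_combine m s t _ _ _ _ h]
  refine ⟨?_, ?_, ?_, ?_⟩ <;> gcongr

/-- The coefficient `1 / (2 cos² (π / 2n)) = 1 - μ_n` of the side slacks. -/
noncomputable def sideCoeff (m : ℕ) : ℝ := 1 / (2 * cos (π / (2 * ((m : ℝ) + 2))) ^ 2)

theorem sideSlack_eq (m : ℕ) (u v : ℝ) :
    sideSlack m u v = sideCoeff m * (1 + (u - v)) - cornerSlack m u v := rfl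

theorem half_lt_sideCoeff (m : ℕ) : 1 / 2 < sideCoeff m := by
  have h1 := veech_cos_pos m
  have h2 := veech_sin_pos m
  have h3 := sin_sq_add_cos_sq (π / (2 * ((m : ℝ) + 2)))
  rw [sideCoeff, div_lt_div_iff₀ (by norm_num) (by positivity)]
  nlinarith

theorem muCoeff_eq (m : ℕ) : muCoeff (m + 2) = 1 - sideCoeff m := by
  have h1 := veech_cos_pos m
  have h3 := sin_sq_add_cos_sq (π / (2 * ((m : ℝ) + 2)))
  rw [muCoeff, sideCoeff]
  push_cast
  rw [tan_eq_sin_div_cos]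
  field_simp
  linear_combination -h3

theorem aCoeff_eq (m : ℕ) : aCoeff (m + 2) = ((m : ℝ) + 1) / (2 * ((m : ℝ) + 2)) := by
  rw [aCoeff]
  push_cast
  field_simp
  ring

theorem quadVertex_zero (m : ℕ) : quadVertex (m + 2) 0 0 = -(1 / ((m : ℝ) + 2)) ∧
    quadVertex (m + 2) 0 1 = 1 - 1 / ((m : ℝ) + 2) := by
  simp [quadVertex]

theorem quadVertex_one (m : ℕ) : quadVertex (m + 2) 1 0 = 1 - 1 / ((m : ℝ) + 2) ∧
    quadVertex (m + 2) 1 1 = -(1 / ((m : ℝ) + 2)) := by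
  simp [quadVertex]

theorem quadVertex_two (m : ℕ) : quadVertex (m + 2) 2 0 = ((m : ℝ) + 1) / (2 * ((m : ℝ) + 2)) ∧
    quadVertex (m + 2) 2 1 = ((m : ℝ) + 1) / (2 * ((m : ℝ) + 2)) := by
  simp [quadVertex, aCoeff_eq]

theorem quadVertex_three (m : ℕ) :
    quadVertex (m + 2) 3 0 = (1 - sideCoeff m) * (((m : ℝ) + 1) / (2 * ((m : ℝ) + 2))) ∧
    quadVertex (m + 2) 3 1 = (1 - sideCoeff m) * (((m : ℝ) + 1) / (2 * ((m : ℝ) + 2))) := by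
  simp [quadVertex, aCoeff_eq, muCoeff_eq]

theorem slacksGe_quadVertex {m : ℕ} (hm : 1 ≤ m) (i : Fin 4) :
    SlacksGe m 0 (quadVertex (m + 2) i) := by
  have hm' : (1 : ℝ) ≤ m := by exact_mod_cast hm
  have hκ := half_lt_sideCoeff m
  have e2 : 0 ≤ 2 / ((m : ℝ) + 1) := by positivity
  have e3 : 2 / ((m : ℝ) + 1) ≤ 1 := by
    rw [div_le_one (by positivity)]
    linarith
  simp only [SlacksGe, sideSlack_eq, cornerSlack]
  fin_cases i
  · obtain ⟨h1, h2⟩ := quadVertex_zero m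
    have c1 : 1 - ((m : ℝ) + 2) / (m + 1) * (-(1 / ((m : ℝ) + 2)) + (1 - 1 / ((m : ℝ) + 2))) +
        (-(1 / ((m : ℝ) + 2)) - (1 - 1 / ((m : ℝ) + 2))) / (m + 1) = 0 := by field_simp; ring
    have c2 : 1 - ((m : ℝ) + 2) / (m + 1) * (1 - 1 / ((m : ℝ) + 2) + -(1 / ((m : ℝ) + 2))) +
        (1 - 1 / ((m : ℝ) + 2) - -(1 / ((m : ℝ) + 2))) / (m + 1) = 2 / (m + 1) := by
      field_simp; ring
    have c3 : 1 + (-(1 / ((m : ℝ) + 2)) - (1 - 1 / ((m : ℝ) + 2))) = 0 := by ring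
    have c4 : 1 + (1 - 1 / ((m : ℝ) + 2) - -(1 / ((m : ℝ) + 2))) = 2 := by ring
    simp only [Fin.zero_eta, h1, h2]
    rw [c1, c2, c3, c4]
    refine ⟨?_, ?_, ?_, ?_⟩ <;> linarith
  · obtain ⟨h1, h2⟩ := quadVertex_one m
    have c1 : 1 - ((m : ℝ) + 2) / (m + 1) * (-(1 / ((m : ℝ) + 2)) + (1 - 1 / ((m : ℝ) + 2))) +
        (-(1 / ((m : ℝ) + 2)) - (1 - 1 / ((m : ℝ) + 2))) / (m + 1) = 0 := by field_simp; ring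
    have c2 : 1 - ((m : ℝ) + 2) / (m + 1) * (1 - 1 / ((m : ℝ) + 2) + -(1 / ((m : ℝ) + 2))) +
        (1 - 1 / ((m : ℝ) + 2) - -(1 / ((m : ℝ) + 2))) / (m + 1) = 2 / (m + 1) := by
      field_simp; ring
    have c3 : 1 + (-(1 / ((m : ℝ) + 2)) - (1 - 1 / ((m : ℝ) + 2))) = 0 := by ring
    have c4 : 1 + (1 - 1 / ((m : ℝ) + 2) - -(1 / ((m : ℝ) + 2))) = 2 := by ring
    simp only [Fin.mk_one, h1, h2]
    rw [c1, c2, c3, c4]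
    refine ⟨?_, ?_, ?_, ?_⟩ <;> linarith
  · obtain ⟨h1, h2⟩ := quadVertex_two m
    have c1 : 1 - ((m : ℝ) + 2) / (m + 1) * (((m : ℝ) + 1) / (2 * ((m : ℝ) + 2)) +
        ((m : ℝ) + 1) / (2 * ((m : ℝ) + 2))) = 0 := by field_simp; ring
    simp only [Fin.reduceFinMk, h1, h2]
    rw [c1, sub_self, zero_div]
    refine ⟨?_, ?_, ?_, ?_⟩ <;> linarith
  · obtain ⟨h1, h2⟩ := quadVertex_three m
    have c1 : 1 - ((m : ℝ) + 2) / (m + 1) *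
        ((1 - sideCoeff m) * (((m : ℝ) + 1) / (2 * ((m : ℝ) + 2))) +
        (1 - sideCoeff m) * (((m : ℝ) + 1) / (2 * ((m : ℝ) + 2)))) = sideCoeff m := by
      field_simp; ring
    simp only [Fin.reduceFinMk, h1, h2]
    rw [c1, sub_self, zero_div]
    refine ⟨?_, ?_, ?_, ?_⟩ <;> linarith

/-- The quadrilateral is the set of points with nonnegative slacks. A point with nonpositive
difference of coordinates is in the triangle of all vertices but the second, and its slacks are
proportional to barycentric coordinates. -/
theorem mem_quad_iff {m : ℕ} (hm : 1 ≤ m) (Y : Plane) : Y ∈ quad (m + 2) ↔ SlacksGe m 0 Y := by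
  constructor
  · intro hY
    have hconv : Convex ℝ {Y : Plane | SlacksGe m 0 Y} := by
      intro Y hY Z hZ s t hs ht hst
      have := SlacksGe.combine hY hZ hs ht hst
      simpa using this
    exact convexHull_min (Set.range_subset_iff.mpr (slacksGe_quadVertex hm)) hconv hY
  · rintro ⟨h1, h2, h3, h4⟩
    have hκ : 0 < sideCoeff m := by linarith [half_lt_sideCoeff m]
    have e3 : sideSlack m (Y 0) (Y 1) = sideCoeff m * (1 + (Y 0 - Y 1)) - cornerSlack m (Y 0) (Y 1) :=
      rfl
    have e4 : sideSlack m (Y 1) (Y 0) = sideCoeff m * (1 + (Y 1 - Y 0)) - cornerSlack m (Y 1) (Y 0) :=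
      rfl
    have mem : ∀ i, quadVertex (m + 2) i ∈ quad (m + 2) := fun i =>
      subset_convexHull ℝ _ (Set.mem_range_self i)
    have hconv : Convex ℝ (quad (m + 2)) := convex_convexHull ℝ _
    obtain ⟨a1, a2⟩ := quadVertex_zero m
    obtain ⟨b1, b2⟩ := quadVertex_one m
    obtain ⟨c1, c2⟩ := quadVertex_two m
    obtain ⟨d1, d2⟩ := quadVertex_three m
    have three : ∀ (i : Fin 4) (r s t : ℝ), 0 ≤ r → 0 ≤ s → 0 ≤ t → r + s + t = 1 →
        Y = r • quadVertex (m + 2) i + s • quadVertex (m + 2) 2 + t • quadVertex (m + 2) 3 →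
        Y ∈ quad (m + 2) := by
      intro i r s t hr hs ht h e
      rw [e]
      have := hconv.sum_mem (t := Finset.univ) (w := ![r, s, t])
        (z := ![quadVertex (m + 2) i, quadVertex (m + 2) 2, quadVertex (m + 2) 3])
        (by intro j _; fin_cases j <;> simpa) (by simpa [Fin.sum_univ_three] using h)
        (by intro j _; fin_cases j <;> simp [mem])
      simpa [Fin.sum_univ_three] using this
    rcases le_total (Y 0) (Y 1) with h | h
    · refine three 0 (Y 1 - Y 0) (sideSlack m (Y 0) (Y 1) / sideCoeff m)
        (cornerSlack m (Y 0) (Y 1) / sideCoeff m) (by linarith) (by positivity) (by positivity) ?_ ?_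
      · rw [e3]; field_simp; ring
      · ext j
        fin_cases j
        · simp only [Fin.zero_eta, PiLp.add_apply, PiLp.smul_apply, smul_eq_mul, a1, c1, d1, e3,
            cornerSlack]
          field_simp
          ring
        · simp only [Fin.mk_one, PiLp.add_apply, PiLp.smul_apply, smul_eq_mul, a2, c2, d2, e3,
            cornerSlack]
          field_simp
          ring
    · refine three 1 (Y 0 - Y 1) (sideSlack m (Y 1) (Y 0) / sideCoeff m)
        (cornerSlack m (Y 1) (Y 0) / sideCoeff m) (by linarith) (by positivity) (by positivity) ?_ ?_
      · rw [e4]; field_simp; ring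
      · ext j
        fin_cases j
        · simp only [Fin.zero_eta, PiLp.add_apply, PiLp.smul_apply, smul_eq_mul, b1, c1, d1, e4,
            cornerSlack]
          field_simp
          ring
        · simp only [Fin.mk_one, PiLp.add_apply, PiLp.smul_apply, smul_eq_mul, b2, c2, d2, e4,
            cornerSlack]
          field_simp
          ring

/-- A point at which a linear functional has its strict maximum is a vertex. -/
theorem notMem_convexHull_of_lt {p : Fin 4 → Plane} {i : Fin 4} (a b : ℝ)
    (h : ∀ j, j ≠ i → a * p j 0 + b * p j 1 < a * p i 0 + b * p i 1) (s : Set (Fin 4)) :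
    p i ∉ convexHull ℝ (p '' (s \ {i})) := by
  intro hi
  have hlin : IsLinearMap ℝ fun Y : Plane => a * Y 0 + b * Y 1 := by
    constructor
    · intro Y Z
      simp only [PiLp.add_apply]
      ring
    · intro r Y
      simp only [PiLp.smul_apply, smul_eq_mul]
      ring
  have := convexHull_min (t := {Y : Plane | a * Y 0 + b * Y 1 < a * p i 0 + b * p i 1})
    (by
      rintro _ ⟨j, ⟨-, hj⟩, rfl⟩
      exact h j hj) (convex_halfSpace_lt hlin _) hi
  exact lt_irrefl (a * p i 0 + b * p i 1) this

theorem convexIndependent_quadVertex {m : ℕ} (hm : 1 ≤ m) :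
    ConvexIndependent ℝ (quadVertex (m + 2)) := by
  have hm' : (1 : ℝ) ≤ m := by exact_mod_cast hm
  have hκ := half_lt_sideCoeff m
  obtain ⟨a1, a2⟩ := quadVertex_zero m
  obtain ⟨b1, b2⟩ := quadVertex_one m
  obtain ⟨c1, c2⟩ := quadVertex_two m
  obtain ⟨d1, d2⟩ := quadVertex_three m
  obtain ⟨A, hA⟩ : ∃ A, A = ((m : ℝ) + 1) / (2 * ((m : ℝ) + 2)) := ⟨_, rfl⟩
  obtain ⟨q, hq⟩ : ∃ q, q = 1 / ((m : ℝ) + 2) := ⟨_, rfl⟩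
  have hq0 : 0 < q := by rw [hq]; positivity
  have hAq : 2 * A = 1 - q := by rw [hA, hq]; field_simp; ring
  have hq3 : q ≤ 1 / 3 := by
    rw [hq]
    gcongr
    linarith
  rw [← hA] at c1 c2 d1 d2
  rw [← hq] at a1 a2 b1 b2
  have hκA : 0 < (sideCoeff m - 1 / 2) * A := mul_pos (by linarith) (by linarith)
  have hκA' : sideCoeff m * A - 1 / 2 * A > 0 := by linarith
  clear hA hq hκA
  rw [convexIndependent_iff_notMem_convexHull_sdiff]
  intro i s
  fin_cases i
  · refine notMem_convexHull_of_lt (-1) 1 (fun j hj => ?_) s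
    fin_cases j <;> simp [a1, a2, b1, b2, c1, c2, d1, d2] at hj ⊢ <;> linarith
  · refine notMem_convexHull_of_lt 1 (-1) (fun j hj => ?_) s
    fin_cases j <;> simp [a1, a2, b1, b2, c1, c2, d1, d2] at hj ⊢ <;> linarith
  · refine notMem_convexHull_of_lt 1 1 (fun j hj => ?_) s
    fin_cases j <;> simp [a1, a2, b1, b2, c1, c2, d1, d2] at hj ⊢ <;> linarith
  · refine notMem_convexHull_of_lt (-1) (-1) (fun j hj => ?_) s
    fin_cases j <;> simp [a1, a2, b1, b2, c1, c2, d1, d2] at hj ⊢ <;> linarith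

/-! ### The limit -/

theorem zeta_eq_scale (m : ℕ) : zeta (m + 2) = scale m := by
  rw [zeta, scale, cot_eq_cos_div_sin, tan_eq_sin_div_cos]
  push_cast
  rw [div_div_eq_mul_div]
  ring

/-- Membership in the rescaled orbit tile in terms of corridors. -/
theorem mem_rescale_image_iff {m k : ℕ} (Y : Plane) :
    Y ∈ rescale (m + 2) k '' orbitTile (tileWord (m + 2) k) ↔
      ∃ α β, Y 0 = scale m * k ^ 2 * (α - π / (2 * ((m : ℝ) + 2))) ∧
        Y 1 = scale m * k ^ 2 * (β - π / (2 * ((m : ℝ) + 2))) ∧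
        (0 < α ∧ 0 < β ∧ α + β < π / 2) ∧ ∃ c : Corridor m k α β, c.Open := by
  have hV : ∀ i, veechPoint (m + 2) i = π / (2 * ((m : ℝ) + 2)) := by
    intro i
    fin_cases i <;> simp [veechPoint]
  constructor
  · rintro ⟨X, hX, rfl⟩
    refine ⟨X 0, X 1, ?_, ?_, hX.1, (mem_orbitTile_iff hX.1).mp hX⟩ <;>
      simp [rescale, zeta_eq_scale, hV]
  · rintro ⟨α, β, h0, h1, hmem, hc⟩
    have hX : (!₂[α, β] : Plane) ∈ obtuseParameters := by simpa [obtuseParameters] using hmem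
    refine ⟨!₂[α, β], (mem_orbitTile_iff hX).mpr (by simpa using hc), ?_⟩
    ext i
    fin_cases i
    · simp [rescale, zeta_eq_scale, hV, h0]
    · simp [rescale, zeta_eq_scale, hV, h1]

/-- Points of the rescaled orbit tiles almost satisfy the inequalities of the quadrilateral. -/
theorem exists_slacksGe_of_mem (m : ℕ) : ∃ C : ℝ, 0 ≤ C ∧ ∃ k₀ : ℕ, 1 ≤ k₀ ∧ ∀ k : ℕ, k₀ ≤ k →
    ∀ Y ∈ rescale (m + 2) k '' orbitTile (tileWord (m + 2) k), SlacksGe m (-(C / k)) Y := by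
  obtain ⟨C, hC, k₀, h⟩ := exists_slacks_ge m
  refine ⟨C, hC, max k₀ 1, le_max_right _ _, fun k hk Y hY => ?_⟩
  obtain ⟨α, β, h0, h1, ⟨h2, h3, h4⟩, c, hc⟩ :=
    (mem_rescale_image_iff Y).mp hY
  obtain ⟨u, v, rfl, rfl, hs⟩ := h ((le_max_left _ _).trans hk) hc h2 h3 h4
  rw [SlacksGe, h0, h1]
  exact hs

/-- For large `k`, the rescaled orbit tile contains all points of slacks at least `δ`. -/
theorem eventually_mem_of_slacksGe {m : ℕ} (hm : 1 ≤ m) {δ : ℝ} (hδ : 0 < δ) :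
    ∀ᶠ k : ℕ in atTop, ∀ Y, SlacksGe m δ Y →
      Y ∈ rescale (m + 2) k '' orbitTile (tileWord (m + 2) k) := by
  filter_upwards [eventually_exists_open hm hδ, eventually_ge_atTop 1] with k hk hk1 Y hY
  rw [mem_rescale_image_iff]
  have hs : scale m * (k : ℝ) ^ 2 ≠ 0 :=
    (mul_pos (scale_pos m) (pow_pos (by exact_mod_cast hk1) 2)).ne'
  have e : ∀ y : ℝ, y = scale m * k ^ 2 * (π / (2 * ((m : ℝ) + 2)) + y / (scale m * k ^ 2) -
      π / (2 * ((m : ℝ) + 2))) := by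
    intro y
    rw [add_sub_cancel_left, mul_div_cancel₀ _ hs]
  exact ⟨_, _, e (Y 0), e (Y 1), hk _ _ _ _ (e (Y 0)) (e (Y 1)) hY.1 hY.2.1 hY.2.2.1 hY.2.2.2⟩

/-- The point of the diagonal at which all four slacks agree. -/
theorem exists_slacksGe_pos (m : ℕ) : ∃ Z : Plane, ∃ ρ, 0 < ρ ∧ SlacksGe m ρ Z := by
  have hκ : 0 < sideCoeff m := by linarith [half_lt_sideCoeff m]
  obtain ⟨p, hp⟩ : ∃ p, p = (1 - sideCoeff m / 2) * ((m + 1) / (2 * ((m : ℝ) + 2))) := ⟨_, rfl⟩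
  have e : 1 - ((m : ℝ) + 2) / (m + 1) * (p + p) = sideCoeff m / 2 := by
    rw [hp]
    field_simp
    ring
  refine ⟨!₂[p, p], sideCoeff m / 2, by positivity, ?_⟩
  simp only [SlacksGe, sideSlack_eq, cornerSlack, Matrix.cons_val_zero, Matrix.cons_val_one,
    e, sub_self, zero_div]
  refine ⟨?_, ?_, ?_, ?_⟩ <;> linarith

theorem norm_le_of_slacksGe (m : ℕ) {C : ℝ} (hC : 0 ≤ C) :
    ∃ R, 0 ≤ R ∧ ∀ Y : Plane, SlacksGe m (-C) Y → ‖Y‖ ≤ R := by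
  obtain ⟨R, hR, h⟩ := exists_abs_le_of_slacks_ge m hC
  refine ⟨2 * R, by positivity, fun Y hY => ?_⟩
  obtain ⟨h0, h1⟩ := h _ _ hY.1 hY.2.1 hY.2.2.1 hY.2.2.2
  rw [EuclideanSpace.norm_eq, Fin.sum_univ_two]
  refine Real.sqrt_le_iff.mpr ⟨by positivity, ?_⟩
  simp only [Real.norm_eq_abs]
  nlinarith [abs_nonneg (Y 0), abs_nonneg (Y 1)]

theorem SlacksGe.mono {m : ℕ} {a b : ℝ} {Y : Plane} (h : SlacksGe m b Y) (hab : a ≤ b) :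
    SlacksGe m a Y :=
  ⟨hab.trans h.1, hab.trans h.2.1, hab.trans h.2.2.1, hab.trans h.2.2.2⟩

theorem edist_combine_le {Y Z : Plane} {R l : ℝ} (hl : 0 ≤ l) (hY : ‖Y‖ ≤ R) :
    edist Y ((1 - l) • Y + l • Z) ≤ ENNReal.ofReal (l * (R + ‖Z‖)) := by
  rw [edist_dist]
  refine ENNReal.ofReal_le_ofReal ?_
  have e : Y - ((1 - l) • Y + l • Z) = l • (Y - Z) := by module
  rw [dist_eq_norm, e, norm_smul, Real.norm_of_nonneg hl]
  gcongr
  exact (norm_sub_le _ _).trans (by linarith)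

/-- Since a point `Z` has positive slacks, moving a point by a small fraction of the way
towards `Z` makes its slacks larger by a fixed amount. This takes the almost admissible points of the
orbit tile to the quadrilateral, and the points of the quadrilateral to the orbit tile. -/
theorem tendsto_hausdorffEDist {m : ℕ} (hm : 1 ≤ m) :
    Tendsto (fun k : ℕ => Metric.hausdorffEDist
      (closure (rescale (m + 2) k '' orbitTile (tileWord (m + 2) k))) (quad (m + 2)))
      atTop (nhds 0) := by
  obtain ⟨Z, ρ, hρ, hZ⟩ := exists_slacksGe_pos m
  obtain ⟨C, hC, k₀, hk₀, hk⟩ := exists_slacksGe_of_mem m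
  obtain ⟨R, hR, hbound⟩ := norm_le_of_slacksGe m hC
  simp only [Metric.hausdorffEDist_closure_left]
  rw [ENNReal.tendsto_nhds_zero]
  intro ε hε
  -- a fraction `l` of the way to `Z` for which the displacement is at most `ε`
  obtain ⟨l, hl0, hl1, hlε⟩ : ∃ l : ℝ, 0 < l ∧ l < 1 ∧
      ENNReal.ofReal (l * (R + ‖Z‖)) ≤ ε := by
    have ht : Tendsto (fun l : ℝ => ENNReal.ofReal (l * (R + ‖Z‖))) (nhdsWithin 0 (Set.Ioi 0))
        (nhds 0) := by
      have h1 : Tendsto (fun l : ℝ => l * (R + ‖Z‖)) (nhdsWithin 0 (Set.Ioi 0))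
          (nhds (0 * (R + ‖Z‖))) := (tendsto_id.mono_left nhdsWithin_le_nhds).mul_const _
      simpa using ENNReal.tendsto_ofReal h1
    obtain ⟨l, ⟨h1, h2⟩, h3⟩ := ((show ∀ᶠ l in _, l ∈ Set.Ioo (0 : ℝ) 1 from Ioo_mem_nhdsGT (zero_lt_one' ℝ)).and
      (ht.eventually (ge_mem_nhds hε))).exists
    exact ⟨l, h1, h2, h3⟩
  have hl : 0 < l * ρ := mul_pos hl0 hρ
  filter_upwards [eventually_ge_atTop k₀, eventually_mem_of_slacksGe hm hl,
    eventually_div_le C (mul_pos hl (sub_pos.mpr hl1))] with k hkk hmem hsmall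
  have hk1 : (1 : ℝ) ≤ k := by exact_mod_cast hk₀.trans hkk
  refine Metric.hausdorffEDist_le_of_mem_edist (fun Y hY => ?_) (fun Y hY => ?_)
  · have hs := hk k hkk Y hY
    refine ⟨(1 - l) • Y + l • Z, ?_, (edist_combine_le hl0.le (hbound Y (hs.mono ?_))).trans hlε⟩
    · rw [mem_quad_iff hm]
      refine (hs.combine hZ (sub_nonneg.mpr hl1.le) hl0.le (by ring)).mono ?_
      have : C / k * (1 - l) ≤ l * ρ * 1 := by
        refine mul_le_mul (hsmall.trans ?_) (by linarith) (by linarith) hl.le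
        exact mul_le_of_le_one_right hl.le (by linarith)
      linarith
    · exact neg_le_neg (div_le_self hC hk1)
  · have hs := (mem_quad_iff hm Y).mp hY
    refine ⟨(1 - l) • Y + l • Z, hmem _ ?_,
      (edist_combine_le hl0.le (hbound Y (hs.mono (by linarith)))).trans hlε⟩
    refine (hs.combine hZ (sub_nonneg.mpr hl1.le) hl0.le (by ring)).mono ?_
    linarith

/-- All slacks are positive in the interior: both corner slacks decrease along the diagonal, and
both side slacks increase. -/
theorem exists_slacksGe_of_mem_interior {m : ℕ} (hm : 1 ≤ m) {Y : Plane}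
    (hY : Y ∈ interior (quad (m + 2))) : ∃ δ, 0 < δ ∧ SlacksGe m δ Y := by
  have hm' : (0 : ℝ) ≤ m := Nat.cast_nonneg m
  have hcont : Continuous fun t : ℝ => Y + t • (!₂[1, 1] : Plane) := by fun_prop
  have hnhds : ∀ᶠ t : ℝ in nhds 0, Y + t • (!₂[1, 1] : Plane) ∈ quad (m + 2) := by
    refine hcont.continuousAt.eventually (p := fun X => X ∈ quad (m + 2)) ?_
    simpa using mem_interior_iff_mem_nhds.mp hY
  obtain ⟨t, ht, hball⟩ := Metric.eventually_nhds_iff_ball.mp hnhds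
  have key : ∀ s : ℝ, |s| < t → SlacksGe m 0 (Y + s • (!₂[1, 1] : Plane)) := fun s hs =>
    (mem_quad_iff hm _).mp (hball s (by simpa using hs))
  have eval : ∀ s : ℝ, (Y + s • (!₂[1, 1] : Plane)) 0 = Y 0 + s ∧
      (Y + s • (!₂[1, 1] : Plane)) 1 = Y 1 + s := by
    intro s
    simp
  have corner : ∀ u v s : ℝ, cornerSlack m (u + s) (v + s) =
      cornerSlack m u v - 2 * ((m + 2) / (m + 1)) * s := by
    intro u v s
    simp only [cornerSlack]
    ring
  have side : ∀ u v s : ℝ, sideSlack m (u + s) (v + s) =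
      sideSlack m u v + 2 * ((m + 2) / (m + 1)) * s := by
    intro u v s
    rw [sideSlack_eq, sideSlack_eq, corner]
    ring
  have hpos : 0 < 2 * (((m : ℝ) + 2) / (m + 1)) * (t / 2) := by positivity
  have habs : |t / 2| < t := by
    rw [abs_of_pos (by positivity)]
    linarith
  have h1 := key (t / 2) habs
  have h2 := key (-(t / 2)) (by rwa [abs_neg])
  simp only [SlacksGe, (eval _).1, (eval _).2, corner, side] at h1 h2
  exact ⟨_, hpos, by linarith [h1.1], by linarith [h1.2.1], by linarith [h2.2.2.1],
    by linarith [h2.2.2.2]⟩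

theorem continuous_cornerSlack (m : ℕ) : Continuous fun p : ℝ × ℝ => cornerSlack m p.1 p.2 := by
  unfold cornerSlack
  fun_prop

theorem continuous_sideSlack (m : ℕ) : Continuous fun p : ℝ × ℝ => sideSlack m p.1 p.2 := by
  simp only [sideSlack_eq, cornerSlack]
  fun_prop

/-- The slacks are bounded below on compact subsets of the interior. -/
theorem exists_slacksGe_of_isCompact {m : ℕ} (hm : 1 ≤ m) {K : Set Plane} (hK : IsCompact K)
    (hsub : K ⊆ interior (quad (m + 2))) : ∃ δ, 0 < δ ∧ ∀ Y ∈ K, SlacksGe m δ Y := by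
  have bound : ∀ f : Plane → ℝ, Continuous f → (∀ Y ∈ K, 0 < f Y) →
      ∃ δ, 0 < δ ∧ ∀ Y ∈ K, δ ≤ f Y := fun f hf h =>
    hK.exists_forall_le' hf.continuousOn h
  have pos : ∀ Y ∈ K, ∃ δ, 0 < δ ∧ SlacksGe m δ Y := fun Y hY =>
    exists_slacksGe_of_mem_interior hm (hsub hY)
  have c0 : Continuous fun Y : Plane => (Y 0, Y 1) := by fun_prop
  have c1 : Continuous fun Y : Plane => (Y 1, Y 0) := by fun_prop
  obtain ⟨δ₁, p₁, h₁⟩ := bound _ ((continuous_cornerSlack m).comp c0) fun Y hY => by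
    obtain ⟨δ, hδ, h⟩ := pos Y hY
    exact hδ.trans_le h.1
  obtain ⟨δ₂, p₂, h₂⟩ := bound _ ((continuous_cornerSlack m).comp c1) fun Y hY => by
    obtain ⟨δ, hδ, h⟩ := pos Y hY
    exact hδ.trans_le h.2.1
  obtain ⟨δ₃, p₃, h₃⟩ := bound _ ((continuous_sideSlack m).comp c0) fun Y hY => by
    obtain ⟨δ, hδ, h⟩ := pos Y hY
    exact hδ.trans_le h.2.2.1
  obtain ⟨δ₄, p₄, h₄⟩ := bound _ ((continuous_sideSlack m).comp c1) fun Y hY => by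
    obtain ⟨δ, hδ, h⟩ := pos Y hY
    exact hδ.trans_le h.2.2.2
  refine ⟨min (min δ₁ δ₂) (min δ₃ δ₄), by positivity, fun Y hY => ⟨?_, ?_, ?_, ?_⟩⟩
  · exact ((min_le_left _ _).trans (min_le_left _ _)).trans (h₁ Y hY)
  · exact ((min_le_left _ _).trans (min_le_right _ _)).trans (h₂ Y hY)
  · exact ((min_le_right _ _).trans (min_le_left _ _)).trans (h₃ Y hY)
  · exact ((min_le_right _ _).trans (min_le_right _ _)).trans (h₄ Y hY)

end TriangularBilliards

theorem theorem1p6 (n : ℕ) (hn : 3 ≤ n) :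
    ConvexIndependent ℝ (TriangularBilliards.quadVertex n) ∧
    Filter.Tendsto
      (fun k : ℕ => Metric.hausdorffEDist
        (closure (TriangularBilliards.rescale n k ''
          TriangularBilliards.orbitTile (TriangularBilliards.tileWord n k)))
        (TriangularBilliards.quad n))
      Filter.atTop (nhds 0) ∧
    ∀ K : Set TriangularBilliards.Plane, IsCompact K →
      K ⊆ interior (TriangularBilliards.quad n) →
      ∀ᶠ k : ℕ in Filter.atTop,
        K ⊆ TriangularBilliards.rescale n k ''
          TriangularBilliards.orbitTile (TriangularBilliards.tileWord n k) := by
  obtain ⟨m, rfl⟩ : ∃ m, n = m + 2 := ⟨n - 2, by omega⟩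
  have hm : 1 ≤ m := by omega
  refine ⟨TriangularBilliards.convexIndependent_quadVertex hm,
    TriangularBilliards.tendsto_hausdorffEDist hm, fun K hK hsub => ?_⟩
  obtain ⟨δ, hδ, hslack⟩ := TriangularBilliards.exists_slacksGe_of_isCompact hm hK hsub
  filter_upwards [TriangularBilliards.eventually_mem_of_slacksGe hm hδ] with k hk Y hY
  exact hk Y (hslack Y hY)
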